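/- Let $k\ge 1$ be an integer, $p=k+2$, $\tilde q=e^{2\pi i/p}$, $\tilde q^{x}=e^{2\pi i x/p}$. For $\operatorname{Im}\tau>0$ put $$\Theta\!\begin{pmatrix}a\\0\end{pmatrix}(z,\tau)=\sum_{l\in\mathbb Z}e^{\pi i(l+a)^2\tau+2\pi i(l+a)z},\qquad E(z,\tau)=\frac{\Theta_1(z,\tau)}{\Theta_1'(0,\tau)},$$ with $\Theta_1$ the first Jacobi theta function and $\eta$ the Dedekind eta function. For $n\in\mathbb Z$, $\operatorname{Im}\tau>0$ and $-z=a+b\tau$ with $a,b\in(0,1)$, define the blocks $$F_n^+(z,\tau)=\int_0^1\omega_n(t,z,\tau),\qquad F_n^-(z,\tau)=F_{-n}^+(z,\tau),$$ $$\omega_n=\frac1{\eta^3(\tau)}\,\Theta\!\begin{pmatrix}\frac n{2p}\\0\end{pmatrix}(-z-2t,2p\tau)\,E(t,\tau)^{-1/p}E(z+t,\tau)^{-1/p}E(-z,\tau)^{1/(2p)}\,\frac{d^2}{dt^2}\ln\frac{E(z+t,\tau)}{E(t,\tau)}\,dt .$$ The integral is along the straight segment. It diverges at both endpoints like $\int_0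 t^{-2-1/p}dt$ and is understood as the Hadamard finite part: the limit as $\varepsilon\to0^+$ of $\int_\varepsilon^{1-\varepsilon}\omega_n-A\varepsilon^{-1-1/p}-B\varepsilon^{-1/p}$ for suitable $A,B\in\mathbb C$. The powers are $E(u,\tau)^\alpha=e^{\alpha\ln E(u,\tau)}$, where $\ln E(u,\tau)=\operatorname{Log}u+\ln\frac{E(u,\tau)}{u}$ with the principal $\operatorname{Log}$, and $\ln\frac{E(u,\tau)}u$ is continued from the value $0$ at $u=0$ along the segment $[0,u]$. Then: (1) These finite parts exist and are unique. Each $F_n^+$ extends to a holomorphic function $\widehat F_n^+$ of $(z,\tau)$ on the domain $\operatorname{Im}\tau>0$, $-z=a+b\tau$ with $0<a<1$, $-1<b<1$. (For each $\tau$ this parallelogram in $-z$ is convex and free of lattice points; passing in it from $b>0$ to $b<0$, across the interval $(0,1)$, is winding clockwise around the origin.) If $-z=a+b\tau$ with $a,b\in(0,1)$, then $(z/\tau,-1/\tau)$ lies in this domain, with negative second coordinate. (2) For every holomorphic extension $\widehat F_n^+$ as in (1), every $n\in\mathbb Z$, $\operatorname{Im}\tau>0$ and $-z=a+b\tau$ with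 $a,b\in(0,1)$, $$\widehat F_n^+\Big(\frac z\tau,-\frac1\tau\Big)=\tau^{3/(2p)}\sum_{\mu=1}^{p-2}C_{n\mu}\Big(F_\mu^+(z,\tau)+(-1)^nF_{p-\mu}^-(z,\tau)\Big),$$ $$C_{n\mu}=\frac{i}{\sqrt{2p}}\,\tilde q^{-n\mu/2}\,\frac{\tilde q^{\mu-n}-\tilde q^{2\mu-n}+\tilde q^{n\mu+2\mu}-\tilde q^{\mu}+\tilde q^{2\mu+1}-\tilde q^{n\mu+2\mu+1}}{(1-\tilde q^{\mu})(1-\tilde q^{\mu+1})},$$ with the principal branch of $\tau^{3/(2p)}$. (3) Let $V=[F_1^+,\dots,F_{p-2}^+,F_{p-1}^-,F_{p-2}^-,\dots,F_2^-]^T$ and $B=[F_{p-1}^-,F_{p-2}^+,F_{p-2}^-,\dots,F_2^+,F_2^-,F_1^+]^T$, let $\widehat V,\widehat B$ be the vectors of their continuations, and regard the blocks as densities in $z$ of weight $3/(2p)$, which removes the factor $\tau^{3/(2p)}$. With $$S'=\begin{pmatrix}(C_{n\mu})&((-1)^nC_{n\mu})\\((-1)^\mu C_{n\mu})&((-1)^{p+\mu+n}C_{n\mu})\end{pmatrix}\quad(1\le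 n,\mu\le p-2)$$ and $K$ the $2k\times2k$ permutation matrix with ones at $(2j-1,k+j)$ and $(2j,k+1-j)$, $j=1,\dots,k$, one has $B=KV$ and $$\tau^{-3/(2p)}\,\widehat V\Big(\frac z\tau,-\frac1\tau\Big)=S'\,V(z,\tau),\qquad \tau^{-3/(2p)}\,\widehat B\Big(\frac z\tau,-\frac1\tau\Big)=S\,B(z,\tau),\qquad S=KS'K^T .$$ Here $S$ has size $(2p-4)\times(2p-4)$. -/

import Mathlib

open Filter Topology MeasureTheory

noncomputable section

namespace TorusBlocks

/-- The theta function with characteristics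
`Θ[a; b](z, τ) = ∑_{l ∈ ℤ} exp (π i (l + a)² τ + 2 π i (l + a) (z + b))`. -/
def theta (a b z τ : ℂ) : ℂ :=
  ∑' l : ℤ, Complex.exp (Real.pi * Complex.I * ((l : ℂ) + a) ^ 2 * τ
    + 2 * Real.pi * Complex.I * ((l : ℂ) + a) * (z + b))

/-- The first Jacobi theta function
`Θ₁(z, τ) = 2 ∑_{l ≥ 0} (-1)^l exp (π i (l + 1/2)² τ) sin ((2 l + 1) π z) = -Θ[1/2; 1/2](z, τ)`. -/
def theta1 (z τ : ℂ) : ℂ := -theta (1 / 2) (1 / 2) z τ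

/-- The prime form `E(z, τ) = Θ₁(z, τ) / Θ₁'(0, τ)`. -/
def primeForm (z τ : ℂ) : ℂ := theta1 z τ / deriv (fun v => theta1 v τ) 0

/-- The logarithm of the prime form that behaves like the principal `log u` as `u → 0`: the function
`E(u, τ) / u` is entire in `u`, equal to `1` at `u = 0`, and its logarithm is continued from the
value `0` at `u = 0` along the straight segment from `0` to `u`. -/
def logPrimeForm (u τ : ℂ) : ℂ :=
  Complex.log u +
    ∫ s in (0 : ℝ)..1, (u * logDeriv (fun v => primeForm v τ) ((s : ℂ) * u) - 1 / (s : ℂ))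

/-- The power `E(u, τ)^α`, for the above branch of the logarithm. -/
def primePow (u τ α : ℂ) : ℂ := Complex.exp (α * logPrimeForm u τ)

/-- The coefficient of `dt` in the one-form `ω_μ(t, z, τ)`:
`η(τ)⁻³ Θ[μ/2p; 0](-z-2t, 2pτ) E(t,τ)^(-1/p) E(z+t,τ)^(-1/p) E(-z,τ)^(1/2p)
  · d²/dt² ln (E(z+t,τ)/E(t,τ))`.
The first derivative of `ln` is written as a logarithmic derivative, which needs no branch. -/
def blockForm (p : ℕ) (μ : ℤ) (z τ t : ℂ) : ℂ :=
  1 / ModularForm.eta τ ^ 3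
    * theta ((μ : ℂ) / (2 * (p : ℂ))) 0 (-z - 2 * t) (2 * (p : ℂ) * τ)
    * primePow t τ (-1 / (p : ℂ))
    * primePow (z + t) τ (-1 / (p : ℂ))
    * primePow (-z) τ (1 / (2 * (p : ℂ)))
    * deriv (logDeriv (fun s : ℂ => primeForm (z + s) τ / primeForm s τ)) t

/-- `I` is the (Hadamard) finite part of `∫₀¹ f(t) dt`, for an integrand with singularities of the
type `t^(-2-1/p) · (power series in t)` at `t = 0`, and likewise at `t = 1`: it is what remains, as
`ε → 0⁺`, of the integral over `[ε, 1-ε]` after the divergent powers `ε^(-1-1/p)` and `ε^(-1/p)` have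
been subtracted. As the exponents are not integers, this is the value obtained by analytic
continuation in the exponent of `t` (or from a Pochhammer-type twisted cycle). -/
def HasFinitePart (p : ℕ) (f : ℝ → ℂ) (I : ℂ) : Prop :=
  (∀ ε : ℝ, 0 < ε → ε < 1 / 2 → IntervalIntegrable f volume ε (1 - ε)) ∧
  ∃ A B : ℂ, Tendsto (fun ε : ℝ => (∫ t in ε..(1 - ε), f t)
      - A * ((ε ^ (-1 - 1 / (p : ℝ)) : ℝ) : ℂ) - B * ((ε ^ (-(1 / (p : ℝ))) : ℝ) : ℂ))
    (𝓝[>] 0) (𝓝 I)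

open Classical in
/-- The finite part of `∫₀¹ f(t) dt` (and `0` if there is none). -/
def finitePart (p : ℕ) (f : ℝ → ℂ) : ℂ :=
  if h : ∃ I, HasFinitePart p f I then h.choose else 0

/-- The block `F_n^+(z, τ)`, the regularized integral of `ω_n` along the straight segment from
`0` to `1`. -/
def blockPlus (p : ℕ) (n : ℤ) (z τ : ℂ) : ℂ :=
  finitePart p (fun t : ℝ => blockForm p n z τ (t : ℂ))

/-- The block `F_n^-(z, τ) = F_{-n}^+(z, τ)`. -/
def blockMinus (p : ℕ) (n : ℤ) (z τ : ℂ) : ℂ := blockPlus p (-n) z τ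

/-- The pairs `(z, τ)` with `Im τ > 0` and `-z` in the open fundamental parallelogram with vertices
`0, 1, 1 + τ, τ`. -/
def cell : Set (ℂ × ℂ) :=
  {x | 0 < x.2.im ∧ ∃ a b : ℝ, 0 < a ∧ a < 1 ∧ 0 < b ∧ b < 1 ∧ -x.1 = (a : ℂ) + (b : ℂ) * x.2}

/-- The pairs `(z, τ)` with `Im τ > 0` and `-z` in the open parallelogram with vertices
`-τ, 1 - τ, 1 + τ, τ`: the cell above the interval `(0, 1)`, the interval `(0, 1)` itself, and the
cell below it. For each `τ` this parallelogram is convex and contains no lattice point. Inside it,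
going from the upper to the lower cell (across `(0, 1)`) is winding clockwise around the
origin. -/
def doubleCell : Set (ℂ × ℂ) :=
  {x | 0 < x.2.im ∧ ∃ a b : ℝ, 0 < a ∧ a < 1 ∧ -1 < b ∧ b < 1 ∧ -x.1 = (a : ℂ) + (b : ℂ) * x.2}

/-- `G` is the holomorphic continuation of `f` from the upper cells, clockwise around the origin,
to the lower cells. If `(z, τ) ∈ cell`, then `(z/τ, -1/τ) ∈ doubleCell` (in the lower cell). -/
def IsClockwiseContinuation (f : ℂ → ℂ → ℂ) (G : ℂ × ℂ → ℂ) : Prop :=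
  DifferentiableOn ℂ G doubleCell ∧ ∀ x ∈ cell, G x = f x.1 x.2

/-- `q̃ ^ x`, where `q̃ = exp (2 π i / p)`. -/
def qt (p : ℕ) (x : ℂ) : ℂ := Complex.exp (2 * Real.pi * Complex.I / (p : ℂ) * x)

/-- The coefficient `C_{nμ}`. -/
def coeffC (p : ℕ) (n μ : ℤ) : ℂ :=
  Complex.I / ((Real.sqrt (2 * (p : ℝ)) : ℝ) : ℂ) * qt p (-((n : ℂ) * μ) / 2) *
    ((qt p ((μ : ℂ) - n) - qt p (2 * (μ : ℂ) - n) + qt p ((n : ℂ) * μ + 2 * μ) - qt p μ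
        + qt p (2 * (μ : ℂ) + 1) - qt p ((n : ℂ) * μ + 2 * μ + 1)) /
      ((1 - qt p μ) * (1 - qt p ((μ : ℂ) + 1))))

/-- The block matrix `S'`, with `p = k + 2` and `n`, `μ` running from `1` to `k = p - 2`:
rows `(C_{nμ}, (-1)^n C_{nμ})` and `((-1)^μ C_{nμ}, (-1)^(p+μ+n) C_{nμ})`. -/
def matS' (k : ℕ) : Matrix (Fin (k + k)) (Fin (k + k)) ℂ :=
  let C : Fin k → Fin k → ℂ := fun n μ => coeffC (k + 2) ((n : ℤ) + 1) ((μ : ℤ) + 1)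
  Matrix.reindex finSumFinEquiv finSumFinEquiv
    (Matrix.fromBlocks
      (Matrix.of C)
      (Matrix.of fun n μ => (-1) ^ ((n : ℕ) + 1) * C n μ)
      (Matrix.of fun n μ => (-1) ^ ((μ : ℕ) + 1) * C n μ)
      (Matrix.of fun n μ => (-1) ^ ((k + 2) + ((μ : ℕ) + 1) + ((n : ℕ) + 1)) * C n μ))

/-- The permutation matrix `K` with ones at the positions `(1, k+1), (2, k), (3, k+2), (4, k-1),
…, (2k-1, 2k), (2k, 1)` (counted from `1`) and zeros elsewhere. Counted from `0`, row `2m` has its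
one in column `k + m` and row `2m + 1` has its one in column `k - 1 - m`. -/
def matK (k : ℕ) : Matrix (Fin (k + k)) (Fin (k + k)) ℂ :=
  Matrix.of fun i j =>
    if ((i : ℕ) % 2 = 0 ∧ (j : ℕ) = k + (i : ℕ) / 2) ∨
        ((i : ℕ) % 2 = 1 ∧ (j : ℕ) + (i : ℕ) / 2 + 1 = k) then 1 else 0

/-- The S matrix `S = K S' Kᵀ`, of size `2k = 2p - 4`. -/
def matS (k : ℕ) : Matrix (Fin (k + k)) (Fin (k + k)) ℂ :=
  matK k * matS' k * (matK k).transpose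

/-- The ordering `[F_1^+, F_2^+, …, F_{p-2}^+, F_{p-1}^-, F_{p-2}^-, …, F_2^-]` (with `p = k + 2`)
of values `f n = F_n^+`, `f (-n) = F_n^-`. -/
def separatedOrder (k : ℕ) (f : ℤ → ℂ) : Fin (k + k) → ℂ := fun i =>
  if (i : ℕ) < k then f ((i : ℤ) + 1) else f (-(2 * (k : ℤ) + 1 - i))

/-- The ordering `[F_{p-1}^-, F_{p-2}^+, F_{p-2}^-, …, F_2^+, F_2^-, F_1^+]` (with `p = k + 2`) of
values `f n = F_n^+`, `f (-n) = F_n^-`: counted from `0`, the entry `2m` is `F_{p-1-m}^-` and the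
entry `2m + 1` is `F_{p-2-m}^+`. -/
def alternatingOrder (k : ℕ) (f : ℤ → ℂ) : Fin (k + k) → ℂ := fun i =>
  if (i : ℕ) % 2 = 0 then f (-((k : ℤ) + 1 - (i : ℤ) / 2)) else f ((k : ℤ) - (i : ℤ) / 2)

end TorusBlocks

end

/-! Up to a factor independent of t, the form ω_n is `core`, a multivalued function of t branched
over the lattice and over its translate by -z. Its primitive `prim` is normalised at t = 0 by the
finite part. Because the exponents -1-1/p and -1/p are nonzero, a rescaling of the cut-off changes
only the coefficients of the divergent powers, so `prim` really is a primitive (`hasDerivAt_prim`).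
Two integrations by parts show that it is holomorphic in all variables (`differentiableOn_prim`).
Every contour deformation then says that a combination of values of `prim` has derivative zero along
a segment.

The symmetries t ↦ 1-t, t ↦ -t, t ↦ t+τ and the exchange of 0 with -z carry `core` to multiples of
`core` with another index (`core_one_sub`, `core_neg`, `core_add_tau`, `core_swap`). Hence integrals
that end at 1, -z or τ are expressed by primitives based at 0.

Under inversion, the integral over [0, 1] for (z/τ, -1/τ) becomes an integral over [0, τ]. Jacobi's
inversion turns the theta function of index n into a sum over all indices μ modulo 2p, the Gaussian
factors cancel, and the weight τ^(3/(2p)) remains (`prefactor_mul_core_div`). This is valid for -z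
to the left of the segment [0, τ]. Bending the path through 1/2 - z gives `transBlock`, which stays
holomorphic when -z crosses that segment. This provides the continuation
(`isClockwiseContinuation_contBlock`), and the identity theorem makes it unique.

With -z on the other side, the bent path is the sum of the paths 0 → -z and -z → τ, with integrals
X_μ and Y_μ (`coreX_add_coreY`). Contour arguments give, with F_n the block, (1 - q̃^(-n)) X_n = F_n
+ q̃^(-n) F_(-n) and (1 - q̃^(1-n)) Y_n = -q̃^(-n) F_(-n) - q̃^(-1) F_(n-2), together with X_(-n) =
-X_n, Y_(2-n) = -Y_n and period 2p in n (`coreX_relation`, `coreY_relation`). The rest is finite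
algebra: solving for X and Y, reindexing the sum, and folding residues modulo 2p into pairs μ, μ+p.
The relations also force F_n = 0 for n ≡ 0 and n ≡ -1 modulo p, so only μ = 1, …, p-2 survive
(`BlockRelations.sum_eq_coeffC`). -/

noncomputable section

namespace TorusBlocks

/-! ### Holomorphic dependence of integrals and derivatives on parameters -/

section ParametricIntegrals

open Metric Set
open scoped Interval

variable {E : Type*} [NormedAddCommGroup E] [NormedSpace ℂ E]

/-- A holomorphic parameter may be differentiated under a weighted integral over a compact
interval. -/
theorem differentiableOn_intervalIntegral [ProperSpace E] {U : Set E} (hU : IsOpen U)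
    {f : E → ℝ → ℂ} {g : ℝ → ℂ} {a b : ℝ} (hab : a ≤ b)
    (hf : ContinuousOn (Function.uncurry f) (U ×ˢ Icc a b))
    (hd : ∀ s ∈ Icc a b, DifferentiableOn ℂ (fun x => f x s) U)
    (hg : IntervalIntegrable g volume a b) :
    DifferentiableOn ℂ (fun x => ∫ s in a..b, g s * f x s) U := by
  intro x₀ hx₀
  apply DifferentiableAt.differentiableWithinAt
  obtain ⟨r, hr, hrU⟩ : ∃ r > 0, closedBall x₀ (2 * r) ⊆ U := by
    obtain ⟨ε, hε, h⟩ := Metric.isOpen_iff.1 hU x₀ hx₀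
    exact ⟨ε / 4, by positivity, (closedBall_subset_ball (by linarith)).trans h⟩
  have hcomp : IsCompact (closedBall x₀ (2 * r) ×ˢ Icc a b) :=
    (isCompact_closedBall _ _).prod isCompact_Icc
  have hf' : ContinuousOn (Function.uncurry f) (closedBall x₀ (2 * r) ×ˢ Icc a b) :=
    hf.mono (prod_mono hrU subset_rfl)
  obtain ⟨M, hM⟩ := hcomp.exists_bound_of_continuousOn hf'
  have hIoc : Ι a b ⊆ Icc a b := by rw [uIoc_of_le hab]; exact Ioc_subset_Icc_self
  have hball : ∀ x ∈ ball x₀ r, ball x r ⊆ closedBall x₀ (2 * r) := fun x hx =>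
    (ball_subset_ball' (by rw [mem_ball] at hx; linarith)).trans ball_subset_closedBall
  -- Cauchy's estimate: the bound M on the ball of radius 2r controls the derivative on the ball of
  -- radius r uniformly in s. This is the dominating function.
  have hbound : ∀ s ∈ Icc a b, ∀ x ∈ ball x₀ r,
      ‖fderiv ℂ (fun x => f x s) x‖ ≤ (2 * M) / r := by
    intro s hs x hx
    refine Complex.norm_fderiv_le_div_of_mapsTo_ball
      ((hd s hs).mono ((hball x hx).trans hrU)) (fun y hy => ?_) hr
    have h1 := hM (y, s) ⟨hball x hx hy, hs⟩
    have h2 := hM (x, s) ⟨hball x hx (mem_ball_self hr), hs⟩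
    rw [mem_closedBall, dist_eq_norm]
    exact (norm_sub_le _ _).trans (by simp only [Function.uncurry] at h1 h2; linarith)
  have hcs : ∀ x ∈ U, ContinuousOn (f x) (Icc a b) := fun x hx =>
    hf.comp (f := fun s : ℝ => (x, s)) (by fun_prop) (fun s hs => ⟨hx, hs⟩)
  -- Continuity in s serves only for measurability. Uniform continuity makes f(·, s) - f(·, s₀)
  -- small on a ball, and Cauchy's estimate passes this to the derivatives.
  have hcd : ContinuousOn (fun s => fderiv ℂ (fun x => f x s) x₀) (Icc a b) := by
    intro s₀ hs₀
    rw [ContinuousWithinAt, Metric.tendsto_nhds]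
    intro ε hε
    have hunif := hcomp.uniformContinuousOn_of_continuous hf'
    rw [Metric.uniformContinuousOn_iff] at hunif
    obtain ⟨δ, hδ, h⟩ := hunif (ε * r / 4) (by positivity)
    filter_upwards [self_mem_nhdsWithin, mem_nhdsWithin_of_mem_nhds (ball_mem_nhds s₀ hδ)]
      with s hs hsδ
    have hx : ∀ x ∈ ball x₀ r, ‖f x s - f x s₀‖ ≤ ε * r / 4 := fun x hx => by
      have hx' := hball x hx (mem_ball_self hr)
      have := h (x, s) ⟨hx', hs⟩ (x, s₀) ⟨hx', hs₀⟩ (by simpa [Prod.dist_eq, hδ] using hsδ)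
      rw [← dist_eq_norm]
      exact this.le
    have hU₀ : U ∈ 𝓝 x₀ := hU.mem_nhds hx₀
    have hsub : fderiv ℂ (fun x => f x s) x₀ - fderiv ℂ (fun x => f x s₀) x₀ =
        fderiv ℂ (fun x => f x s - f x s₀) x₀ :=
      (fderiv_fun_sub ((hd s hs).differentiableAt hU₀) ((hd s₀ hs₀).differentiableAt hU₀)).symm
    rw [dist_eq_norm, hsub]
    have hrU' : ball x₀ r ⊆ U := (hball x₀ (mem_ball_self hr)).trans hrU
    have := Complex.norm_fderiv_le_div_of_mapsTo_ball (R₂ := ε * r / 2)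
      (((hd s hs).sub (hd s₀ hs₀)).mono hrU') (fun y hy => ?_) hr
    · refine lt_of_le_of_lt this ?_
      rw [div_lt_iff₀ hr]; nlinarith
    · rw [mem_closedBall, dist_eq_norm]
      refine (norm_sub_le _ _).trans ?_
      have h1 := hx y hy
      have h2 := hx x₀ (mem_ball_self hr)
      simp only [Pi.sub_apply] at *
      linarith
  have hmul : ∀ x ∈ U, IntervalIntegrable (fun s => g s * f x s) volume a b := fun x hx =>
    hg.mul_continuousOn (by rw [uIcc_of_le hab]; exact hcs x hx)
  refine (intervalIntegral.hasFDerivAt_integral_of_dominated_of_fderiv_le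
    (F := fun x s => g s * f x s) (F' := fun x s => g s • fderiv ℂ (fun x => f x s) x)
    (bound := fun s => ‖g s‖ * ((2 * M) / r)) (s := ball x₀ r) (ball_mem_nhds x₀ hr) ?_ (hmul x₀ hx₀)
    ?_ ?_ (hg.norm.mul_const _) ?_).differentiableAt
  · filter_upwards [hU.mem_nhds hx₀] with x hx
    exact ((intervalIntegrable_iff.1 (hmul x hx)).aestronglyMeasurable)
  · refine (intervalIntegrable_iff.1 hg).aestronglyMeasurable.smul ?_
    exact (hcd.mono hIoc).aestronglyMeasurable measurableSet_uIoc
  · refine Eventually.of_forall fun s hs x hx => ?_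
    rw [norm_smul]
    exact mul_le_mul_of_nonneg_left (hbound s (hIoc hs) x hx) (norm_nonneg _)
  · refine Eventually.of_forall fun s hs x hx => ?_
    have hxU : U ∈ 𝓝 x := hU.mem_nhds (hrU (hball x hx (mem_ball_self hr)))
    exact ((hd s (hIoc hs)).differentiableAt hxU).hasFDerivAt.const_mul (g s)

/-- The partial derivative of a jointly holomorphic function is jointly holomorphic. -/
theorem differentiableOn_partialDeriv [ProperSpace E] {W : Set (E × ℂ)} (hW : IsOpen W)
    {f : E → ℂ → ℂ} (hf : DifferentiableOn ℂ (Function.uncurry f) W) :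
    DifferentiableOn ℂ (fun y : E × ℂ => deriv (f y.1) y.2) W := by
  intro y₀ hy₀
  apply DifferentiableAt.differentiableWithinAt
  obtain ⟨ε, hε, hεW⟩ := Metric.isOpen_iff.1 hW y₀ hy₀
  set r := ε / 2 with hr
  have hr0 : 0 < r := by positivity
  have hmem : ∀ y ∈ ball y₀ r, ∀ w : ℂ, ‖w‖ ≤ r → (y.1, y.2 + w) ∈ W := fun y hy w hw => by
    apply hεW
    rw [mem_ball, Prod.dist_eq, max_lt_iff] at hy ⊢
    refine ⟨hy.1.trans (by linarith), ?_⟩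
    have : dist (y.2 + w) y.2 ≤ r := by simpa [dist_eq_norm] using hw
    linarith [dist_triangle (y.2 + w) y.2 y₀.2, hy.2]
  -- Cauchy's formula over a circle of one radius r for all y near y₀ reduces the claim to a
  -- parametric integral.
  have hrepr : ∀ y ∈ ball y₀ r, deriv (f y.1) y.2 =
      ∫ θ in (0 : ℝ)..(2 * Real.pi), (2 * Real.pi * r : ℂ)⁻¹ *
        (Complex.exp (-(θ * Complex.I)) * f y.1 (y.2 + r * Complex.exp (θ * Complex.I))) := by
    intro y hy
    have hd : DifferentiableOn ℂ (f y.1) (closedBall y.2 r) := by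
      intro w hw
      have hw' : (y.1, w) ∈ W := by
        have := hmem y hy (w - y.2) (by simpa [dist_eq_norm] using hw)
        simpa using this
      have h1 : DifferentiableAt ℂ (Function.uncurry f) (y.1, w) :=
        hf.differentiableAt (hW.mem_nhds hw')
      have h2 : DifferentiableAt ℂ (fun w : ℂ => (y.1, w)) w := by fun_prop
      exact (h1.comp w h2).differentiableWithinAt
    have key := hd.deriv_eq_smul_circleIntegral hr0
    have hne : (2 * Real.pi * Complex.I : ℂ) ≠ 0 := Complex.two_pi_I_ne_zero
    have hrc : (r : ℂ) ≠ 0 := by exact_mod_cast hr0.ne'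
    have hpi : (Real.pi : ℂ) ≠ 0 := by exact_mod_cast Real.pi_ne_zero
    rw [smul_eq_mul, circleIntegral] at key
    have : deriv (f y.1) y.2 = (2 * Real.pi * Complex.I : ℂ)⁻¹ *
        (2 * Real.pi * Complex.I * deriv (f y.1) y.2) := by field_simp
    rw [this, ← key, ← intervalIntegral.integral_const_mul]
    refine intervalIntegral.integral_congr fun θ _ => ?_
    simp only [deriv_circleMap, circleMap, smul_eq_mul, add_sub_cancel_left, Complex.exp_neg]
    have := Complex.exp_ne_zero (θ * Complex.I)
    simp only [zero_add]
    field_simp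
  have hD : DifferentiableOn ℂ (fun y : E × ℂ => ∫ θ in (0 : ℝ)..(2 * Real.pi),
      (2 * Real.pi * r : ℂ)⁻¹ * (Complex.exp (-(θ * Complex.I)) *
        f y.1 (y.2 + r * Complex.exp (θ * Complex.I)))) (ball y₀ r) := by
    have hn : ∀ θ : ℝ, ‖(r : ℂ) * Complex.exp (θ * Complex.I)‖ ≤ r := fun θ => by
      rw [norm_mul, Complex.norm_exp_ofReal_mul_I, mul_one, Complex.norm_real, Real.norm_eq_abs,
        abs_of_pos hr0]
    refine differentiableOn_intervalIntegral isOpen_ball (by positivity) ?_ ?_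
      intervalIntegrable_const
    · refine ContinuousOn.mul (by fun_prop) ?_
      have : ContinuousOn (Function.uncurry f ∘ fun x : (E × ℂ) × ℝ =>
          (x.1.1, x.1.2 + r * Complex.exp (x.2 * Complex.I)))
          (ball y₀ r ×ˢ Icc 0 (2 * Real.pi)) :=
        hf.continuousOn.comp (by fun_prop) (fun x hx => hmem _ hx.1 _ (hn _))
      exact this
    · intro θ _
      refine DifferentiableOn.mul (by fun_prop) ?_
      have : DifferentiableOn ℂ (Function.uncurry f ∘ fun x : E × ℂ =>
          (x.1, x.2 + r * Complex.exp (θ * Complex.I))) (ball y₀ r) :=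
        hf.comp (by fun_prop) (fun x hx => hmem _ hx _ (hn _))
      exact this
  refine (hD.differentiableAt (ball_mem_nhds y₀ hr0)).congr_of_eventuallyEq ?_
  filter_upwards [ball_mem_nhds y₀ hr0] with y hy using hrepr y hy

end ParametricIntegrals

/-! ### The theta function Θ₁: quasi-periods, inversion and zeros -/

section ThetaOne

open Set
open Complex (I exp exp_add)
open scoped Real

theorem exp_pi_mul_I_eq : exp (π * I) = -1 := Complex.exp_pi_mul_I

theorem theta_eq_jacobiTheta₂ (a b z τ : ℂ) :
    theta a b z τ =
      exp (π * I * a ^ 2 * τ + 2 * π * I * a * (z + b)) * jacobiTheta₂ (z + b + a * τ) τ := by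
  rw [theta, jacobiTheta₂, ← tsum_mul_left]
  refine tsum_congr fun n => ?_
  rw [jacobiTheta₂_term, ← exp_add]
  congr 1; ring

theorem theta1_eq (z τ : ℂ) :
    theta1 z τ = -(exp (π * I * τ / 4 + π * I * (z + 1 / 2)) *
      jacobiTheta₂ (z + 1 / 2 + τ / 2) τ) := by
  rw [theta1, theta_eq_jacobiTheta₂]
  ring_nf

theorem exp_int_mul_two_pi (n : ℤ) : exp (n * (2 * π * I)) = 1 := Complex.exp_int_mul_two_pi_mul_I n

theorem theta1_add_one (z τ : ℂ) : theta1 (z + 1) τ = -theta1 z τ := by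
  rw [theta1_eq, theta1_eq, show z + 1 + 1 / 2 + τ / 2 = (z + 1 / 2 + τ / 2) + 1 by ring,
    jacobiTheta₂_add_left, show π * I * τ / 4 + π * I * (z + 1 + 1 / 2) =
      (π * I * τ / 4 + π * I * (z + 1 / 2)) + π * I by ring, exp_add, exp_pi_mul_I_eq]
  ring

theorem theta1_add_tau (z τ : ℂ) :
    theta1 (z + τ) τ = -(exp (-(π * I * τ) - 2 * π * I * z) * theta1 z τ) := by
  rw [theta1_eq, theta1_eq, show z + τ + 1 / 2 + τ / 2 = (z + 1 / 2 + τ / 2) + τ by ring,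
    jacobiTheta₂_add_left', mul_neg, ← mul_assoc, ← mul_assoc, ← exp_add, ← exp_add]
  rw [show π * I * τ / 4 + π * I * (z + τ + 1 / 2) + -π * I * (τ + 2 * (z + 1 / 2 + τ / 2)) =
    (-(π * I * τ) - 2 * π * I * z + (π * I * τ / 4 + π * I * (z + 1 / 2))) - π * I by ring,
    Complex.exp_sub, exp_pi_mul_I_eq]
  ring

theorem theta1_neg (z τ : ℂ) : theta1 (-z) τ = -theta1 z τ := by
  rw [theta1_eq, theta1_eq, ← jacobiTheta₂_neg_left,
    show z + 1 / 2 + τ / 2 = (-(-z + 1 / 2 + τ / 2) + τ) + 1 by ring, jacobiTheta₂_add_left,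
    jacobiTheta₂_add_left', ← mul_assoc, ← exp_add]
  rw [show π * I * τ / 4 + π * I * (z + 1 / 2) + -π * I * (τ + 2 * -(-z + 1 / 2 + τ / 2)) =
    (π * I * τ / 4 + π * I * (-z + 1 / 2)) + π * I by ring,
    exp_add _ (π * I), exp_pi_mul_I_eq]
  ring

theorem theta1_zero (τ : ℂ) : theta1 0 τ = 0 := by
  have := theta1_neg 0 τ
  rw [neg_zero] at this
  exact self_eq_neg.1 this

/-- The constant may stay anonymous: it depends on τ only and cancels in the quotient that defines
the prime form. -/
theorem exists_theta1_div (τ : ℂ) (hτ : 0 < τ.im) : ∃ C : ℂ, C ≠ 0 ∧ ∀ z : ℂ,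
    theta1 (z / τ) (-1 / τ) = C * exp (π * I * z ^ 2 / τ) * theta1 z τ := by
  have hτ0 : τ ≠ 0 := by rintro rfl; simp at hτ
  have hc : (-I * τ) ^ (1 / 2 : ℂ) ≠ 0 := by
    rw [Complex.cpow_def_of_ne_zero (by simp [hτ0])]; exact Complex.exp_ne_zero _
  refine ⟨(-I * τ) ^ (1 / 2 : ℂ) * exp (-(π * I / 2)), mul_ne_zero hc (Complex.exp_ne_zero _),
    fun z => ?_⟩
  have key := jacobiTheta₂_functional_equation (z + 1 / 2 + τ / 2 - 1) τ
  have h1 : jacobiTheta₂ (z + 1 / 2 + τ / 2) τ = jacobiTheta₂ (z + 1 / 2 + τ / 2 - 1) τ := by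
    rw [← jacobiTheta₂_add_left (z + 1 / 2 + τ / 2 - 1), sub_add_cancel]
  rw [theta1_eq, theta1_eq, h1, key,
    show z / τ + 1 / 2 + -1 / τ / 2 = (z + 1 / 2 + τ / 2 - 1) / τ by field_simp; ring]
  generalize jacobiTheta₂ _ _ = J
  have : exp (π * I * (-1 / τ) / 4 + π * I * (z / τ + 1 / 2)) =
      exp (-(π * I / 2)) * exp (π * I * z ^ 2 / τ) *
        exp (π * I * τ / 4 + π * I * (z + 1 / 2)) *
        exp (-π * I * (z + 1 / 2 + τ / 2 - 1) ^ 2 / τ) := by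
    rw [← exp_add, ← exp_add, ← exp_add]
    congr 1
    field_simp
    ring
  rw [this]
  field_simp

theorem differentiable_theta1 {τ : ℂ} (hτ : 0 < τ.im) :
    Differentiable ℂ (fun z => theta1 z τ) := by
  intro z
  simp_rw [theta1_eq]
  refine DifferentiableAt.neg (DifferentiableAt.mul (by fun_prop) ?_)
  exact (differentiableAt_jacobiTheta₂_fst _ hτ).comp z (by fun_prop)

/-- The `n`-th Fourier coefficient of a `1`-periodic entire function. -/
def fourierInt (F : ℂ → ℂ) (n : ℤ) : ℂ := ∫ x in (0 : ℝ)..1, exp (-(2 * π * I * n * x)) * F x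

/-- Cauchy's theorem on a rectangle of width 1, whose vertical sides cancel by periodicity. -/
theorem intervalIntegral_add_right_of_periodic {G : ℂ → ℂ} (hG : Differentiable ℂ G)
    (hper : ∀ u, G (u + 1) = G u) (w : ℂ) :
    ∫ x in (0 : ℝ)..1, G (x + w) = ∫ x in (0 : ℝ)..1, G x := by
  have h1 := Complex.integral_boundary_rect_eq_zero_of_differentiableOn G (w.re : ℂ) (w + 1)
    hG.differentiableOn
  have h2 : ∀ y : ℝ, G (((w + 1).re : ℂ) + y * I) = G (w.re + y * I) := fun y => by
    rw [← hper (w.re + y * I)]; congr 1; push_cast [Complex.add_re, Complex.one_re]; ring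
  simp only [h2] at h1
  simp only [Complex.ofReal_im, Complex.ofReal_zero, zero_mul, add_zero, Complex.ofReal_re,
    add_sub_cancel_right, Complex.add_re, Complex.one_re, Complex.add_im,
    Complex.one_im] at h1
  have hp : Function.Periodic (fun x : ℝ => G x) 1 := fun x => by
    simpa using hper x
  have h3 := hp.intervalIntegral_add_eq w.re 0
  rw [zero_add] at h3
  rw [← h3, sub_eq_zero.1 h1]
  have := intervalIntegral.integral_comp_add_right (a := 0) (b := 1)
    (fun x : ℝ => G (x + w.im * I)) w.re
  rw [zero_add, add_comm 1] at this
  rw [← this]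
  refine intervalIntegral.integral_congr fun x _ => ?_
  simp only [Complex.ofReal_add, add_assoc, Complex.re_add_im]

/-- Moving the contour by τ links consecutive Fourier coefficients. Hence the zeroth one determines
all, and the functions with these two periodicity laws form a space of dimension at most one. -/
theorem fourierInt_succ {F : ℂ → ℂ} (hF : Differentiable ℂ F) (hper : ∀ u, F (u + 1) = F u)
    {τ : ℂ} (hq : ∀ u, F (u + τ) = -(exp (-(2 * π * I * u)) * F u)) (n : ℤ) :
    fourierInt F n = -exp (-(2 * π * I * n * τ)) * fourierInt F (n + 1) := by
  have h := intervalIntegral_add_right_of_periodic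
    (G := fun u => exp (-(2 * π * I * n * u)) * F u) (by fun_prop) (fun u => by
      simp only [hper]
      rw [show -(2 * π * I * n * (u + 1)) = -(2 * π * I * n * u) + (-n : ℤ) * (2 * π * I) by
        push_cast; ring, exp_add, exp_int_mul_two_pi, mul_one]) τ
  rw [fourierInt, ← h, fourierInt, ← intervalIntegral.integral_const_mul]
  refine intervalIntegral.integral_congr fun x _ => ?_
  simp only [hq]
  rw [show -(2 * π * I * (n + 1 : ℤ) * x) = -(2 * π * I * n * x) + -(2 * π * I * x) by
    push_cast; ring, mul_add, neg_add, exp_add, exp_add]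
  ring

theorem fourierInt_eq_zero {F : ℂ → ℂ} (hF : Differentiable ℂ F) (hper : ∀ u, F (u + 1) = F u)
    {τ : ℂ} (hq : ∀ u, F (u + τ) = -(exp (-(2 * π * I * u)) * F u)) (h0 : fourierInt F 0 = 0)
    (n : ℤ) : fourierInt F n = 0 := by
  have hs := fourierInt_succ hF hper hq
  induction n using Int.induction_on with
  | zero => exact h0
  | succ n ih =>
    have := hs n
    rw [ih, eq_comm, mul_eq_zero] at this
    simpa [Complex.exp_ne_zero] using this
  | pred n ih => rw [hs, show -(n : ℤ) - 1 + 1 = -n by ring, ih, mul_zero]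

/-- The Fourier series, being trivially summable, converges to F pointwise on the real line. The
identity theorem does the rest. -/
theorem eq_zero_of_fourierInt {F : ℂ → ℂ} (hF : Differentiable ℂ F)
    (hper : ∀ u, F (u + 1) = F u) (h : ∀ n, fourierInt F n = 0) : F = 0 := by
  have : Fact (0 < (1 : ℝ)) := ⟨one_pos⟩
  have hp : Function.Periodic (fun x : ℝ => F x) 1 := fun x => by simpa using hper x
  have hcont : Continuous (fun x : ℝ => F x) := hF.continuous.comp Complex.continuous_ofReal
  let f : C(AddCircle (1 : ℝ), ℂ) := ⟨hp.lift, continuous_coinduced_dom.2 hcont⟩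
  have hcoeff : fourierCoeff f = 0 := by
    funext n
    rw [fourierCoeff_eq_intervalIntegral _ n 0, zero_add, Pi.zero_apply, div_one, one_smul]
    rw [← h n, fourierInt]
    refine intervalIntegral.integral_congr fun x _ => ?_
    simp only [fourier_coe_apply, smul_eq_mul]
    congr 2
    push_cast; ring
  have hreal : ∀ x : ℝ, F x = 0 := fun x => by
    have := has_pointwise_sum_fourier_series_of_summable (f := f)
      (by rw [hcoeff]; exact summable_zero) (x : AddCircle (1 : ℝ))
    rw [hcoeff] at this
    simp only [Pi.zero_apply, zero_smul] at this
    exact this.unique hasSum_zero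
  have han : AnalyticOnNhd ℂ F univ := hF.differentiableOn.analyticOnNhd isOpen_univ
  have hfreq : ∃ᶠ z in 𝓝[≠] (0 : ℂ), F z = (0 : ℂ → ℂ) z := by
    have ht : Tendsto (fun x : ℝ => (x : ℂ)) (𝓝[≠] 0) (𝓝[≠] 0) := by
      refine tendsto_nhdsWithin_iff.2 ⟨?_, ?_⟩
      · exact (Complex.continuous_ofReal.tendsto' 0 0 (by simp)).mono_left nhdsWithin_le_nhds
      · filter_upwards [self_mem_nhdsWithin] with x hx
        simpa using hx
    exact ht.frequently (Eventually.frequently (Eventually.of_forall fun x => hreal x))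
  exact han.eq_of_frequently_eq (fun z _ => analyticAt_const) hfreq

/-- The product `∏ (1 - q ^ n w)`. -/
def qPoch (q w : ℂ) : ℂ := ∏' n : ℕ, (1 + -(q ^ n * w))

theorem summable_qPoch {q : ℂ} (hq : ‖q‖ < 1) (w : ℂ) : Summable fun n : ℕ => ‖-(q ^ n * w)‖ := by
  simp only [norm_neg, norm_mul, norm_pow]
  exact (summable_geometric_of_lt_one (norm_nonneg _) hq).mul_right _

theorem qPoch_eq {q : ℂ} (hq : ‖q‖ < 1) (w : ℂ) : qPoch q w = (1 - w) * qPoch q (q * w) := by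
  have hterm : ∀ n : ℕ, 1 + -(q ^ (n + 1) * w) = 1 + -(q ^ n * (q * w)) := fun n => by ring
  have hm : Multipliable fun n : ℕ => 1 + -(q ^ (n + 1) * w) := by
    simp_rw [hterm]
    exact multipliable_one_add_of_summable (summable_qPoch hq (q * w))
  have h := tprod_eq_zero_mul' (f := fun n : ℕ => 1 + -(q ^ n * w)) hm
  simp only [hterm, pow_zero, one_mul] at h
  rw [qPoch, qPoch, h, ← sub_eq_add_neg]

theorem qPoch_ne_zero {q : ℂ} (hq : ‖q‖ < 1) {w : ℂ} (hw : ∀ n : ℕ, q ^ n * w ≠ 1) :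
    qPoch q w ≠ 0 :=
  tprod_one_add_ne_zero_of_summable
    (fun n h => hw n (by linear_combination -h)) (summable_qPoch hq w)

theorem differentiable_qPoch {q : ℂ} (hq : ‖q‖ < 1) : Differentiable ℂ (qPoch q) := by
  intro w
  have hd : DifferentiableOn ℂ (qPoch q) (Metric.ball 0 (‖w‖ + 1)) := by
    have := Summable.hasProdLocallyUniformlyOn_nat_one_add (K := Metric.ball (0 : ℂ) (‖w‖ + 1))
      (f := fun n w => -(q ^ n * w)) (u := fun n => ‖q‖ ^ n * (‖w‖ + 1)) Metric.isOpen_ball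
      ((summable_geometric_of_lt_one (norm_nonneg _) hq).mul_right _)
      (Eventually.of_forall fun n x hx => by
        rw [norm_neg, norm_mul, norm_pow]
        exact mul_le_mul_of_nonneg_left (by simpa using (mem_ball_zero_iff.1 hx).le) (by positivity))
      (fun n => by fun_prop)
    refine this.differentiableOn (Eventually.of_forall fun s => ?_) Metric.isOpen_ball
    simpa [Finset.prod_fn] using DifferentiableOn.finsetProd (fun _ _ => by fun_prop)
  exact hd.differentiableAt (Metric.isOpen_ball.mem_nhds (by simp))

/-- The product with simple zeros at the points of the lattice `ℤ + ℤ τ`. -/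
def thetaProd (τ u : ℂ) : ℂ :=
  qPoch (exp (2 * π * I * τ)) (exp (2 * π * I * u)) *
    qPoch (exp (2 * π * I * τ)) (exp (2 * π * I * τ) * exp (-(2 * π * I * u)))

theorem norm_nome_lt_one {τ : ℂ} (hτ : 0 < τ.im) : ‖exp (2 * π * I * τ)‖ < 1 := by
  rw [Complex.norm_exp]
  simp only [Complex.mul_re, Complex.re_ofNat, Complex.ofReal_re, Complex.im_ofNat,
    Complex.ofReal_im, mul_zero, sub_zero, Complex.I_re, Complex.mul_im, zero_mul, add_zero,
    Complex.I_im, mul_one, zero_sub, Real.exp_lt_one_iff, Left.neg_neg_iff]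
  have := Real.pi_pos
  positivity

theorem differentiable_thetaProd {τ : ℂ} (hτ : 0 < τ.im) : Differentiable ℂ (thetaProd τ) := by
  have h := differentiable_qPoch (norm_nome_lt_one hτ)
  intro u
  exact ((h _).comp u (f := fun u => exp (2 * π * I * u)) (by fun_prop)).mul
    ((h _).comp u (f := fun u => exp (2 * π * I * τ) * exp (-(2 * π * I * u))) (by fun_prop))

theorem thetaProd_add_one (τ u : ℂ) : thetaProd τ (u + 1) = thetaProd τ u := by
  have h1 : exp (2 * π * I * (u + 1)) = exp (2 * π * I * u) := by
    rw [mul_add, exp_add, mul_one, Complex.exp_two_pi_mul_I, mul_one]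
  rw [thetaProd, thetaProd, Complex.exp_neg, Complex.exp_neg, h1]

theorem thetaProd_add_tau {τ : ℂ} (hτ : 0 < τ.im) (u : ℂ) :
    thetaProd τ (u + τ) = -(exp (-(2 * π * I * u)) * thetaProd τ u) := by
  have hq := norm_nome_lt_one hτ
  have h1 : exp (2 * π * I * (u + τ)) = exp (2 * π * I * τ) * exp (2 * π * I * u) := by
    rw [← exp_add]; ring_nf
  have h2 : exp (2 * π * I * τ) * exp (-(2 * π * I * (u + τ))) = exp (-(2 * π * I * u)) := by
    rw [← exp_add]; ring_nf
  rw [thetaProd, thetaProd, h1, h2, qPoch_eq hq (exp (-(2 * π * I * u))),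
    qPoch_eq hq (exp (2 * π * I * u)), Complex.exp_neg]
  have := Complex.exp_ne_zero (2 * π * I * u)
  field_simp
  ring

theorem exists_int_of_pow_mul_eq_one {τ : ℂ} {w : ℂ} {k : ℤ}
    (h : exp (2 * π * I * τ * k) * exp (2 * π * I * w) = 1) :
    ∃ m n : ℤ, w = m + n * τ := by
  rw [← exp_add, Complex.exp_eq_one_iff] at h
  obtain ⟨m, hm⟩ := h
  refine ⟨m, -k, ?_⟩
  have h0 : (2 * π * I : ℂ) ≠ 0 := Complex.two_pi_I_ne_zero
  apply mul_left_cancel₀ h0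
  push_cast
  linear_combination hm

theorem thetaProd_ne_zero {τ u : ℂ} (hτ : 0 < τ.im) (hu : ∀ m n : ℤ, u ≠ m + n * τ) :
    thetaProd τ u ≠ 0 := by
  have hq := norm_nome_lt_one hτ
  refine mul_ne_zero (qPoch_ne_zero hq fun n h => ?_) (qPoch_ne_zero hq fun n h => ?_)
  · rw [← Complex.exp_nat_mul] at h
    obtain ⟨m, k, e⟩ := exists_int_of_pow_mul_eq_one (τ := τ) (k := n) (w := u) (by
      rw [← h]; push_cast; ring_nf)
    exact hu m k e
  · rw [← mul_assoc, ← pow_succ, ← Complex.exp_nat_mul] at h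
    obtain ⟨m, k, e⟩ := exists_int_of_pow_mul_eq_one (τ := τ) (k := n + 1) (w := -u) (by
      rw [← h]; push_cast; ring_nf)
    exact hu (-m) (-k) (by push_cast; linear_combination -e)

/-- Splitting off the factor 1 - e^(2πiu), with a simple zero at 0, leaves a cofactor whose value at
0 is the nonzero number `qPoch q q` squared. -/
theorem deriv_thetaProd_zero_ne_zero {τ : ℂ} (hτ : 0 < τ.im) : deriv (thetaProd τ) 0 ≠ 0 := by
  have hq := norm_nome_lt_one hτ
  set q := exp (2 * π * I * τ) with hqdef
  have hne : qPoch q q ≠ 0 := qPoch_ne_zero hq fun n h => by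
    have := congrArg norm h
    rw [← pow_succ, norm_pow, norm_one] at this
    exact absurd this (pow_lt_one₀ (norm_nonneg _) hq (by lia)).ne
  have h := differentiable_qPoch hq
  have he : HasDerivAt (fun u => exp (2 * π * I * u)) (2 * π * I) 0 := by
    have := ((hasDerivAt_id (0 : ℂ)).const_mul (2 * π * I)).cexp
    simpa using this
  have hr : DifferentiableAt ℂ (fun u => qPoch q (q * exp (2 * π * I * u)) *
      qPoch q (q * exp (-(2 * π * I * u)))) 0 :=
    ((h _).comp 0 (f := fun u => q * exp (2 * π * I * u)) (by fun_prop)).mul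
      ((h _).comp 0 (f := fun u => q * exp (-(2 * π * I * u))) (by fun_prop))
  have hd := (he.const_sub 1).mul hr.hasDerivAt
  have heq : thetaProd τ = (fun u => 1 - exp (2 * π * I * u)) *
      (fun u => qPoch q (q * exp (2 * π * I * u)) * qPoch q (q * exp (-(2 * π * I * u)))) := by
    funext u
    simp only [Pi.mul_apply]
    rw [thetaProd, ← hqdef, qPoch_eq hq (exp (2 * π * I * u))]
    ring
  rw [heq, hd.deriv]
  simp [hne, Real.pi_ne_zero]

/-- Integrating the series over [0, 1] term by term leaves only the term n = 0, which is 1. -/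
theorem exists_jacobiTheta₂_ne_zero {τ : ℂ} (hτ : 0 < τ.im) : ∃ z, jacobiTheta₂ z τ ≠ 0 := by
  by_contra! hz
  have hb : ∀ (n : ℤ) (x : ℝ), ‖jacobiTheta₂_term n x τ‖ = ‖jacobiTheta₂_term n 0 τ‖ := by
    intro n x
    simp [norm_jacobiTheta₂_term]
  have hsum := intervalIntegral.hasSum_integral_of_dominated_convergence (μ := volume) (a := 0)
    (b := 1) (F := fun (n : ℤ) (x : ℝ) => jacobiTheta₂_term n x τ) (f := fun _ => 0)
    (fun n _ => ‖jacobiTheta₂_term n 0 τ‖) (fun n => by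
      refine Continuous.aestronglyMeasurable ?_
      unfold jacobiTheta₂_term
      fun_prop)
    (fun n => Eventually.of_forall fun x _ => (hb n x).le)
    (Eventually.of_forall fun x _ => (summable_jacobiTheta₂_term_iff 0 τ).2 hτ |>.norm)
    intervalIntegrable_const
    (Eventually.of_forall fun x _ => by
      have := hasSum_jacobiTheta₂_term (x : ℂ) hτ
      rwa [hz] at this)
  have hint : ∀ n : ℤ, n ≠ 0 → ∫ x in (0 : ℝ)..1, jacobiTheta₂_term n x τ = 0 := by
    intro n hn
    have hc : (2 * π * I * n : ℂ) ≠ 0 := mul_ne_zero Complex.two_pi_I_ne_zero (by exact_mod_cast hn)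
    simp_rw [jacobiTheta₂_term, exp_add]
    rw [intervalIntegral.integral_mul_const, integral_exp_mul_complex hc]
    rw [Complex.ofReal_one, mul_one, mul_comm _ (n : ℂ), exp_int_mul_two_pi]
    simp
  have h2 := hsum.unique (hasSum_single 0 fun n hn => hint n hn)
  simp [jacobiTheta₂_term] at h2

/-- A weak form of the Jacobi triple product: e^(πiu) Θ₁ and the product obey the same two
periodicity laws, hence are proportional. This locates the zeros of Θ₁ and shows that the zero at 0
is simple; the constant is never needed. -/
theorem exists_theta1_eq {τ : ℂ} (hτ : 0 < τ.im) :
    ∃ c : ℂ, c ≠ 0 ∧ ∀ u, theta1 u τ = c * (exp (-(π * I * u)) * thetaProd τ u) := by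
  set g : ℂ → ℂ := fun u => exp (π * I * u) * theta1 u τ with hg
  have hgd : Differentiable ℂ g := by
    have := differentiable_theta1 hτ
    fun_prop
  have hg1 : ∀ u, g (u + 1) = g u := fun u => by
    simp only [hg]
    rw [theta1_add_one, mul_add, exp_add, mul_one, exp_pi_mul_I_eq]; ring
  have hg2 : ∀ u, g (u + τ) = -(exp (-(2 * π * I * u)) * g u) := fun u => by
    simp only [hg]
    rw [theta1_add_tau, mul_neg, ← mul_assoc, ← mul_assoc, ← exp_add, ← exp_add]
    ring_nf
  have hfd := differentiable_thetaProd hτ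
  have hf1 := thetaProd_add_one τ
  have hf2 := thetaProd_add_tau hτ
  have ha : fourierInt (thetaProd τ) 0 ≠ 0 := by
    intro h0
    have := eq_zero_of_fourierInt hfd hf1 (fourierInt_eq_zero hfd hf1 hf2 h0)
    have h := deriv_thetaProd_zero_ne_zero hτ
    rw [this] at h
    simp at h
  have hb : fourierInt g 0 ≠ 0 := by
    intro h0
    have h := eq_zero_of_fourierInt hgd hg1 (fourierInt_eq_zero hgd hg1 hg2 h0)
    obtain ⟨z, hz⟩ := exists_jacobiTheta₂_ne_zero hτ
    have := congrFun h (z - 1 / 2 - τ / 2)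
    simp only [hg, theta1_eq, Pi.zero_apply] at this
    rw [show z - 1 / 2 - τ / 2 + 1 / 2 + τ / 2 = z by ring] at this
    simp [Complex.exp_ne_zero, hz] at this
  refine ⟨fourierInt g 0 / fourierInt (thetaProd τ) 0, div_ne_zero hb ha, fun u => ?_⟩
  set A := fourierInt g 0
  set B := fourierInt (thetaProd τ) 0
  -- The combination is chosen so that its zeroth Fourier coefficient vanishes.
  have hzero := eq_zero_of_fourierInt (F := fun u => B * g u - A * thetaProd τ u) (by fun_prop)
    (fun u => by rw [hg1, hf1])
    (fourierInt_eq_zero (by fun_prop) (fun u => by rw [hg1, hf1]) (τ := τ)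
      (fun u => by rw [hg2, hf2]; ring) (by
        have : ∀ F : ℂ → ℂ, fourierInt F 0 = ∫ x in (0 : ℝ)..1, F x := fun F => by
          simp [fourierInt]
        rw [this, intervalIntegral.integral_sub, intervalIntegral.integral_const_mul,
          intervalIntegral.integral_const_mul, ← this, ← this]
        · ring
        · exact (Continuous.intervalIntegrable (by
            have := hgd.continuous
            fun_prop) _ _)
        · exact (Continuous.intervalIntegrable (by
            have := hfd.continuous
            fun_prop) _ _)))
  have h := congrFun hzero u
  simp only [Pi.zero_apply, hg] at h
  have he : exp (π * I * u) ≠ 0 := Complex.exp_ne_zero _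
  rw [Complex.exp_neg]
  field_simp
  linear_combination h

theorem theta1_ne_zero {τ u : ℂ} (hτ : 0 < τ.im) (hu : ∀ m n : ℤ, u ≠ m + n * τ) :
    theta1 u τ ≠ 0 := by
  obtain ⟨c, hc, h⟩ := exists_theta1_eq hτ
  rw [h]
  exact mul_ne_zero hc (mul_ne_zero (Complex.exp_ne_zero _) (thetaProd_ne_zero hτ hu))

theorem deriv_theta1_ne_zero {τ : ℂ} (hτ : 0 < τ.im) : deriv (fun v => theta1 v τ) 0 ≠ 0 := by
  obtain ⟨c, hc, h⟩ := exists_theta1_eq hτ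
  have h0 : thetaProd τ 0 = 0 := by
    have := h 0
    rw [theta1_zero] at this
    simpa [hc] using this.symm
  have hfun : (fun v => theta1 v τ) = fun v => c * (exp (-(π * I * v)) * thetaProd τ v) :=
    funext h
  have he : DifferentiableAt ℂ (fun v => exp (-(π * I * v))) 0 := by fun_prop
  have hd := (he.hasDerivAt.mul ((differentiable_thetaProd hτ) 0).hasDerivAt).const_mul c
  rw [hfun]
  refine ne_of_eq_of_ne hd.deriv ?_
  rw [h0]
  simp [hc, deriv_thetaProd_zero_ne_zero hτ]

end ThetaOne

/-! ### Integrals along rays from the origin -/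

section RayIntegrals

open Set Metric

/-- A function with vanishing derivative along a segment takes the same value at both ends. -/
theorem eq_of_hasDerivAt_zero_segment {g : ℂ → ℂ} {a b : ℂ}
    (h : ∀ x ∈ segment ℝ a b, HasDerivAt g 0 x) : g a = g b := by
  have := (convex_segment (𝕜 := ℝ) a b).norm_image_sub_le_of_norm_hasDerivWithin_le
    (f := g) (f' := fun _ => (0 : ℂ)) (C := 0) (fun x hx => (h x hx).hasDerivWithinAt)
    (fun x _ => by simp) (left_mem_segment ℝ a b) (right_mem_segment ℝ a b)
  rw [zero_mul, norm_le_zero_iff, sub_eq_zero] at this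
  exact this.symm

theorem intervalIntegrable_ofReal_rpow {β : ℝ} (hβ : -1 < β) (a b : ℝ) :
    IntervalIntegrable (fun s : ℝ => ((s ^ β : ℝ) : ℂ)) volume a b :=
  ⟨(intervalIntegral.intervalIntegrable_rpow' hβ).1.ofReal,
    (intervalIntegral.intervalIntegrable_rpow' hβ).2.ofReal⟩

variable {U : Set ℂ} {r : ℂ → ℂ} {β : ℝ}

theorem differentiableOn_rayIntegral (hU : IsOpen U) (hstar : ∀ u ∈ U, ∀ s ∈ Icc (0 : ℝ) 1, s * u ∈ U)
    (hr : DifferentiableOn ℂ r U) (hβ : -1 < β) :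
    DifferentiableOn ℂ (fun u => ∫ s in (0 : ℝ)..1, ((s ^ β : ℝ) : ℂ) * r (s * u)) U := by
  refine differentiableOn_intervalIntegral hU zero_le_one ?_ ?_
    (intervalIntegrable_ofReal_rpow hβ _ _)
  · exact hr.continuousOn.comp (f := fun x : ℂ × ℝ => (x.2 : ℂ) * x.1) (by fun_prop)
      (fun x hx => hstar _ hx.1 _ hx.2)
  · intro s hs
    exact hr.comp (f := fun x : ℂ => (s : ℂ) * x) (by fun_prop) (fun x hx => hstar _ hx _ hs)

/-- An Euler identity. By homogeneity x^(β+1) R(xu) = ∫₀ˣ y^β r(yu) dy for x > 0, and the two sides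
are differentiated in x at x = 1. -/
theorem mul_deriv_rayIntegral (hU : IsOpen U) (hstar : ∀ u ∈ U, ∀ s ∈ Icc (0 : ℝ) 1, s * u ∈ U)
    (hr : DifferentiableOn ℂ r U) (hβ : -1 < β) {u : ℂ} (hu : u ∈ U) :
    u * deriv (fun u => ∫ s in (0 : ℝ)..1, ((s ^ β : ℝ) : ℂ) * r (s * u)) u =
      r u - (β + 1) * ∫ s in (0 : ℝ)..1, ((s ^ β : ℝ) : ℂ) * r (s * u) := by
  set R : ℂ → ℂ := fun u => ∫ s in (0 : ℝ)..1, ((s ^ β : ℝ) : ℂ) * r (s * u) with hR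
  have hRd : DifferentiableAt ℂ R u :=
    (differentiableOn_rayIntegral hU hstar hr hβ).differentiableAt (hU.mem_nhds hu)
  have hscale : ∀ x : ℝ, 0 < x → ((x ^ (β + 1) : ℝ) : ℂ) * R (x * u) =
      ∫ y in (0 : ℝ)..x, ((y ^ β : ℝ) : ℂ) * r (y * u) := by
    intro x hx
    have := intervalIntegral.integral_comp_mul_left (a := 0) (b := 1)
      (fun y : ℝ => ((y ^ β : ℝ) : ℂ) * r (y * u)) hx.ne'
    rw [mul_zero, mul_one, eq_inv_smul_iff₀ hx.ne'] at this
    rw [← this, hR, ← intervalIntegral.integral_const_mul, ← intervalIntegral.integral_smul]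
    refine intervalIntegral.integral_congr fun s hs => ?_
    rw [uIcc_of_le zero_le_one] at hs
    simp only [Complex.real_smul, Real.mul_rpow hx.le hs.1, Real.rpow_add hx, Real.rpow_one,
      Complex.ofReal_mul]
    rw [show (s : ℂ) * ((x : ℂ) * u) = (x : ℂ) * s * u by ring]
    ring
  have hline : HasDerivAt (fun x : ℝ => (x : ℂ) * u) u 1 := by
    simpa using (Complex.ofRealCLM.hasDerivAt (x := (1 : ℝ))).mul_const u
  have hcont : ContinuousOn (fun y : ℝ => r (y * u)) (Icc 0 1) :=
    hr.continuousOn.comp (by fun_prop) (fun y hy => hstar u hu y hy)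
  have hL : HasDerivAt (fun x : ℝ => ((x ^ (β + 1) : ℝ) : ℂ) * R (x * u))
      ((β + 1) * R u + u * deriv R u) 1 := by
    have h1 : HasDerivAt (fun x : ℝ => ((x ^ (β + 1) : ℝ) : ℂ)) ((β + 1 : ℝ) : ℂ) 1 := by
      simpa using (Real.hasDerivAt_rpow_const (x := 1) (p := β + 1) (by simp)).ofReal_comp
    have h2 : HasDerivAt (fun x : ℝ => R (x * u)) (deriv R u * u) 1 := by
      have h3 : HasDerivAt R (deriv R u) (((1 : ℝ) : ℂ) * u) := by simpa using hRd.hasDerivAt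
      exact h3.comp (1 : ℝ) hline
    have := h1.mul h2
    simp only [Complex.ofReal_one, one_mul, Real.one_rpow] at this
    refine this.congr_deriv ?_
    push_cast; ring
  have hF : HasDerivAt (fun x : ℝ => ∫ y in (0 : ℝ)..x, ((y ^ β : ℝ) : ℂ) * r (y * u)) (r u) 1 := by
    have hca : ContinuousAt (fun y : ℝ => ((y ^ β : ℝ) : ℂ) * r (y * u)) 1 := by
      refine ContinuousAt.mul ?_ ?_
      · exact Complex.continuous_ofReal.continuousAt.comp
          (Real.continuousAt_rpow_const 1 β (by simp))
      · have h3 : ContinuousAt r (((1 : ℝ) : ℂ) * u) := by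
          simpa using (hr.differentiableAt (hU.mem_nhds hu)).continuousAt
        exact ContinuousAt.comp (f := fun y : ℝ => (y : ℂ) * u) h3 hline.continuousAt
    have hint : IntervalIntegrable (fun y : ℝ => ((y ^ β : ℝ) : ℂ) * r (y * u)) volume 0 1 :=
      (intervalIntegrable_ofReal_rpow hβ 0 1).mul_continuousOn
        (by rwa [uIcc_of_le zero_le_one])
    have hmeas : StronglyMeasurableAtFilter (fun y : ℝ => ((y ^ β : ℝ) : ℂ) * r (y * u)) (𝓝 1) := by
      have hopen : IsOpen ({y : ℝ | (y : ℂ) * u ∈ U} ∩ Ioi 0) :=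
        (hU.preimage (by fun_prop)).inter isOpen_Ioi
      refine ContinuousOn.stronglyMeasurableAtFilter hopen ?_ 1 ⟨by simpa using hu, zero_lt_one' ℝ⟩
      refine ContinuousOn.mul ?_ (hr.continuousOn.comp (by fun_prop) fun y hy => hy.1)
      exact Complex.continuous_ofReal.comp_continuousOn fun y hy =>
        (Real.continuousAt_rpow_const y β (Or.inl hy.2.ne')).continuousWithinAt
    simpa using intervalIntegral.integral_hasDerivAt_right hint hmeas hca
  have heq : (fun x : ℝ => ((x ^ (β + 1) : ℝ) : ℂ) * R (x * u)) =ᶠ[𝓝 1]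
      fun x : ℝ => ∫ y in (0 : ℝ)..x, ((y ^ β : ℝ) : ℂ) * r (y * u) := by
    filter_upwards [Ioi_mem_nhds (zero_lt_one' ℝ)] with x hx using hscale x hx
  have := (hF.congr_of_eventuallyEq heq).unique hL
  linear_combination -this

end RayIntegrals

/-! ### Lattice coordinates and domains star-shaped about the origin -/

section Coordinates

/-- The first coordinate `ξ` of `u = ξ + υ τ`. -/
def latX (u τ : ℂ) : ℝ := u.re - u.im / τ.im * τ.re

/-- The second coordinate `υ` of `u = ξ + υ τ`. -/
def latY (u τ : ℂ) : ℝ := u.im / τ.im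

variable {τ : ℂ}

theorem latX_add_latY (hτ : 0 < τ.im) (u : ℂ) : (latX u τ : ℂ) + latY u τ * τ = u := by
  apply Complex.ext
  · simp [latX, latY]
  · simp [latY, hτ.ne']

theorem latX_add (u v τ : ℂ) : latX (u + v) τ = latX u τ + latX v τ := by
  simp only [latX, Complex.add_re, Complex.add_im]; ring

theorem latY_add (u v τ : ℂ) : latY (u + v) τ = latY u τ + latY v τ := by
  simp only [latY, Complex.add_im]; ring

theorem latX_neg (u τ : ℂ) : latX (-u) τ = -latX u τ := by
  simp only [latX, Complex.neg_re, Complex.neg_im]; ring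

theorem latY_neg (u τ : ℂ) : latY (-u) τ = -latY u τ := by
  simp only [latY, Complex.neg_im]; ring

theorem latX_sub (u v τ : ℂ) : latX (u - v) τ = latX u τ - latX v τ := by
  rw [sub_eq_add_neg, latX_add, latX_neg]; ring

theorem latY_sub (u v τ : ℂ) : latY (u - v) τ = latY u τ - latY v τ := by
  rw [sub_eq_add_neg, latY_add, latY_neg]; ring

theorem latX_real_mul (s : ℝ) (u τ : ℂ) : latX (s * u) τ = s * latX u τ := by
  simp only [latX, Complex.re_ofReal_mul, Complex.im_ofReal_mul]; ring

theorem latY_real_mul (s : ℝ) (u τ : ℂ) : latY (s * u) τ = s * latY u τ := by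
  simp only [latY, Complex.im_ofReal_mul]; ring

theorem latX_ofReal (s : ℝ) (τ : ℂ) : latX s τ = s := by simp [latX]

theorem latY_ofReal (s : ℝ) (τ : ℂ) : latY s τ = 0 := by simp [latY]

theorem latX_self (hτ : 0 < τ.im) : latX τ τ = 0 := by simp [latX, hτ.ne']

theorem latY_self (hτ : 0 < τ.im) : latY τ τ = 1 := by simp [latY, hτ.ne']

theorem latX_one (τ : ℂ) : latX 1 τ = 1 := by simp [latX]

theorem latY_one (τ : ℂ) : latY 1 τ = 0 := by simp [latY]

theorem latX_zero (τ : ℂ) : latX 0 τ = 0 := by simp [latX]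

theorem latY_zero (τ : ℂ) : latY 0 τ = 0 := by simp [latY]

theorem latX_div_two (u τ : ℂ) : latX (u / 2) τ = latX u τ / 2 := by
  have := latX_real_mul (1 / 2) u τ
  rw [show ((1 / 2 : ℝ) : ℂ) * u = u / 2 by push_cast; ring] at this
  rw [this]; ring

theorem latY_div_two (u τ : ℂ) : latY (u / 2) τ = latY u τ / 2 := by
  have := latY_real_mul (1 / 2) u τ
  rw [show ((1 / 2 : ℝ) : ℂ) * u = u / 2 by push_cast; ring] at this
  rw [this]; ring

theorem continuousOn_latX : ContinuousOn (fun y : ℂ × ℂ => latX y.2 y.1) {y | 0 < y.1.im} := by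
  unfold latX
  refine ContinuousOn.sub (by fun_prop) (ContinuousOn.mul (ContinuousOn.div ?_ ?_ ?_) ?_)
  · exact (Complex.continuous_im.comp continuous_snd).continuousOn
  · exact (Complex.continuous_im.comp continuous_fst).continuousOn
  · intro y hy; exact (ne_of_gt hy)
  · exact (Complex.continuous_re.comp continuous_fst).continuousOn

theorem continuousOn_latY : ContinuousOn (fun y : ℂ × ℂ => latY y.2 y.1) {y | 0 < y.1.im} := by
  unfold latY
  refine ContinuousOn.div ?_ ?_ ?_
  · exact (Complex.continuous_im.comp continuous_snd).continuousOn
  · exact (Complex.continuous_im.comp continuous_fst).continuousOn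
  · intro y hy; exact (ne_of_gt hy)

theorem isOpen_upper : IsOpen {y : ℂ × ℂ | 0 < y.1.im} :=
  isOpen_lt continuous_const (Complex.continuous_im.comp continuous_fst)

/-- The set of pairs `(τ, u)` on which the branch `logPrimeForm u τ` is holomorphic. -/
def logDomain : Set (ℂ × ℂ) :=
  {y | 0 < y.1.im ∧ ((0 < latX y.2 y.1 ∧ latX y.2 y.1 < 1) ∨
    (latY y.2 y.1 ≠ 0 ∧ |latY y.2 y.1| < 1))}

/-- A set of pairs `(τ, u)` for which the segment from `0` to `u` meets the lattice at most
in `0`. -/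
def starDomain : Set (ℂ × ℂ) :=
  {y | y ∈ logDomain ∨ (0 < y.1.im ∧ |latX y.2 y.1| < 1 ∧ |latY y.2 y.1| < 1)}

theorem isOpen_logDomain : IsOpen logDomain := by
  have h : logDomain = {y : ℂ × ℂ | 0 < y.1.im} ∩ (fun y => (latX y.2 y.1, latY y.2 y.1)) ⁻¹'
      {x : ℝ × ℝ | (0 < x.1 ∧ x.1 < 1) ∨ (x.2 ≠ 0 ∧ |x.2| < 1)} := by
    ext y; simp [logDomain]
  rw [h]
  refine (continuousOn_latX.prodMk continuousOn_latY).isOpen_inter_preimage isOpen_upper ?_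
  refine IsOpen.union (IsOpen.inter ?_ ?_) (IsOpen.inter ?_ ?_)
  · exact isOpen_lt continuous_const continuous_fst
  · exact isOpen_lt continuous_fst continuous_const
  · exact isOpen_ne_fun continuous_snd continuous_const
  · exact isOpen_lt continuous_snd.abs continuous_const

theorem isOpen_starDomain : IsOpen starDomain := by
  have h : starDomain = logDomain ∪ ({y : ℂ × ℂ | 0 < y.1.im} ∩
      (fun y => (latX y.2 y.1, latY y.2 y.1)) ⁻¹' {x : ℝ × ℝ | |x.1| < 1 ∧ |x.2| < 1}) := by
    ext y; simp [starDomain]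
  rw [h]
  refine isOpen_logDomain.union
    ((continuousOn_latX.prodMk continuousOn_latY).isOpen_inter_preimage isOpen_upper ?_)
  exact IsOpen.inter (isOpen_lt continuous_fst.abs continuous_const)
    (isOpen_lt continuous_snd.abs continuous_const)

theorem im_pos_of_mem_logDomain {y : ℂ × ℂ} (h : y ∈ logDomain) : 0 < y.1.im := h.1

theorem im_pos_of_mem_starDomain {y : ℂ × ℂ} (h : y ∈ starDomain) : 0 < y.1.im :=
  h.elim (fun h => h.1) (fun h => h.1)

theorem mem_starDomain_of_mem_logDomain {y : ℂ × ℂ} (h : y ∈ logDomain) : y ∈ starDomain := Or.inl h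

theorem zero_mem_starDomain (hτ : 0 < τ.im) : (τ, (0 : ℂ)) ∈ starDomain :=
  Or.inr ⟨hτ, by simp [latX_zero], by simp [latY_zero]⟩

theorem real_mul_mem_logDomain {u : ℂ} (h : (τ, u) ∈ logDomain) {s : ℝ} (hs : 0 < s) (hs' : s ≤ 1) :
    (τ, s * u) ∈ logDomain := by
  refine ⟨h.1, ?_⟩
  have h2 := h.2
  simp only [latX_real_mul, latY_real_mul] at h2 ⊢
  refine h2.imp (fun h => ⟨mul_pos hs h.1, ?_⟩) (fun h => ⟨mul_ne_zero hs.ne' h.1, ?_⟩)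
  · nlinarith [h.1, h.2]
  · rw [abs_mul, abs_of_pos hs]
    nlinarith [abs_nonneg (latY u τ), h.2]

theorem real_mul_mem_starDomain {u : ℂ} (h : (τ, u) ∈ starDomain) {s : ℝ} (hs : 0 ≤ s)
    (hs' : s ≤ 1) : (τ, s * u) ∈ starDomain := by
  rcases hs.eq_or_lt with rfl | hs0
  · simpa using zero_mem_starDomain (im_pos_of_mem_starDomain h)
  refine h.imp (fun h => real_mul_mem_logDomain h hs0 hs') (fun h => ⟨h.1, ?_, ?_⟩)
  · simp only [latX_real_mul, abs_mul, abs_of_pos hs0]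
    nlinarith [h.2.1, abs_nonneg (latX u τ)]
  · simp only [latY_real_mul, abs_mul, abs_of_pos hs0]
    nlinarith [h.2.2, abs_nonneg (latY u τ)]

/-- A real point has second coordinate 0, so only the first alternative is left, and it makes the
point positive. -/
theorem mem_slitPlane_of_mem_logDomain {u : ℂ} (h : (τ, u) ∈ logDomain) : u ∈ Complex.slitPlane := by
  rw [Complex.mem_slitPlane_iff]
  by_cases hi : u.im = 0
  · left
    have hy : latY u τ = 0 := by simp [latY, hi]
    rcases h.2 with h2 | h2
    · have : latX u τ = u.re := by simp [latX, hi]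
      simp only at h2; rw [this] at h2; exact h2.1
    · exact absurd hy h2.1
  · exact Or.inr hi

theorem ne_zero_of_mem_logDomain {u : ℂ} (h : (τ, u) ∈ logDomain) : u ≠ 0 :=
  Complex.slitPlane_ne_zero (mem_slitPlane_of_mem_logDomain h)

theorem latX_lattice (hτ : 0 < τ.im) (m n : ℝ) : latX (m + n * τ) τ = m := by
  rw [latX_add, latX_ofReal, latX_real_mul, latX_self hτ]; ring

theorem latY_lattice (hτ : 0 < τ.im) (m n : ℝ) : latY (m + n * τ) τ = n := by
  rw [latY_add, latY_ofReal, latY_real_mul, latY_self hτ]; ring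

theorem ne_lattice_of_mem_starDomain {u : ℂ} (h : (τ, u) ∈ starDomain) (hu : u ≠ 0) (m n : ℤ) :
    u ≠ m + n * τ := by
  rintro rfl
  have hτ : 0 < τ.im := im_pos_of_mem_starDomain h
  have hX : latX ((m : ℂ) + n * τ) τ = m := by
    have := latX_lattice hτ m n
    push_cast at this; exact this
  have hY : latY ((m : ℂ) + n * τ) τ = n := by
    have := latY_lattice hτ m n
    push_cast at this; exact this
  have habs : ∀ k : ℤ, |(k : ℝ)| < 1 → k = 0 := fun k hk => by
    have : |k| < 1 := by exact_mod_cast hk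
    exact Int.abs_lt_one_iff.1 this
  rcases h with ⟨-, h | h⟩ | ⟨-, h⟩
  · simp only [hX] at h
    have h1 : 0 < m := by exact_mod_cast h.1
    have h2 : m < 1 := by exact_mod_cast h.2
    lia
  · simp only [hY] at h
    exact h.1 (by exact_mod_cast habs n h.2)
  · simp only [hX, hY] at h
    rw [habs m h.1, habs n h.2] at hu
    simp at hu

end Coordinates

/-! ### The prime form and the logarithm of E(u, τ)/u -/

section PrimeForm

open Set

theorem differentiableOn_theta1_joint :
    DifferentiableOn ℂ (fun y : ℂ × ℂ => theta1 y.2 y.1) {y | 0 < y.1.im} := by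
  intro y hy
  apply DifferentiableAt.differentiableWithinAt
  simp_rw [theta1_eq]
  refine DifferentiableAt.neg (DifferentiableAt.mul (by fun_prop) ?_)
  exact (hasFDerivAt_jacobiTheta₂ _ hy).differentiableAt.comp y
    (f := fun y : ℂ × ℂ => (y.2 + 1 / 2 + y.1 / 2, y.1)) (by fun_prop)

theorem differentiableOn_primeForm_joint :
    DifferentiableOn ℂ (fun y : ℂ × ℂ => primeForm y.2 y.1) {y | 0 < y.1.im} := by
  have h1 : DifferentiableOn ℂ (fun y : ℂ × ℂ => deriv (fun v => theta1 v y.1) y.2)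
      {y | 0 < y.1.im} :=
    differentiableOn_partialDeriv isOpen_upper (f := fun τ v => theta1 v τ)
      differentiableOn_theta1_joint
  have h2 : DifferentiableOn ℂ (fun y : ℂ × ℂ => deriv (fun v => theta1 v y.1) 0)
      {y | 0 < y.1.im} :=
    h1.comp (f := fun y : ℂ × ℂ => (y.1, (0 : ℂ))) (by fun_prop) (fun y hy => hy)
  simp only [primeForm, div_eq_mul_inv]
  exact differentiableOn_theta1_joint.mul (h2.inv fun y hy => deriv_theta1_ne_zero hy)

theorem differentiable_primeForm {τ : ℂ} (hτ : 0 < τ.im) :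
    Differentiable ℂ (fun v => primeForm v τ) :=
  (differentiable_theta1 hτ).div_const _

theorem primeForm_zero (τ : ℂ) : primeForm 0 τ = 0 := by simp [primeForm, theta1_zero]

theorem primeForm_neg (u τ : ℂ) : primeForm (-u) τ = -primeForm u τ := by
  simp [primeForm, theta1_neg, neg_div]

theorem primeForm_add_one (u τ : ℂ) : primeForm (u + 1) τ = -primeForm u τ := by
  simp [primeForm, theta1_add_one, neg_div]

theorem primeForm_add_tau (u τ : ℂ) : primeForm (u + τ) τ =
    -(Complex.exp (-(Real.pi * Complex.I * τ) - 2 * Real.pi * Complex.I * u) * primeForm u τ) := by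
  rw [primeForm, primeForm, theta1_add_tau]; ring

theorem deriv_primeForm_zero {τ : ℂ} (hτ : 0 < τ.im) : deriv (fun v => primeForm v τ) 0 = 1 := by
  simp only [primeForm, deriv_div_const]
  exact div_self (deriv_theta1_ne_zero hτ)

theorem primeForm_ne_zero {u τ : ℂ} (hτ : 0 < τ.im) (hu : ∀ m n : ℤ, u ≠ m + n * τ) :
    primeForm u τ ≠ 0 :=
  div_ne_zero (theta1_ne_zero hτ hu) (deriv_theta1_ne_zero hτ)

theorem primeForm_div {τ : ℂ} (hτ : 0 < τ.im) (u : ℂ) :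
    primeForm (u / τ) (-1 / τ) =
      τ⁻¹ * Complex.exp (Real.pi * Complex.I * u ^ 2 / τ) * primeForm u τ := by
  have hτ0 : τ ≠ 0 := by rintro rfl; simp at hτ
  obtain ⟨C, hC, h⟩ := exists_theta1_div τ hτ
  have hd : deriv (fun v => theta1 v (-1 / τ)) 0 = τ * (C * deriv (fun v => theta1 v τ) 0) := by
    have hf : (fun v => theta1 v (-1 / τ)) = fun v =>
        C * Complex.exp (Real.pi * Complex.I * (τ * v) ^ 2 / τ) * theta1 (τ * v) τ := by
      funext v
      rw [← h, mul_div_cancel_left₀ _ hτ0]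
    have h1 : HasDerivAt (fun v => theta1 (τ * v) τ) (deriv (fun v => theta1 v τ) 0 * τ) 0 := by
      have h2 : HasDerivAt (fun v => theta1 v τ) (deriv (fun v => theta1 v τ) 0) (τ * 0) := by
        simpa using (differentiable_theta1 hτ 0).hasDerivAt
      exact h2.comp (0 : ℂ) (by simpa using (hasDerivAt_id (0 : ℂ)).const_mul τ)
    have h3 : DifferentiableAt ℂ
        (fun v => C * Complex.exp (Real.pi * Complex.I * (τ * v) ^ 2 / τ)) 0 := by fun_prop
    have h4 := h3.hasDerivAt.mul h1
    rw [hf]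
    refine h4.deriv.trans ?_
    simp [theta1_zero]
    ring
  rw [primeForm, primeForm, hd, h]
  have := deriv_theta1_ne_zero hτ
  field_simp

/-- The entire function `E(u, τ) / u`. -/
def regForm (u τ : ℂ) : ℂ := ∫ s in (0 : ℝ)..1, deriv (fun v => primeForm v τ) (s * u)

theorem differentiableOn_regForm_joint :
    DifferentiableOn ℂ (fun y : ℂ × ℂ => regForm y.2 y.1) {y | 0 < y.1.im} := by
  have h1 : DifferentiableOn ℂ (fun y : ℂ × ℂ => deriv (fun v => primeForm v y.1) y.2)
      {y | 0 < y.1.im} :=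
    differentiableOn_partialDeriv isOpen_upper (f := fun τ v => primeForm v τ)
      differentiableOn_primeForm_joint
  have := differentiableOn_intervalIntegral (E := ℂ × ℂ) isOpen_upper (zero_le_one' ℝ)
    (f := fun y s => deriv (fun v => primeForm v y.1) (s * y.2)) (g := fun _ => 1) ?_ ?_
    intervalIntegrable_const
  · simpa [regForm] using this
  · exact h1.continuousOn.comp (f := fun x : (ℂ × ℂ) × ℝ => (x.1.1, (x.2 : ℂ) * x.1.2))
      (by fun_prop) (fun x hx => hx.1)
  · intro s _
    exact h1.comp (f := fun y : ℂ × ℂ => (y.1, (s : ℂ) * y.2)) (by fun_prop) (fun y hy => hy)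

theorem differentiable_regForm {τ : ℂ} (hτ : 0 < τ.im) : Differentiable ℂ (fun u => regForm u τ) :=
  fun u => (differentiableOn_regForm_joint.differentiableAt (isOpen_upper.mem_nhds hτ)).comp u
    (f := fun u : ℂ => (τ, u)) (by fun_prop)

/-- The fundamental theorem of calculus on the segment [0, u], with E(0) = 0. Defining the quotient
by an integral makes it jointly holomorphic without a removable singularity. -/
theorem primeForm_eq_mul_regForm {τ : ℂ} (hτ : 0 < τ.im) (u : ℂ) :
    primeForm u τ = u * regForm u τ := by
  have hline : ∀ x : ℝ, HasDerivAt (fun x : ℝ => (x : ℂ) * u) u x := fun x => by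
    simpa using (Complex.ofRealCLM.hasDerivAt (x := x)).mul_const u
  have hd : ∀ x ∈ uIcc (0 : ℝ) 1, HasDerivAt (fun x : ℝ => primeForm (x * u) τ)
      (deriv (fun v => primeForm v τ) (x * u) * u) x := fun x _ =>
    (differentiable_primeForm hτ ((x : ℂ) * u)).hasDerivAt.comp x
      (h₂ := fun v => primeForm v τ) (hline x)
  have hc : Continuous (deriv (fun v => primeForm v τ)) :=
    ((differentiable_primeForm hτ).contDiff (n := 1)).continuous_deriv le_rfl
  have := intervalIntegral.integral_eq_sub_of_hasDerivAt hd
    (Continuous.intervalIntegrable (by fun_prop) _ _)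
  rw [intervalIntegral.integral_mul_const] at this
  simp only [Complex.ofReal_one, one_mul, Complex.ofReal_zero, zero_mul, primeForm_zero,
    sub_zero] at this
  rw [← this, regForm, mul_comm]

theorem regForm_zero {τ : ℂ} (hτ : 0 < τ.im) : regForm 0 τ = 1 := by
  simp [regForm, deriv_primeForm_zero hτ]

theorem regForm_ne_zero {u τ : ℂ} (h : (τ, u) ∈ starDomain) : regForm u τ ≠ 0 := by
  have hτ : 0 < τ.im := im_pos_of_mem_starDomain h
  by_cases hu : u = 0
  · rw [hu, regForm_zero hτ]; exact one_ne_zero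
  · have h1 := primeForm_ne_zero hτ (ne_lattice_of_mem_starDomain h hu)
    rw [primeForm_eq_mul_regForm hτ] at h1
    exact right_ne_zero_of_mul h1

theorem regForm_neg {τ : ℂ} (u : ℂ) : regForm (-u) τ = regForm u τ := by
  have h : ∀ v, deriv (fun v => primeForm v τ) (-v) = deriv (fun v => primeForm v τ) v := by
    intro v
    have h1 : (fun v => primeForm (-v) τ) = fun v => -primeForm v τ := by
      funext v; exact primeForm_neg v τ
    have h2 := deriv_comp_neg (fun v => primeForm v τ) v
    rw [h1, deriv.fun_neg] at h2
    exact (neg_injective h2).symm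
  simp only [regForm, mul_neg, h]

theorem regForm_div {τ : ℂ} (hτ : 0 < τ.im) (u : ℂ) : regForm (u / τ) (-1 / τ) =
    Complex.exp (Real.pi * Complex.I * u ^ 2 / τ) * regForm u τ := by
  have hτ0 : τ ≠ 0 := by rintro rfl; simp at hτ
  have hτ' : 0 < (-1 / τ).im := by
    rw [neg_div, Complex.neg_im, one_div, Complex.inv_im]
    have := Complex.normSq_pos.2 hτ0
    rw [neg_div, neg_neg]; positivity
  by_cases hu : u = 0
  · simp [hu, regForm_zero hτ, regForm_zero hτ']
  · have := primeForm_div hτ u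
    rw [primeForm_eq_mul_regForm hτ, primeForm_eq_mul_regForm hτ'] at this
    have h2 : u / τ ≠ 0 := div_ne_zero hu hτ0
    apply mul_left_cancel₀ h2
    rw [this]
    ring

/-- The logarithmic derivative of `E(u, τ) / u`. -/
def regLogDeriv (u τ : ℂ) : ℂ := deriv (fun v => regForm v τ) u / regForm u τ

theorem differentiableOn_regLogDeriv_joint :
    DifferentiableOn ℂ (fun y : ℂ × ℂ => regLogDeriv y.2 y.1) starDomain := by
  have h1 : DifferentiableOn ℂ (fun y : ℂ × ℂ => deriv (fun v => regForm v y.1) y.2)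
      {y | 0 < y.1.im} :=
    differentiableOn_partialDeriv isOpen_upper (f := fun τ v => regForm v τ)
      differentiableOn_regForm_joint
  have hsub : starDomain ⊆ {y | 0 < y.1.im} := fun y hy => im_pos_of_mem_starDomain hy
  simp only [regLogDeriv, div_eq_mul_inv]
  exact (h1.mono hsub).mul
    ((differentiableOn_regForm_joint.mono hsub).inv fun y hy => regForm_ne_zero hy)

theorem logDeriv_primeForm {u τ : ℂ} (h : (τ, u) ∈ starDomain) (hu : u ≠ 0) :
    logDeriv (fun v => primeForm v τ) u = 1 / u + regLogDeriv u τ := by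
  have hτ : 0 < τ.im := im_pos_of_mem_starDomain h
  have he := regForm_ne_zero h
  have hf : (fun v => primeForm v τ) = fun v => v * regForm v τ := by
    funext v; exact primeForm_eq_mul_regForm hτ v
  have hd := (hasDerivAt_id u).mul (differentiable_regForm hτ u).hasDerivAt
  rw [hf, logDeriv_apply, regLogDeriv]
  rw [show deriv (fun v => v * regForm v τ) u = _ from hd.deriv]
  simp only [id]
  field_simp

/-- The logarithm of `E(u, τ) / u` that vanishes at `u = 0`. -/
def regLog (u τ : ℂ) : ℂ := u * ∫ s in (0 : ℝ)..1, regLogDeriv (s * u) τ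

theorem differentiableOn_regLog_joint :
    DifferentiableOn ℂ (fun y : ℂ × ℂ => regLog y.2 y.1) starDomain := by
  refine DifferentiableOn.mul (by fun_prop) ?_
  have := differentiableOn_intervalIntegral (E := ℂ × ℂ) isOpen_starDomain (zero_le_one' ℝ)
    (f := fun y s => regLogDeriv (s * y.2) y.1) (g := fun _ => 1) ?_ ?_ intervalIntegrable_const
  · simpa using this
  · exact differentiableOn_regLogDeriv_joint.continuousOn.comp
      (f := fun x : (ℂ × ℂ) × ℝ => (x.1.1, (x.2 : ℂ) * x.1.2))
      (by fun_prop) (fun x hx => real_mul_mem_starDomain hx.1 hx.2.1 hx.2.2)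
  · intro s hs
    exact differentiableOn_regLogDeriv_joint.comp (f := fun y : ℂ × ℂ => (y.1, (s : ℂ) * y.2))
      (by fun_prop) (fun y hy => real_mul_mem_starDomain hy hs.1 hs.2)

theorem isOpen_starDomain_fiber (τ : ℂ) : IsOpen {u | (τ, u) ∈ starDomain} :=
  isOpen_starDomain.preimage (by fun_prop)

theorem differentiableOn_regLogDeriv (τ : ℂ) :
    DifferentiableOn ℂ (fun u => regLogDeriv u τ) {u | (τ, u) ∈ starDomain} :=
  differentiableOn_regLogDeriv_joint.comp (f := fun u : ℂ => (τ, u)) (by fun_prop) (fun _ hu => hu)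

/-- The Euler identity with β = 0 reads u R' = r - R, that is (u R)' = r. -/
theorem hasDerivAt_regLog {u τ : ℂ} (h : (τ, u) ∈ starDomain) :
    HasDerivAt (fun v => regLog v τ) (regLogDeriv u τ) u := by
  have hstar : ∀ u ∈ {u | (τ, u) ∈ starDomain}, ∀ s ∈ Icc (0 : ℝ) 1,
      (s : ℂ) * u ∈ {u | (τ, u) ∈ starDomain} := fun u hu s hs =>
    real_mul_mem_starDomain hu hs.1 hs.2
  have h1 := mul_deriv_rayIntegral (isOpen_starDomain_fiber τ) hstar
    (differentiableOn_regLogDeriv τ) (β := 0) (by norm_num) h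
  have h2 := (differentiableOn_rayIntegral (isOpen_starDomain_fiber τ) hstar
    (differentiableOn_regLogDeriv τ) (β := 0) (by norm_num)).differentiableAt
    ((isOpen_starDomain_fiber τ).mem_nhds h)
  simp only [Real.rpow_zero, Complex.ofReal_one, one_mul, Complex.ofReal_zero, zero_add] at h1 h2
  have h3 := (hasDerivAt_id u).mul h2.hasDerivAt
  refine HasDerivAt.congr_deriv (f := fun v => regLog v τ) h3 ?_
  simp only [id, one_mul, h1]
  ring

theorem regLogDeriv_neg (u τ : ℂ) : regLogDeriv (-u) τ = -regLogDeriv u τ := by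
  have h1 : (fun v => regForm (-v) τ) = fun v => regForm v τ := by
    funext v; exact regForm_neg v
  have h2 := deriv_comp_neg (fun v => regForm v τ) u
  rw [h1] at h2
  rw [regLogDeriv, regLogDeriv, regForm_neg, h2]
  ring

theorem regLog_neg (u τ : ℂ) : regLog (-u) τ = regLog u τ := by
  simp only [regLog, mul_neg, regLogDeriv_neg, intervalIntegral.integral_neg, neg_mul, neg_neg]

/-- The pole 1/(su) of the logarithmic derivative, multiplied by u, cancels the subtracted 1/s. Only
0 < s < 1 matters, so the value at s = 0 plays no role. -/
theorem logPrimeForm_eq {u τ : ℂ} (h : (τ, u) ∈ starDomain) (hu : u ≠ 0) :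
    logPrimeForm u τ = Complex.log u + regLog u τ := by
  rw [logPrimeForm, regLog, ← intervalIntegral.integral_const_mul]
  congr 1
  refine intervalIntegral.integral_congr_uIoo fun s hs => ?_
  rw [uIoo_of_le zero_le_one] at hs
  have hs0 : (s : ℂ) ≠ 0 := by exact_mod_cast hs.1.ne'
  have := logDeriv_primeForm (real_mul_mem_starDomain h hs.1.le hs.2.le) (mul_ne_zero hs0 hu)
  rw [this]
  field_simp
  ring

end PrimeForm

/-! ### Functional equations of log E and of its derivatives -/

section LogPrimeForm

open Set
open Complex (I exp)
open scoped Real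

variable {τ u : ℂ}

theorem primeForm_ne_zero_of_mem (h : (τ, u) ∈ logDomain) : primeForm u τ ≠ 0 :=
  primeForm_ne_zero h.1
    (ne_lattice_of_mem_starDomain (mem_starDomain_of_mem_logDomain h) (ne_zero_of_mem_logDomain h))

theorem logPrimeForm_eq_of_mem (h : (τ, u) ∈ logDomain) :
    logPrimeForm u τ = Complex.log u + regLog u τ :=
  logPrimeForm_eq (mem_starDomain_of_mem_logDomain h) (ne_zero_of_mem_logDomain h)

theorem differentiableOn_logPrimeForm_joint :
    DifferentiableOn ℂ (fun y : ℂ × ℂ => logPrimeForm y.2 y.1) logDomain := by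
  have h1 : DifferentiableOn ℂ (fun y : ℂ × ℂ => Complex.log y.2 + regLog y.2 y.1) logDomain := by
    refine DifferentiableOn.add ?_
      (differentiableOn_regLog_joint.mono fun y hy => mem_starDomain_of_mem_logDomain hy)
    intro y hy
    have hs : y.2 ∈ Complex.slitPlane := mem_slitPlane_of_mem_logDomain (τ := y.1) hy
    exact ((Complex.differentiableAt_log hs).comp y differentiableAt_snd).differentiableWithinAt
  exact h1.congr fun y hy => logPrimeForm_eq_of_mem hy

theorem isOpen_logDomain_fiber (τ : ℂ) : IsOpen {u | (τ, u) ∈ logDomain} :=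
  isOpen_logDomain.preimage (by fun_prop)

theorem hasDerivAt_logPrimeForm (h : (τ, u) ∈ logDomain) :
    HasDerivAt (fun v => logPrimeForm v τ) (logDeriv (fun v => primeForm v τ) u) u := by
  have hs := mem_starDomain_of_mem_logDomain h
  have h1 := (Complex.hasDerivAt_log (mem_slitPlane_of_mem_logDomain h)).add (hasDerivAt_regLog hs)
  rw [logDeriv_primeForm hs (ne_zero_of_mem_logDomain h), one_div]
  refine h1.congr_of_eventuallyEq ?_
  filter_upwards [(isOpen_logDomain_fiber τ).mem_nhds h] with v hv
  exact logPrimeForm_eq_of_mem hv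

theorem logDeriv_primeForm_neg (u τ : ℂ) :
    logDeriv (fun v => primeForm v τ) (-u) = -logDeriv (fun v => primeForm v τ) u := by
  have h1 : (fun v => primeForm (-v) τ) = fun v => -primeForm v τ := by
    funext v; exact primeForm_neg v τ
  have h2 := deriv_comp_neg (fun v => primeForm v τ) u
  rw [h1, deriv.fun_neg] at h2
  rw [logDeriv_apply, logDeriv_apply, primeForm_neg, ← neg_inj.1 h2, div_neg]

theorem logDeriv_primeForm_add_one (u τ : ℂ) :
    logDeriv (fun v => primeForm v τ) (u + 1) = logDeriv (fun v => primeForm v τ) u := by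
  have h1 : (fun v => primeForm (v + 1) τ) = fun v => -primeForm v τ := by
    funext v; exact primeForm_add_one v τ
  have h2 := deriv_comp_add_const (fun v => primeForm v τ) 1 u
  rw [h1, deriv.fun_neg] at h2
  rw [logDeriv_apply, logDeriv_apply, primeForm_add_one, ← h2, neg_div_neg_eq]

theorem logDeriv_primeForm_one_sub (u τ : ℂ) :
    logDeriv (fun v => primeForm v τ) (1 - u) = -logDeriv (fun v => primeForm v τ) u := by
  rw [sub_eq_neg_add, logDeriv_primeForm_add_one, logDeriv_primeForm_neg]

theorem logDeriv_primeForm_add_tau (hτ : 0 < τ.im) (hu : primeForm u τ ≠ 0) :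
    logDeriv (fun v => primeForm v τ) (u + τ) =
      -(2 * π * I) + logDeriv (fun v => primeForm v τ) u := by
  have h1 : (fun v => primeForm (v + τ) τ) =
      fun v => -exp (-(π * I * τ) - 2 * π * I * v) * primeForm v τ := by
    funext v; rw [primeForm_add_tau]; ring
  have h2 : logDeriv (fun v => primeForm (v + τ) τ) u = logDeriv (fun v => primeForm v τ) (u + τ) := by
    rw [logDeriv_apply, logDeriv_apply, deriv_comp_add_const (fun v => primeForm v τ)]
  have h3 : HasDerivAt (fun v => -exp (-(π * I * τ) - 2 * π * I * v))
      (-(exp (-(π * I * τ) - 2 * π * I * u) * (-(2 * π * I)))) u := by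
    have h4 : HasDerivAt (fun v => -(π * I * τ) - 2 * π * I * v) (-(2 * π * I)) u := by
      simpa using ((hasDerivAt_id u).const_mul (2 * π * I)).const_sub (-(π * I * τ))
    exact h4.cexp.neg
  have he := Complex.exp_ne_zero (-(π * I * τ) - 2 * π * I * u)
  rw [← h2, h1, logDeriv_mul (f := fun v => -exp (-(π * I * τ) - 2 * π * I * v)) u
      (neg_ne_zero.2 he) hu h3.differentiableAt (differentiable_primeForm hτ u),
    logDeriv_apply (fun v => -exp (-(π * I * τ) - 2 * π * I * v)), h3.deriv]
  field_simp

/-- Both sides have the same derivative and agree at the fixed point u = 1/2 of the reflection. The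
segment from 1/2 to u stays in the domain. -/
theorem logPrimeForm_one_sub (h : (τ, u) ∈ logDomain) :
    logPrimeForm (1 - u) τ = logPrimeForm u τ := by
  have hτ := h.1
  have key : (fun v => logPrimeForm (1 - v) τ - logPrimeForm v τ) (1 / 2) =
      (fun v => logPrimeForm (1 - v) τ - logPrimeForm v τ) u := by
    refine eq_of_hasDerivAt_zero_segment
      (g := fun v => logPrimeForm (1 - v) τ - logPrimeForm v τ) fun x hx => ?_
    have hx1 : (τ, x) ∈ logDomain := by
      rw [segment_eq_image] at hx
      obtain ⟨s, ⟨hs0, hs1⟩, rfl⟩ := hx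
      refine ⟨hτ, ?_⟩
      have e : (1 - s) • (1 / 2 : ℂ) + s • u = ((1 - s) / 2 : ℝ) + (s : ℝ) * u := by
        simp only [Complex.real_smul]; push_cast; ring
      simp only [e, latX_add, latY_add, latX_ofReal, latY_ofReal, latX_real_mul, latY_real_mul]
      rcases h.2 with h2 | h2
      · left; simp only at h2
        constructor <;> nlinarith [h2.1, h2.2]
      · simp only at h2
        rcases hs0.eq_or_lt with rfl | hs0
        · left; norm_num
        · right
          rw [zero_add, abs_mul, abs_of_pos hs0]
          exact ⟨mul_ne_zero hs0.ne' h2.1, by nlinarith [abs_nonneg (latY u τ)]⟩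
    have hx2 : (τ, 1 - x) ∈ logDomain := by
      refine ⟨hτ, ?_⟩
      simp only [latX_sub, latY_sub, latX_one, latY_one, zero_sub, abs_neg, neg_ne_zero]
      have := hx1.2
      simp only at this
      exact this.imp (fun h => ⟨by linarith [h.2], by linarith [h.1]⟩) id
    have h1 := (hasDerivAt_logPrimeForm hx2).comp x (h₂ := fun v => logPrimeForm v τ)
      ((hasDerivAt_id x).const_sub 1)
    refine (h1.sub (hasDerivAt_logPrimeForm hx1)).congr_deriv ?_
    rw [logDeriv_primeForm_one_sub]
    ring
  simp only at key
  rw [show (1 : ℂ) - 1 / 2 = 1 / 2 by ring, sub_self] at key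
  exact sub_eq_zero.1 key.symm

theorem log_neg_of_im_pos (hu : 0 < u.im) : Complex.log (-u) = Complex.log u - π * I := by
  rw [Complex.log, Complex.log, norm_neg, Complex.arg_neg_eq_arg_sub_pi_of_im_pos hu]
  push_cast; ring

theorem mem_logDomain_of_latY (hτ : 0 < τ.im) (h0 : latY u τ ≠ 0) (h1 : |latY u τ| < 1) :
    (τ, u) ∈ logDomain := ⟨hτ, Or.inr ⟨h0, h1⟩⟩

theorem mem_logDomain_of_latX (hτ : 0 < τ.im) (h0 : 0 < latX u τ) (h1 : latX u τ < 1) :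
    (τ, u) ∈ logDomain := ⟨hτ, Or.inl ⟨h0, h1⟩⟩

/-- The logarithm of E(u)/u is even, so the whole change comes from the principal `Log u`, which
loses πi in the upper half plane. -/
theorem logPrimeForm_neg (hτ : 0 < τ.im) (h0 : 0 < latY u τ) (h1 : latY u τ < 1) :
    logPrimeForm (-u) τ = logPrimeForm u τ - π * I := by
  have hu : 0 < u.im := by
    rw [latY, lt_div_iff₀ hτ, zero_mul] at h0; exact h0
  have habs : |latY u τ| < 1 := abs_lt.2 ⟨by linarith, h1⟩
  rw [logPrimeForm_eq_of_mem (mem_logDomain_of_latY hτ h0.ne' habs),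
    logPrimeForm_eq_of_mem (mem_logDomain_of_latY hτ (by rw [latY_neg]; linarith)
      (by rwa [latY_neg, abs_neg])), regLog_neg, log_neg_of_im_pos hu]
  ring

theorem logPrimeForm_neg_of_neg (hτ : 0 < τ.im) (h0 : latY u τ < 0) (h1 : -1 < latY u τ) :
    logPrimeForm (-u) τ = logPrimeForm u τ + π * I := by
  have := logPrimeForm_neg (u := -u) hτ (by rw [latY_neg]; linarith) (by rw [latY_neg]; linarith)
  rw [neg_neg] at this
  rw [this]; ring

/-- The derivatives agree up to the constant -2πi. The additive constant is read off at u = -τ/2,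
where u + τ = -u and the rule for a sign change applies. -/
theorem logPrimeForm_add_tau (hτ : 0 < τ.im)
    (h : (0 < latX u τ ∧ latX u τ < 1) ∨ (-1 < latY u τ ∧ latY u τ < 0)) :
    logPrimeForm (u + τ) τ = logPrimeForm u τ + π * I - π * I * τ - 2 * π * I * u := by
  have key : (fun v => logPrimeForm (v + τ) τ - logPrimeForm v τ + 2 * π * I * v) (-τ / 2) =
      (fun v => logPrimeForm (v + τ) τ - logPrimeForm v τ + 2 * π * I * v) u := by
    refine eq_of_hasDerivAt_zero_segment
      (g := fun v => logPrimeForm (v + τ) τ - logPrimeForm v τ + 2 * π * I * v) fun x hx => ?_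
    have hx0 : (0 < latX x τ ∧ latX x τ < 1) ∨ (-1 < latY x τ ∧ latY x τ < 0) := by
      rw [segment_eq_image] at hx
      obtain ⟨s, ⟨hs0, hs1⟩, rfl⟩ := hx
      have e : (1 - s) • (-τ / 2 : ℂ) + s • u = (-(1 - s) / 2 : ℝ) * τ + (s : ℝ) * u := by
        simp only [Complex.real_smul]; push_cast; ring
      simp only [e, latX_add, latY_add, latX_real_mul, latY_real_mul, latX_self hτ, latY_self hτ]
      rcases hs0.eq_or_lt with rfl | hs0
      · right; norm_num
      rcases h with h | h
      · left; constructor <;> nlinarith [h.1, h.2]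
      · right
        constructor <;> nlinarith [h.1, h.2]
    have hx1 : (τ, x) ∈ logDomain :=
      hx0.elim (fun h => mem_logDomain_of_latX hτ h.1 h.2)
        (fun h => mem_logDomain_of_latY hτ h.2.ne (abs_lt.2 ⟨h.1, by linarith⟩))
    have hx2 : (τ, x + τ) ∈ logDomain :=
      hx0.elim (fun h => mem_logDomain_of_latX hτ (by rw [latX_add, latX_self hτ]; linarith)
          (by rw [latX_add, latX_self hτ]; linarith))
        (fun h => mem_logDomain_of_latY hτ (by rw [latY_add, latY_self hτ]; linarith)
          (by rw [latY_add, latY_self hτ]; exact abs_lt.2 ⟨by linarith, by linarith⟩))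
    have h1 := (hasDerivAt_logPrimeForm hx2).comp x (h₂ := fun v => logPrimeForm v τ)
      ((hasDerivAt_id x).add_const τ)
    have h2 : HasDerivAt (fun v => 2 * π * I * v) (2 * π * I) x := by
      simpa using (hasDerivAt_id x).const_mul (2 * π * I)
    refine ((h1.sub (hasDerivAt_logPrimeForm hx1)).add h2).congr_deriv ?_
    rw [logDeriv_primeForm_add_tau hτ (primeForm_ne_zero_of_mem hx1)]
    ring
  simp only at key
  have hb := logPrimeForm_neg (u := τ / 2) hτ (by rw [latY_div_two, latY_self hτ]; norm_num)
    (by rw [latY_div_two, latY_self hτ]; norm_num)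
  rw [show -τ / 2 + τ = τ / 2 by ring, show -τ / 2 = -(τ / 2) by ring, hb] at key
  linear_combination -key

theorem regLogDeriv_div (hτ : 0 < τ.im) (h : regForm u τ ≠ 0) :
    regLogDeriv (u / τ) (-1 / τ) = 2 * π * I * u + τ * regLogDeriv u τ := by
  have hτ0 : τ ≠ 0 := by rintro rfl; simp at hτ
  have hf : (fun v => regForm v (-1 / τ)) =
      fun v => exp (π * I * (τ * v) ^ 2 / τ) * regForm (τ * v) τ := by
    funext v
    rw [← regForm_div hτ, mul_div_cancel_left₀ _ hτ0]
  have h1 : HasDerivAt (fun v => regForm (τ * v) τ) (deriv (fun v => regForm v τ) u * τ) (u / τ) := by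
    have h2 : HasDerivAt (fun v => regForm v τ) (deriv (fun v => regForm v τ) u) (τ * (u / τ)) := by
      rw [mul_div_cancel₀ _ hτ0]
      exact (differentiable_regForm hτ u).hasDerivAt
    exact h2.comp (u / τ) (by simpa using (hasDerivAt_id (u / τ)).const_mul τ)
  have h3 : HasDerivAt (fun v => exp (π * I * (τ * v) ^ 2 / τ))
      (exp (π * I * u ^ 2 / τ) * (2 * π * I * u)) (u / τ) := by
    have h4 : HasDerivAt (fun v => τ * v) τ (u / τ) := by
      simpa using (hasDerivAt_id (u / τ)).const_mul τ
    have h5 := (((h4.pow 2).const_mul (π * I)).div_const τ).cexp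
    have e : τ * (u / τ) = u := mul_div_cancel₀ _ hτ0
    simp only [Pi.pow_apply, e] at h5
    refine h5.congr_deriv ?_
    field_simp
    norm_num
    ring
  have h6 := h3.mul h1
  have e : τ * (u / τ) = u := mul_div_cancel₀ _ hτ0
  rw [regLogDeriv, regLogDeriv, regForm_div hτ, hf]
  rw [show deriv (fun v => exp (π * I * (τ * v) ^ 2 / τ) * regForm (τ * v) τ) (u / τ) = _ from
    h6.deriv]
  have he := Complex.exp_ne_zero (π * I * u ^ 2 / τ)
  rw [e]
  field_simp

/-- Integrating the law of the logarithmic derivative along the ray avoids every choice of branch.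
The Gaussian factor contributes the integral of 2πi u² s/τ over s in [0, 1]. -/
theorem regLog_div (h : (τ, u) ∈ starDomain) :
    regLog (u / τ) (-1 / τ) = π * I * u ^ 2 / τ + regLog u τ := by
  have hτ : 0 < τ.im := im_pos_of_mem_starDomain h
  have hτ0 : τ ≠ 0 := by rintro rfl; simp at hτ
  have hi : ∫ s in (0 : ℝ)..1, regLogDeriv (s * (u / τ)) (-1 / τ) =
      ∫ s in (0 : ℝ)..1, ((s : ℂ) * (2 * π * I * u) + τ * regLogDeriv (s * u) τ) := by
    refine intervalIntegral.integral_congr fun s hs => ?_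
    rw [uIcc_of_le zero_le_one] at hs
    have := regLogDeriv_div hτ (regForm_ne_zero (real_mul_mem_starDomain h hs.1 hs.2))
    rw [← mul_div_assoc, this]
    ring
  have hc : ContinuousOn (fun s : ℝ => regLogDeriv (s * u) τ) (uIcc 0 1) := by
    rw [uIcc_of_le zero_le_one]
    exact (differentiableOn_regLogDeriv τ).continuousOn.comp (by fun_prop)
      (fun s hs => real_mul_mem_starDomain h hs.1 hs.2)
  have hs : ∫ s in (0 : ℝ)..1, (s : ℂ) = 1 / 2 := by
    rw [intervalIntegral.integral_ofReal, integral_id]; norm_num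
  rw [regLog, regLog, hi, intervalIntegral.integral_add, intervalIntegral.integral_mul_const,
    intervalIntegral.integral_const_mul, hs]
  · field_simp
  · exact (Continuous.intervalIntegrable (by fun_prop) _ _)
  · exact hc.intervalIntegrable.const_mul τ

theorem logPrimeForm_div (h : (τ, u) ∈ starDomain) (h' : (-1 / τ, u / τ) ∈ starDomain) (hu : u ≠ 0)
    (hlog : Complex.log (u / τ) = Complex.log u - Complex.log τ) :
    logPrimeForm (u / τ) (-1 / τ) = logPrimeForm u τ - Complex.log τ + π * I * u ^ 2 / τ := by
  have hτ : 0 < τ.im := im_pos_of_mem_starDomain h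
  have hτ0 : τ ≠ 0 := by rintro rfl; simp at hτ
  rw [logPrimeForm_eq h hu, logPrimeForm_eq h' (div_ne_zero hu hτ0), regLog_div h, hlog]
  ring

/-- The second logarithmic derivative of the prime form. -/
def primeFormDeriv2 (u τ : ℂ) : ℂ := deriv (logDeriv fun v => primeForm v τ) u

theorem primeFormDeriv2_neg (u τ : ℂ) : primeFormDeriv2 (-u) τ = primeFormDeriv2 u τ := by
  have h1 : (fun u => logDeriv (fun v => primeForm v τ) (-u)) =
      fun u => -logDeriv (fun v => primeForm v τ) u := by
    funext v; exact logDeriv_primeForm_neg v τ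
  have h2 := deriv_comp_neg (logDeriv fun v => primeForm v τ) u
  rw [h1, deriv.fun_neg] at h2
  exact (neg_inj.1 h2).symm

theorem primeFormDeriv2_add_one (u τ : ℂ) : primeFormDeriv2 (u + 1) τ = primeFormDeriv2 u τ := by
  have h1 : (fun u => logDeriv (fun v => primeForm v τ) (u + 1)) =
      fun u => logDeriv (fun v => primeForm v τ) u := by
    funext v; exact logDeriv_primeForm_add_one v τ
  have h2 := deriv_comp_add_const (logDeriv fun v => primeForm v τ) 1 u
  rw [h1] at h2
  exact h2.symm

theorem primeFormDeriv2_one_sub (u τ : ℂ) : primeFormDeriv2 (1 - u) τ = primeFormDeriv2 u τ := by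
  rw [sub_eq_neg_add, primeFormDeriv2_add_one, primeFormDeriv2_neg]

theorem eventually_primeForm_ne_zero (hτ : 0 < τ.im) (hu : primeForm u τ ≠ 0) :
    ∀ᶠ v in 𝓝 u, primeForm v τ ≠ 0 :=
  (differentiable_primeForm hτ).continuous.continuousAt.eventually_ne hu

theorem primeFormDeriv2_add_tau (hτ : 0 < τ.im) (hu : primeForm u τ ≠ 0) :
    primeFormDeriv2 (u + τ) τ = primeFormDeriv2 u τ := by
  have h2 := deriv_comp_add_const (logDeriv fun v => primeForm v τ) τ u
  rw [primeFormDeriv2, ← h2, primeFormDeriv2]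
  have : (fun x => logDeriv (fun v => primeForm v τ) (x + τ)) =ᶠ[𝓝 u]
      fun x => -(2 * π * I) + logDeriv (fun v => primeForm v τ) x := by
    filter_upwards [eventually_primeForm_ne_zero hτ hu] with v hv
    exact logDeriv_primeForm_add_tau hτ hv
  rw [this.deriv_eq, deriv_const_add]

theorem differentiableAt_logDeriv_primeForm (hτ : 0 < τ.im) (hu : primeForm u τ ≠ 0) :
    DifferentiableAt ℂ (logDeriv fun v => primeForm v τ) u := by
  have h := differentiable_primeForm hτ
  exact (h.contDiff (n := 2)).differentiable_deriv_two.differentiableAt.div (h u) hu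

theorem deriv_logDeriv_ratio {z t : ℂ} (hτ : 0 < τ.im) (ht : primeForm t τ ≠ 0)
    (hz : primeForm (z + t) τ ≠ 0) :
    deriv (logDeriv fun s => primeForm (z + s) τ / primeForm s τ) t =
      primeFormDeriv2 (z + t) τ - primeFormDeriv2 t τ := by
  have hE := differentiable_primeForm hτ
  have hcomp : ∀ s, logDeriv (fun s => primeForm (z + s) τ) s =
      logDeriv (fun v => primeForm v τ) (z + s) := fun s => by
    rw [logDeriv_apply, logDeriv_apply, deriv_comp_const_add (fun v => primeForm v τ)]
  have hev : (logDeriv fun s => primeForm (z + s) τ / primeForm s τ) =ᶠ[𝓝 t]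
      fun s => logDeriv (fun v => primeForm v τ) (z + s) - logDeriv (fun v => primeForm v τ) s := by
    have hc : ContinuousAt (fun s => z + s) t := by fun_prop
    filter_upwards [eventually_primeForm_ne_zero hτ ht,
      hc.eventually (eventually_primeForm_ne_zero hτ hz)] with s hs hs'
    rw [← hcomp]
    exact logDeriv_div s hs' hs ((hE _).comp s (f := fun s => z + s) (by fun_prop)) (hE s)
  rw [hev.deriv_eq, deriv_fun_sub, deriv_comp_const_add (logDeriv fun v => primeForm v τ)]
  · rfl
  · exact (differentiableAt_logDeriv_primeForm hτ hz).comp t (f := fun s => z + s) (by fun_prop)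
  · exact differentiableAt_logDeriv_primeForm hτ ht

theorem logDeriv_primeForm_div (hτ : 0 < τ.im) (hu : primeForm u τ ≠ 0) :
    logDeriv (fun v => primeForm v (-1 / τ)) (u / τ) =
      2 * π * I * u + τ * logDeriv (fun v => primeForm v τ) u := by
  have hτ0 : τ ≠ 0 := by rintro rfl; simp at hτ
  have e : τ * (u / τ) = u := mul_div_cancel₀ _ hτ0
  have hf : (fun v => primeForm v (-1 / τ)) =
      fun v => τ⁻¹ * exp (π * I * (τ * v) ^ 2 / τ) * primeForm (τ * v) τ := by
    funext v
    rw [← primeForm_div hτ, mul_div_cancel_left₀ _ hτ0]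
  have h4 : HasDerivAt (fun v => τ * v) τ (u / τ) := by
    simpa using (hasDerivAt_id (u / τ)).const_mul τ
  have h1 : HasDerivAt (fun v => primeForm (τ * v) τ) (deriv (fun v => primeForm v τ) u * τ)
      (u / τ) := by
    have h2 : HasDerivAt (fun v => primeForm v τ) (deriv (fun v => primeForm v τ) u)
        (τ * (u / τ)) := by
      rw [e]
      exact (differentiable_primeForm hτ u).hasDerivAt
    exact h2.comp (u / τ) h4
  have h3 : HasDerivAt (fun v => τ⁻¹ * exp (π * I * (τ * v) ^ 2 / τ))
      (τ⁻¹ * (exp (π * I * u ^ 2 / τ) * (2 * π * I * u))) (u / τ) := by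
    have h5 := ((((h4.pow 2).const_mul (π * I)).div_const τ).cexp).const_mul τ⁻¹
    simp only [Pi.pow_apply, e] at h5
    refine h5.congr_deriv ?_
    field_simp
    norm_num
    ring
  have h6 := h3.mul h1
  rw [logDeriv_apply, primeForm_div hτ, hf]
  rw [show deriv (fun v => τ⁻¹ * exp (π * I * (τ * v) ^ 2 / τ) * primeForm (τ * v) τ) (u / τ) = _
    from h6.deriv, logDeriv_apply]
  have he := Complex.exp_ne_zero (π * I * u ^ 2 / τ)
  simp only [e]
  field_simp

/-- The inhomogeneous term 2πiτ does not depend on u. It therefore cancels in the difference of two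
such values, which is all that the integrand contains. -/
theorem primeFormDeriv2_div (hτ : 0 < τ.im) (hu : primeForm u τ ≠ 0) :
    primeFormDeriv2 (u / τ) (-1 / τ) = 2 * π * I * τ + τ ^ 2 * primeFormDeriv2 u τ := by
  have hτ0 : τ ≠ 0 := by rintro rfl; simp at hτ
  have e : τ * (u / τ) = u := mul_div_cancel₀ _ hτ0
  have hev : (logDeriv fun v => primeForm v (-1 / τ)) =ᶠ[𝓝 (u / τ)]
      fun v => 2 * π * I * (τ * v) + τ * logDeriv (fun v => primeForm v τ) (τ * v) := by
    have hc : ContinuousAt (fun v => τ * v) (u / τ) := by fun_prop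
    filter_upwards [hc.eventually (p := fun v => primeForm v τ ≠ 0)
      (by simpa only [e] using eventually_primeForm_ne_zero hτ hu)] with v hv
    have := logDeriv_primeForm_div hτ hv
    rwa [mul_div_cancel_left₀ _ hτ0] at this
  have h4 : HasDerivAt (fun v => τ * v) τ (u / τ) := by
    simpa using (hasDerivAt_id (u / τ)).const_mul τ
  have h1 : HasDerivAt (fun v => logDeriv (fun v => primeForm v τ) (τ * v))
      (primeFormDeriv2 u τ * τ) (u / τ) := by
    have h2 : HasDerivAt (logDeriv fun v => primeForm v τ) (primeFormDeriv2 u τ)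
        (τ * (u / τ)) := by
      rw [e]
      exact (differentiableAt_logDeriv_primeForm hτ hu).hasDerivAt
    exact h2.comp (u / τ) h4
  rw [primeFormDeriv2, hev.deriv_eq]
  refine ((h4.const_mul (2 * π * I)).add (h1.const_mul τ)).deriv.trans ?_
  ring

end LogPrimeForm

/-! ### Hadamard finite parts -/

section FinitePart

open Set

variable {p : ℕ} {g g₁ g₂ : ℝ → ℂ} {J J₁ J₂ : ℂ}

/-- `J` is the finite part of `∫₀¹ g`, for an integrand of type `t ^ (-2 - 1 / p)` at `0` that is
regular at `1`. -/
def HasRayPart (p : ℕ) (g : ℝ → ℂ) (J : ℂ) : Prop :=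
  (∀ ε : ℝ, 0 < ε → ε ≤ 1 → IntervalIntegrable g volume ε 1) ∧
  ∃ A B : ℂ, Tendsto (fun ε : ℝ => (∫ t in ε..1, g t)
      - A * ((ε ^ (-1 - 1 / (p : ℝ)) : ℝ) : ℂ) - B * ((ε ^ (-(1 / (p : ℝ))) : ℝ) : ℂ))
    (𝓝[>] 0) (𝓝 J)

open Classical in
/-- The finite part of `∫₀¹ g`, and `0` if there is none. -/
def rayPart (p : ℕ) (g : ℝ → ℂ) : ℂ := if h : ∃ J, HasRayPart p g J then h.choose else 0

theorem tendsto_rpow_ofReal_zero {r : ℝ} (hr : 0 < r) :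
    Tendsto (fun ε : ℝ => ((ε ^ r : ℝ) : ℂ)) (𝓝[>] 0) (𝓝 0) := by
  have h : Tendsto (fun ε : ℝ => ε ^ r) (𝓝[>] 0) (𝓝 0) := by
    have := (Real.continuousAt_rpow_const 0 r (Or.inr hr.le)).tendsto
    rw [Real.zero_rpow hr.ne'] at this
    exact this.mono_left nhdsWithin_le_nhds
  have h2 := (Complex.continuous_ofReal.tendsto 0).comp h
  rwa [Complex.ofReal_zero] at h2

/-- No nontrivial combination of the divergent powers has a nonzero limit. -/
theorem eq_zero_of_tendsto_powers (hp : 0 < p) {A B c : ℂ}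
    (h : Tendsto (fun ε : ℝ => A * ((ε ^ (-1 - 1 / (p : ℝ)) : ℝ) : ℂ)
      + B * ((ε ^ (-(1 / (p : ℝ))) : ℝ) : ℂ)) (𝓝[>] 0) (𝓝 c)) : c = 0 := by
  have hr : (0 : ℝ) < 1 / p := by positivity
  have hε : Tendsto (fun ε : ℝ => (ε : ℂ)) (𝓝[>] 0) (𝓝 0) := by
    have := tendsto_rpow_ofReal_zero (r := 1) one_pos
    simpa using this
  -- Multiplication by ε^(1+1/p) isolates A; once A = 0, multiplication by ε^(1/p) isolates B.
  have h1 := h.mul (tendsto_rpow_ofReal_zero (r := 1 + 1 / (p : ℝ)) (by positivity))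
  rw [mul_zero] at h1
  have hA : A = 0 := by
    have h2 : Tendsto (fun ε : ℝ => A + B * (ε : ℂ)) (𝓝[>] 0) (𝓝 (A + B * 0)) :=
      tendsto_const_nhds.add (hε.const_mul B)
    rw [mul_zero, add_zero] at h2
    refine tendsto_nhds_unique h2 (h1.congr' ?_)
    filter_upwards [self_mem_nhdsWithin] with ε hε0
    have e1 : ε ^ (-1 - 1 / (p : ℝ)) * ε ^ (1 + 1 / (p : ℝ)) = 1 := by
      rw [← Real.rpow_add hε0]; ring_nf; exact Real.rpow_zero ε
    have e2 : ε ^ (-(1 / (p : ℝ))) * ε ^ (1 + 1 / (p : ℝ)) = ε := by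
      rw [← Real.rpow_add hε0]; ring_nf; exact Real.rpow_one ε
    rw [add_mul, mul_assoc, mul_assoc, ← Complex.ofReal_mul, ← Complex.ofReal_mul, e1, e2]
    simp
  simp only [hA, zero_mul, zero_add] at h
  have h3 := h.mul (tendsto_rpow_ofReal_zero hr)
  rw [mul_zero] at h3
  have hB : B = 0 := by
    refine tendsto_nhds_unique tendsto_const_nhds (h3.congr' ?_)
    filter_upwards [self_mem_nhdsWithin] with ε hε0
    have e2 : ε ^ (-(1 / (p : ℝ))) * ε ^ (1 / (p : ℝ)) = 1 := by
      rw [← Real.rpow_add hε0]; ring_nf; exact Real.rpow_zero ε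
    rw [mul_assoc, ← Complex.ofReal_mul, e2]
    simp
  simp only [hB, zero_mul] at h
  exact (tendsto_nhds_unique h tendsto_const_nhds)

theorem eq_of_tendsto_sub_powers (hp : 0 < p) {F : ℝ → ℂ} {A B A' B' c c' : ℂ}
    (h : Tendsto (fun ε : ℝ => F ε - A * ((ε ^ (-1 - 1 / (p : ℝ)) : ℝ) : ℂ)
      - B * ((ε ^ (-(1 / (p : ℝ))) : ℝ) : ℂ)) (𝓝[>] 0) (𝓝 c))
    (h' : Tendsto (fun ε : ℝ => F ε - A' * ((ε ^ (-1 - 1 / (p : ℝ)) : ℝ) : ℂ)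
      - B' * ((ε ^ (-(1 / (p : ℝ))) : ℝ) : ℂ)) (𝓝[>] 0) (𝓝 c')) : c = c' := by
  have := eq_zero_of_tendsto_powers hp (A := A' - A) (B := B' - B) ((h.sub h').congr fun ε => by ring)
  exact sub_eq_zero.1 this

theorem HasRayPart.unique (hp : 0 < p) (h₁ : HasRayPart p g J₁) (h₂ : HasRayPart p g J₂) :
    J₁ = J₂ := by
  obtain ⟨-, A, B, h⟩ := h₁
  obtain ⟨-, A', B', h'⟩ := h₂
  exact eq_of_tendsto_sub_powers hp h h'

theorem HasFinitePart.unique (hp : 0 < p) (h₁ : HasFinitePart p g J₁)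
    (h₂ : HasFinitePart p g J₂) : J₁ = J₂ := by
  obtain ⟨-, A, B, h⟩ := h₁
  obtain ⟨-, A', B', h'⟩ := h₂
  exact eq_of_tendsto_sub_powers hp h h'

theorem HasFinitePart.finitePart_eq (hp : 0 < p) (h : HasFinitePart p g J) :
    finitePart p g = J := by
  have hex : ∃ J, HasFinitePart p g J := ⟨J, h⟩
  rw [finitePart, dif_pos hex]
  exact hex.choose_spec.unique hp h

theorem HasRayPart.rayPart_eq (hp : 0 < p) (h : HasRayPart p g J) : rayPart p g = J := by
  have hex : ∃ J, HasRayPart p g J := ⟨J, h⟩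
  rw [rayPart, dif_pos hex]
  exact hex.choose_spec.unique hp h

theorem HasRayPart.congr (h : HasRayPart p g₁ J) (he : ∀ s, 0 < s → s ≤ 1 → g₁ s = g₂ s) :
    HasRayPart p g₂ J := by
  obtain ⟨hi, A, B, ht⟩ := h
  have hcongr : ∀ ε : ℝ, 0 < ε → ε ≤ 1 → EqOn g₁ g₂ (uIcc ε 1) := fun ε h0 h1 s hs => by
    rw [uIcc_of_le h1] at hs
    exact he s (h0.trans_le hs.1) hs.2
  refine ⟨fun ε h0 h1 => (hi ε h0 h1).congr fun s hs =>
    hcongr ε h0 h1 (uIoc_subset_uIcc hs), A, B, ht.congr' ?_⟩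
  filter_upwards [Ioc_mem_nhdsGT (zero_lt_one' ℝ)] with ε hε
  rw [intervalIntegral.integral_congr (hcongr ε hε.1 hε.2)]

/-- The chosen value depends only on the predicate, so equality holds even when no finite part
exists. -/
theorem rayPart_congr (he : ∀ s, 0 < s → s ≤ 1 → g₁ s = g₂ s) : rayPart p g₁ = rayPart p g₂ := by
  have : HasRayPart p g₁ = HasRayPart p g₂ := by
    funext J
    exact propext ⟨fun h => h.congr he, fun h => h.congr fun s h0 h1 => (he s h0 h1).symm⟩
  unfold rayPart
  generalize HasRayPart p g₁ = P at *
  subst this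
  rfl

theorem HasRayPart.const_mul (h : HasRayPart p g J) (c : ℂ) :
    HasRayPart p (fun s => c * g s) (c * J) := by
  obtain ⟨hi, A, B, ht⟩ := h
  refine ⟨fun ε h0 h1 => (hi ε h0 h1).const_mul c, c * A, c * B, (ht.const_mul c).congr fun ε => ?_⟩
  rw [intervalIntegral.integral_const_mul]
  ring

theorem HasRayPart.add (h₁ : HasRayPart p g₁ J₁) (h₂ : HasRayPart p g₂ J₂) :
    HasRayPart p (fun s => g₁ s + g₂ s) (J₁ + J₂) := by
  obtain ⟨hi, A, B, ht⟩ := h₁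
  obtain ⟨hi', A', B', ht'⟩ := h₂
  refine ⟨fun ε h0 h1 => (hi ε h0 h1).add (hi' ε h0 h1), A + A', B + B', (ht.add ht').congr' ?_⟩
  filter_upwards [Ioc_mem_nhdsGT (zero_lt_one' ℝ)] with ε hε
  rw [intervalIntegral.integral_add (hi ε hε.1 hε.2) (hi' ε hε.1 hε.2)]
  ring

theorem hasRayPart_zero : HasRayPart p (fun _ => 0) 0 :=
  ⟨fun _ _ _ => intervalIntegrable_const, 0, 0, by simp⟩

theorem HasRayPart.sum {ι : Type*} (s : Finset ι) {f : ι → ℝ → ℂ} {K : ι → ℂ}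
    (h : ∀ i ∈ s, HasRayPart p (f i) (K i)) :
    HasRayPart p (fun x => ∑ i ∈ s, f i x) (∑ i ∈ s, K i) := by
  classical
  induction s using Finset.induction_on with
  | empty => simpa using hasRayPart_zero
  | insert a s ha ih =>
    simp only [Finset.sum_insert ha]
    exact (h a (Finset.mem_insert_self a s)).add
      (ih fun i hi => h i (Finset.mem_insert_of_mem hi))

theorem rayPart_const_mul (hp : 0 < p) (c : ℂ) (h : HasRayPart p g J) :
    rayPart p (fun s => c * g s) = c * rayPart p g := by
  rw [(h.const_mul c).rayPart_eq hp, h.rayPart_eq hp]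

/-- Finite parts at the two ends of `[0, 1]` combine to the finite part over `[0, 1]`. -/
theorem HasRayPart.hasFinitePart {f : ℝ → ℂ} (h₀ : HasRayPart p (fun s => f (s / 2)) J₁)
    (h₁ : HasRayPart p (fun s => f (1 - s / 2)) J₂) : HasFinitePart p f ((J₁ + J₂) / 2) := by
  obtain ⟨hi, A, B, ht⟩ := h₀
  obtain ⟨hi', A', B', ht'⟩ := h₁
  have hleft : ∀ ε : ℝ, 0 < ε → ε ≤ 1 / 2 → IntervalIntegrable f volume ε (1 / 2) := by
    intro ε h0 h1
    have := (hi (2 * ε) (by linarith) (by linarith)).comp_mul_left (c := 2)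
    refine (IntervalIntegrable.congr (fun s _ => ?_) this) |> fun h => by
      simpa [show 2 * ε / 2 = ε by ring] using h
    congr 1; ring
  have hright : ∀ ε : ℝ, 0 < ε → ε ≤ 1 / 2 → IntervalIntegrable f volume (1 / 2) (1 - ε) := by
    intro ε h0 h1
    have h2 := (hi' (2 * ε) (by linarith) (by linarith)).comp_mul_left (c := 2)
    have h3 := h2.comp_sub_left 1
    have h4 : IntervalIntegrable f volume (1 - 2 * ε / 2) (1 - 1 / 2) := by
      refine IntervalIntegrable.congr (fun s _ => ?_) h3
      congr 1; ring
    rw [show 1 - 2 * ε / 2 = 1 - ε by ring, show (1 : ℝ) - 1 / 2 = 1 / 2 by norm_num] at h4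
    exact h4.symm
  have hI₀ : ∀ ε : ℝ, ∫ t in (2 * ε)..1, f (t / 2) = 2 * ∫ t in ε..(1 / 2), f t := fun ε => by
    rw [intervalIntegral.integral_comp_div (fun t => f t) (two_ne_zero' ℝ)]
    rw [show 2 * ε / 2 = ε by ring, Complex.real_smul]
    norm_num
  have hI₁ : ∀ ε : ℝ, ∫ t in (2 * ε)..1, f (1 - t / 2) = 2 * ∫ t in (1 / 2)..(1 - ε), f t :=
    fun ε => by
    rw [intervalIntegral.integral_comp_div (fun t => f (1 - t)) (two_ne_zero' ℝ),
      intervalIntegral.integral_comp_sub_left (fun t => f t)]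
    rw [show 1 - 2 * ε / 2 = 1 - ε by ring, Complex.real_smul]
    norm_num
  have hscale : Tendsto (fun ε : ℝ => 2 * ε) (𝓝[>] 0) (𝓝[>] 0) := by
    refine tendsto_nhdsWithin_iff.2 ⟨?_, ?_⟩
    · have : Tendsto (fun ε : ℝ => 2 * ε) (𝓝 0) (𝓝 (2 * 0)) := by
        exact (continuous_const.mul continuous_id).tendsto 0
      rw [mul_zero] at this
      exact this.mono_left nhdsWithin_le_nhds
    · filter_upwards [self_mem_nhdsWithin] with ε hε
      exact mul_pos two_pos (mem_Ioi.1 hε)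
  -- The substitution t = s/2 doubles ε. It multiplies the coefficients of the divergent powers by
  -- powers of 2 and adds nothing to the finite part, since no logarithm of ε occurs.
  refine ⟨fun ε h0 h1 => (hleft ε h0 h1.le).trans (hright ε h0 h1.le),
    (A + A') * ((2 ^ (-1 - 1 / (p : ℝ)) : ℝ) : ℂ) / 2,
    (B + B') * ((2 ^ (-(1 / (p : ℝ))) : ℝ) : ℂ) / 2, ?_⟩
  refine (((ht.comp hscale).add (ht'.comp hscale)).div_const 2).congr' ?_
  filter_upwards [Ioo_mem_nhdsGT (show (0 : ℝ) < 1 / 2 by norm_num)] with ε hε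
  simp only [Function.comp]
  rw [hI₀, hI₁, Real.mul_rpow two_pos.le hε.1.le, Real.mul_rpow two_pos.le hε.1.le,
    ← intervalIntegral.integral_add_adjacent_intervals (hleft ε hε.1 hε.2.le)
      (hright ε hε.1 hε.2.le)]
  push_cast
  ring

end FinitePart

/-! ### The finite part along a ray, and the primitive it defines -/

section RayKernel

open Set

/-- The finite part of `∫₀¹ s ^ (-2 - 1 / p) h (s t) ds`, after two integrations by parts. -/
def rayKernel (p : ℕ) (h : ℂ → ℂ) (t : ℂ) : ℂ :=
  h t / (-1 - 1 / (p : ℂ)) - t * deriv h t / ((-1 - 1 / (p : ℂ)) * (-(1 / (p : ℂ))))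
    + t ^ 2 / ((-1 - 1 / (p : ℂ)) * (-(1 / (p : ℂ)))) *
      ∫ s in (0 : ℝ)..1, ((s ^ (-(1 / (p : ℝ))) : ℝ) : ℂ) * deriv (deriv h) (s * t)

variable {p : ℕ} {U : Set ℂ} {h : ℂ → ℂ} {t : ℂ}

theorem exists_second_order_expansion {U : Set ℂ} (hU : IsOpen U) (h0 : (0 : ℂ) ∈ U) {h : ℂ → ℂ}
    (hh : DifferentiableOn ℂ h U) :
    ∃ d : ℂ → ℂ, ContinuousAt d 0 ∧ ∀ x, h x = h 0 + x * deriv h 0 + x ^ 2 * d x := by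
  have hn : U ∈ 𝓝 (0 : ℂ) := hU.mem_nhds h0
  have h1 := (Complex.differentiableOn_dslope hn).2 hh
  have h2 := (Complex.differentiableOn_dslope hn).2 h1
  refine ⟨dslope (dslope h 0) 0, (h2.differentiableAt hn).continuousAt, fun x => ?_⟩
  have e1 := sub_smul_dslope h 0 x
  have e2 := sub_smul_dslope (dslope h 0) 0 x
  rw [dslope_same] at e2
  simp only [sub_zero, smul_eq_mul] at e1 e2
  linear_combination -e1 - x * e2

theorem exists_first_order_expansion {U : Set ℂ} (hU : IsOpen U) (h0 : (0 : ℂ) ∈ U) {h : ℂ → ℂ}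
    (hh : DifferentiableOn ℂ h U) :
    ∃ d : ℂ → ℂ, ContinuousAt d 0 ∧ ∀ x, h x = h 0 + x * d x := by
  have hn : U ∈ 𝓝 (0 : ℂ) := hU.mem_nhds h0
  have h1 := (Complex.differentiableOn_dslope hn).2 hh
  refine ⟨dslope h 0, (h1.differentiableAt hn).continuousAt, fun x => ?_⟩
  have e1 := sub_smul_dslope h 0 x
  simp only [sub_zero, smul_eq_mul] at e1
  linear_combination -e1

theorem inv_natCast_lt_one (hp : 1 < p) : 1 / (p : ℝ) < 1 := by
  rw [div_lt_one (by positivity)]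
  exact_mod_cast hp

theorem hasRayPart_rayKernel (hp : 1 < p) (hU : IsOpen U)
    (hstar : ∀ u ∈ U, ∀ s ∈ Icc (0 : ℝ) 1, s * u ∈ U) (hh : DifferentiableOn ℂ h U) (ht : t ∈ U) :
    HasRayPart p (fun s => ((s ^ (-2 - 1 / (p : ℝ)) : ℝ) : ℂ) * h (s * t)) (rayKernel p h t) := by
  have hp0 : (0 : ℝ) < p := by positivity
  have hr1 := inv_natCast_lt_one hp
  have hr0 : 0 < 1 / (p : ℝ) := by positivity
  set ρ : ℝ := 1 / (p : ℝ) with hρ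
  have hρc : (1 / (p : ℂ)) = (ρ : ℂ) := by rw [hρ]; push_cast; rfl
  have ha1 : (-1 - (ρ : ℂ)) ≠ 0 := by
    have : (-1 - ρ : ℝ) ≠ 0 := by linarith
    exact_mod_cast this
  have ha2 : (-(ρ : ℂ)) ≠ 0 := by
    have : (-ρ : ℝ) ≠ 0 := by linarith
    exact_mod_cast this
  have hρ0 : (ρ : ℂ) ≠ 0 := neg_ne_zero.1 ha2
  have h0U : (0 : ℂ) ∈ U := by simpa using hstar t ht 0 ⟨le_rfl, zero_le_one⟩
  have hd : DifferentiableOn ℂ (deriv h) U := hh.deriv hU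
  have hdd : DifferentiableOn ℂ (deriv (deriv h)) U := hd.deriv hU
  have hline : ∀ x : ℝ, HasDerivAt (fun x : ℝ => (x : ℂ) * t) t x := fun x => by
    simpa using (Complex.ofRealCLM.hasDerivAt (x := x)).mul_const t
  have hmem : ∀ s ∈ Icc (0 : ℝ) 1, (s : ℂ) * t ∈ U := hstar t ht
  have hpow : ∀ a x : ℝ, 0 < x → HasDerivAt (fun x : ℝ => ((x ^ a : ℝ) : ℂ))
      ((a * x ^ (a - 1) : ℝ) : ℂ) x := fun a x hx =>
    (Real.hasDerivAt_rpow_const (Or.inl hx.ne')).ofReal_comp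
  have hcomp : ∀ {k : ℂ → ℂ}, DifferentiableOn ℂ k U → ∀ x ∈ Icc (0 : ℝ) 1,
      HasDerivAt (fun x : ℝ => k (x * t)) (deriv k (x * t) * t) x := fun hk x hx =>
    (hk.differentiableAt (hU.mem_nhds (hmem x hx))).hasDerivAt.comp x (hline x)
  -- The boundary terms of two integrations by parts. What remains under the integral is s^(-ρ)
  -- h''(st), integrable at 0 because ρ = 1/p < 1.
  set P : ℝ → ℂ := fun s => ((s ^ (-1 - ρ) : ℝ) : ℂ) * h (s * t) / (-1 - ρ)
    - ((s ^ (-ρ) : ℝ) : ℂ) * (t * deriv h (s * t)) / ((-1 - ρ) * (-ρ)) with hP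
  have hPd : ∀ s : ℝ, 0 < s → s ≤ 1 → HasDerivAt P
      (((s ^ (-2 - ρ) : ℝ) : ℂ) * h (s * t) - t ^ 2 / ((-1 - ρ) * (-ρ)) *
        (((s ^ (-ρ) : ℝ) : ℂ) * deriv (deriv h) (s * t))) s := by
    intro s hs hs1
    have e1 := ((hpow (-1 - ρ) s hs).mul (hcomp hh s ⟨hs.le, hs1⟩)).div_const (-1 - (ρ : ℂ))
    have e2 := ((hpow (-ρ) s hs).mul ((hcomp hd s ⟨hs.le, hs1⟩).const_mul t)).div_const
      ((-1 - (ρ : ℂ)) * (-(ρ : ℂ)))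
    refine (e1.sub e2).congr_deriv ?_
    rw [show -1 - ρ - 1 = -2 - ρ by ring, show -ρ - 1 = -1 - ρ by ring]
    push_cast
    field_simp
    ring
  have hcont : ∀ {k : ℂ → ℂ}, DifferentiableOn ℂ k U → ∀ a : ℝ, ∀ ε : ℝ, 0 < ε → ε ≤ 1 →
      IntervalIntegrable (fun s : ℝ => ((s ^ a : ℝ) : ℂ) * k (s * t)) volume ε 1 := by
    intro k hk a ε h0 h1
    refine ContinuousOn.intervalIntegrable ?_
    rw [uIcc_of_le h1]
    refine ContinuousOn.mul ?_ (hk.continuousOn.comp (by fun_prop)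
      fun s hs => hmem s ⟨h0.le.trans hs.1, hs.2⟩)
    exact fun s hs => (hpow a s (h0.trans_le hs.1)).continuousAt.continuousWithinAt
  have hint : ∀ ε : ℝ, 0 < ε → ε ≤ 1 → ∫ s in ε..1, ((s ^ (-2 - ρ) : ℝ) : ℂ) * h (s * t) =
      P 1 - P ε + t ^ 2 / ((-1 - ρ) * (-ρ)) *
        ∫ s in ε..1, ((s ^ (-ρ) : ℝ) : ℂ) * deriv (deriv h) (s * t) := by
    intro ε h0 h1
    have := intervalIntegral.integral_eq_sub_of_hasDerivAt (a := ε) (b := 1) (f := P)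
      (fun s hs => by
        rw [uIcc_of_le h1] at hs
        exact hPd s (h0.trans_le hs.1) hs.2)
      ((hcont hh _ ε h0 h1).sub ((hcont hdd _ ε h0 h1).const_mul _))
    rw [intervalIntegral.integral_sub (hcont hh _ ε h0 h1) ((hcont hdd _ ε h0 h1).const_mul _),
      intervalIntegral.integral_const_mul] at this
    linear_combination this
  -- By Taylor expansion at 0, the boundary terms at ε are multiples of ε^(-1-ρ) and ε^(-ρ) plus a
  -- remainder of order ε^(1-ρ), which vanishes in the limit.
  obtain ⟨d, hdc, hde⟩ := exists_second_order_expansion hU h0U hh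
  obtain ⟨d', hdc', hde'⟩ := exists_first_order_expansion hU h0U hd
  refine ⟨hcont hh _, -(h 0 / (-1 - ρ)),
    -(t * deriv h 0 / (-1 - ρ) - t * deriv h 0 / ((-1 - ρ) * (-ρ))), ?_⟩
  have hεt : Tendsto (fun ε : ℝ => (ε : ℂ) * t) (𝓝[>] 0) (𝓝 0) := by
    have : Tendsto (fun ε : ℝ => (ε : ℂ) * t) (𝓝 0) (𝓝 (((0 : ℝ) : ℂ) * t)) :=
      (hline 0).continuousAt
    rw [Complex.ofReal_zero, zero_mul] at this
    exact this.mono_left nhdsWithin_le_nhds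
  have hrem : Tendsto (fun ε : ℝ => ((ε ^ (1 - ρ) : ℝ) : ℂ) *
      (t ^ 2 * d (ε * t) / (-1 - ρ) - t ^ 2 * d' (ε * t) / ((-1 - ρ) * (-ρ)))) (𝓝[>] 0) (𝓝 0) := by
    have := (tendsto_rpow_ofReal_zero (r := 1 - ρ) (by linarith)).mul
      ((((hdc.tendsto.comp hεt).const_mul (t ^ 2)).div_const (-1 - (ρ : ℂ))).sub
        (((hdc'.tendsto.comp hεt).const_mul (t ^ 2)).div_const ((-1 - (ρ : ℂ)) * (-(ρ : ℂ)))))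
    rw [zero_mul] at this
    exact this
  have hintlim : Tendsto (fun ε : ℝ =>
      ∫ s in ε..1, ((s ^ (-ρ) : ℝ) : ℂ) * deriv (deriv h) (s * t)) (𝓝[>] 0)
      (𝓝 (∫ s in (0 : ℝ)..1, ((s ^ (-ρ) : ℝ) : ℂ) * deriv (deriv h) (s * t))) := by
    have hi : IntervalIntegrable (fun s : ℝ => ((s ^ (-ρ) : ℝ) : ℂ) * deriv (deriv h) (s * t))
        volume 0 1 := by
      refine (intervalIntegrable_ofReal_rpow (by linarith) 0 1).mul_continuousOn ?_
      rw [uIcc_of_le zero_le_one]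
      exact hdd.continuousOn.comp (by fun_prop) hmem
    have hc := intervalIntegral.continuousOn_primitive_interval_left (μ := volume)
      (f := fun s : ℝ => ((s ^ (-ρ) : ℝ) : ℂ) * deriv (deriv h) (s * t)) (a := 0) (b := 1)
      (by
        rw [uIcc_of_le zero_le_one, integrableOn_Icc_iff_integrableOn_Ioc]
        exact (intervalIntegrable_iff_integrableOn_Ioc_of_le zero_le_one).1 hi)
    have h1 := hc 0 left_mem_uIcc
    refine h1.mono_left ?_
    rw [uIcc_of_le zero_le_one]
    exact nhdsWithin_le_of_mem (mem_of_superset (Ioc_mem_nhdsGT (zero_lt_one' ℝ)) Ioc_subset_Icc_self)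
  have hlim := ((tendsto_const_nhds (x := P 1)).sub hrem).add
    (hintlim.const_mul (t ^ 2 / ((-1 - (ρ : ℂ)) * (-(ρ : ℂ)))))
  have hval : P 1 - 0 + t ^ 2 / ((-1 - (ρ : ℂ)) * (-(ρ : ℂ))) *
      (∫ s in (0 : ℝ)..1, ((s ^ (-ρ) : ℝ) : ℂ) * deriv (deriv h) (s * t)) = rayKernel p h t := by
    rw [rayKernel, hρc, ← hρ, hP]
    simp only [Real.one_rpow, Complex.ofReal_one, one_mul, sub_zero]
  rw [hval] at hlim
  refine hlim.congr' ?_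
  filter_upwards [Ioc_mem_nhdsGT (zero_lt_one' ℝ)] with ε hε
  rw [hint ε hε.1 hε.2]
  have e1 : ((ε ^ (-1 - ρ) : ℝ) : ℂ) * ε = ((ε ^ (-ρ) : ℝ) : ℂ) := by
    rw [← Complex.ofReal_mul]
    nth_rw 2 [← Real.rpow_one ε]
    rw [← Real.rpow_add hε.1]; ring_nf
  have e2 : ((ε ^ (-ρ) : ℝ) : ℂ) * ε = ((ε ^ (1 - ρ) : ℝ) : ℂ) := by
    rw [← Complex.ofReal_mul]
    nth_rw 2 [← Real.rpow_one ε]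
    rw [← Real.rpow_add hε.1]; ring_nf
  simp only [hP, ← hρ]
  rw [hde (ε * t), hde' (ε * t), ← e2, ← e1]
  field_simp
  ring

/-- The normalised primitive of `t ^ (-2 - 1 / p) h t`. -/
theorem hasDerivAt_rayKernel (hp : 1 < p) (hU : IsOpen U)
    (hstar : ∀ u ∈ U, ∀ s ∈ Icc (0 : ℝ) 1, s * u ∈ U) (hh : DifferentiableOn ℂ h U) (ht : t ∈ U)
    (hts : t ∈ Complex.slitPlane) :
    HasDerivAt (fun v => v * (Complex.exp ((-2 - 1 / (p : ℂ)) * Complex.log v) * rayKernel p h v))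
      (Complex.exp ((-2 - 1 / (p : ℂ)) * Complex.log t) * h t) t := by
  have hr1 := inv_natCast_lt_one hp
  have hp0 : (p : ℂ) ≠ 0 := by
    have : p ≠ 0 := by lia
    exact_mod_cast this
  have hd : DifferentiableOn ℂ (deriv h) U := hh.deriv hU
  have hdd : DifferentiableOn ℂ (deriv (deriv h)) U := hd.deriv hU
  have hβ : -1 < -(1 / (p : ℝ)) := by linarith
  have hR := (differentiableOn_rayIntegral hU hstar hdd hβ).differentiableAt (hU.mem_nhds ht)
  have hR' := mul_deriv_rayIntegral hU hstar hdd hβ ht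
  set R : ℂ → ℂ := fun u => ∫ s in (0 : ℝ)..1,
    ((s ^ (-(1 / (p : ℝ))) : ℝ) : ℂ) * deriv (deriv h) (s * u) with hRdef
  have hn := hU.mem_nhds ht
  set c : ℂ := (-1 - 1 / (p : ℂ)) * (-(1 / (p : ℂ))) with hc
  have ha1 : (-1 - 1 / (p : ℂ)) ≠ 0 := by
    have : (-1 - 1 / (p : ℝ)) ≠ 0 := by
      have : 0 ≤ 1 / (p : ℝ) := by positivity
      linarith
    have h2 : ((-1 - 1 / (p : ℝ) : ℝ) : ℂ) ≠ 0 := Complex.ofReal_ne_zero.2 this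
    push_cast at h2
    exact h2
  have hc0 : c ≠ 0 := mul_ne_zero ha1 (by simpa using hp0)
  have hK : HasDerivAt (rayKernel p h) (deriv h t / (-1 - 1 / (p : ℂ))
      - (deriv h t + t * deriv (deriv h) t) / c
      + (2 * t / c * R t + t ^ 2 / c * deriv R t)) t := by
    have k1 := (hh.differentiableAt hn).hasDerivAt.div_const (-1 - 1 / (p : ℂ))
    have k2 := ((hasDerivAt_id t).mul (hd.differentiableAt hn).hasDerivAt).div_const c
    have k3 := (((hasDerivAt_id t).pow 2).div_const c).mul hR.hasDerivAt
    refine ((k1.sub k2).add k3).congr_deriv ?_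
    simp
  have hlog : HasDerivAt (fun v => Complex.exp ((-2 - 1 / (p : ℂ)) * Complex.log v))
      (Complex.exp ((-2 - 1 / (p : ℂ)) * Complex.log t) * ((-2 - 1 / (p : ℂ)) * t⁻¹)) t :=
    ((Complex.hasDerivAt_log hts).const_mul _).cexp
  have ht0 : t ≠ 0 := Complex.slitPlane_ne_zero hts
  refine ((hasDerivAt_id t).mul (hlog.mul hK)).congr_deriv ?_
  -- The differential equation of the kernel: the Euler identity with β = -1/p replaces t R' by h''
  -- - (1 - 1/p) R, and everything but h t cancels.
  have hkey : (-1 - 1 / (p : ℂ)) * rayKernel p h t + t * (deriv h t / (-1 - 1 / (p : ℂ))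
      - (deriv h t + t * deriv (deriv h) t) / c + (2 * t / c * R t + t ^ 2 / c * deriv R t)) = h t := by
    have e : rayKernel p h t = h t / (-1 - 1 / (p : ℂ)) - t * deriv h t / c + t ^ 2 / c * R t := rfl
    have e3 : t ^ 2 / c * (t * deriv R t) = t ^ 2 / c *
      (deriv (deriv h) t - (((-(1 / (p : ℝ)) : ℝ) : ℂ) + 1) * R t) := by rw [hR']
    push_cast at e3
    rw [e]
    have e4 : (-1 - 1 / (p : ℂ)) * (h t / (-1 - 1 / (p : ℂ))) = h t := mul_div_cancel₀ _ ha1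
    have e5 : deriv h t / (-1 - 1 / (p : ℂ)) = deriv h t * (-(1 / (p : ℂ))) / c := by
      rw [hc]
      field_simp
    rw [e5]
    linear_combination e4 + e3
  simp only [id, Pi.mul_apply]
  have : t * t⁻¹ = 1 := mul_inv_cancel₀ ht0
  linear_combination (Complex.exp ((-2 - 1 / (p : ℂ)) * Complex.log t)) * hkey +
    Complex.exp ((-2 - 1 / (p : ℂ)) * Complex.log t) * (-2 - 1 / (p : ℂ)) * rayKernel p h t * this

end RayKernel

/-! ### The t-dependent factor of the form and its primitive -/

section Core

open Set
open Complex (I exp)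
open scoped Real

/-- The part of `blockForm` that depends on `t`. -/
def core (p : ℕ) (n : ℤ) (z τ t : ℂ) : ℂ :=
  theta ((n : ℂ) / (2 * (p : ℂ))) 0 (-z - 2 * t) (2 * (p : ℂ) * τ)
    * primePow t τ (-1 / (p : ℂ)) * primePow (z + t) τ (-1 / (p : ℂ))
    * (primeFormDeriv2 (z + t) τ - primeFormDeriv2 t τ)

theorem blockForm_eq (p : ℕ) (n : ℤ) {z τ t : ℂ} (ht : (τ, t) ∈ logDomain)
    (hz : (τ, z + t) ∈ logDomain) : blockForm p n z τ t =
      1 / ModularForm.eta τ ^ 3 * primePow (-z) τ (1 / (2 * (p : ℂ))) * core p n z τ t := by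
  rw [blockForm, core, deriv_logDeriv_ratio (im_pos_of_mem_logDomain ht)
    (primeForm_ne_zero_of_mem ht) (primeForm_ne_zero_of_mem hz)]
  ring

/-- The regular factor of `core` at `t = 0`. -/
def regCore (p : ℕ) (n : ℤ) (x : ℂ × ℂ) (t : ℂ) : ℂ :=
  theta ((n : ℂ) / (2 * (p : ℂ))) 0 (-x.1 - 2 * t) (2 * (p : ℂ) * x.2)
    * exp (-1 / (p : ℂ) * regLog t x.2) * exp (-1 / (p : ℂ) * logPrimeForm (x.1 + t) x.2)
    * (t ^ 2 * primeFormDeriv2 (x.1 + t) x.2 + 1 - t ^ 2 * deriv (fun v => regLogDeriv v x.2) t)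

/-- The domain of `regCore`. -/
def regCoreDomain : Set ((ℂ × ℂ) × ℂ) :=
  {y | (y.1.2, y.2) ∈ starDomain ∧ (y.1.2, y.1.1 + y.2) ∈ logDomain}

theorem isOpen_regCoreDomain : IsOpen regCoreDomain :=
  (isOpen_starDomain.preimage (f := fun y : (ℂ × ℂ) × ℂ => (y.1.2, y.2)) (by fun_prop)).inter
    (isOpen_logDomain.preimage (f := fun y : (ℂ × ℂ) × ℂ => (y.1.2, y.1.1 + y.2)) (by fun_prop))

theorem differentiableOn_theta_joint (a b : ℂ) :
    DifferentiableOn ℂ (fun y : ℂ × ℂ => theta a b y.2 y.1) {y | 0 < y.1.im} := by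
  intro y hy
  apply DifferentiableAt.differentiableWithinAt
  simp_rw [theta_eq_jacobiTheta₂]
  refine DifferentiableAt.mul (by fun_prop) ?_
  exact (hasFDerivAt_jacobiTheta₂ _ hy).differentiableAt.comp y
    (f := fun y : ℂ × ℂ => (y.2 + b + a * y.1, y.1)) (by fun_prop)

theorem differentiableOn_primeFormDeriv2_joint :
    DifferentiableOn ℂ (fun y : ℂ × ℂ => primeFormDeriv2 y.2 y.1) logDomain := by
  refine differentiableOn_partialDeriv isOpen_logDomain
    (f := fun τ u => logDeriv (fun v => primeForm v τ) u) ?_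
  have h1 : DifferentiableOn ℂ (fun y : ℂ × ℂ => deriv (fun v => primeForm v y.1) y.2) logDomain :=
    (differentiableOn_partialDeriv isOpen_upper (f := fun τ v => primeForm v τ)
      differentiableOn_primeForm_joint).mono fun y hy => im_pos_of_mem_logDomain hy
  have h2 : DifferentiableOn ℂ (fun y : ℂ × ℂ => primeForm y.2 y.1) logDomain :=
    differentiableOn_primeForm_joint.mono fun y hy => im_pos_of_mem_logDomain hy
  refine (h1.mul (h2.inv fun y hy => primeForm_ne_zero_of_mem hy)).congr fun y _ => ?_
  simp [Function.uncurry, logDeriv, div_eq_mul_inv]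

theorem differentiableOn_regCore {p : ℕ} (hp : 0 < p) (n : ℤ) :
    DifferentiableOn ℂ (Function.uncurry (regCore p n)) regCoreDomain := by
  have h1 : DifferentiableOn ℂ (fun y : (ℂ × ℂ) × ℂ =>
      theta ((n : ℂ) / (2 * (p : ℂ))) 0 (-y.1.1 - 2 * y.2) (2 * (p : ℂ) * y.1.2)) regCoreDomain := by
    refine (differentiableOn_theta_joint ((n : ℂ) / (2 * (p : ℂ))) 0).comp
      (f := fun y : (ℂ × ℂ) × ℂ => (2 * (p : ℂ) * y.1.2, -y.1.1 - 2 * y.2)) (by fun_prop)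
      fun y hy => ?_
    have := im_pos_of_mem_logDomain hy.2
    have hp' : (0 : ℝ) < p := by exact_mod_cast hp
    have e : (2 * (p : ℂ) * y.1.2).im = 2 * p * y.1.2.im := by
      simp
    rw [Set.mem_ofPred_eq, e]
    positivity
  have hs : MapsTo (fun y : (ℂ × ℂ) × ℂ => (y.1.2, y.2)) regCoreDomain starDomain :=
    fun y hy => hy.1
  have hl : MapsTo (fun y : (ℂ × ℂ) × ℂ => (y.1.2, y.1.1 + y.2)) regCoreDomain logDomain :=
    fun y hy => hy.2
  have h2 : DifferentiableOn ℂ (fun y : (ℂ × ℂ) × ℂ => regLog y.2 y.1.2) regCoreDomain :=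
    differentiableOn_regLog_joint.comp (f := fun y : (ℂ × ℂ) × ℂ => (y.1.2, y.2)) (by fun_prop) hs
  have h3 : DifferentiableOn ℂ (fun y : (ℂ × ℂ) × ℂ => logPrimeForm (y.1.1 + y.2) y.1.2)
      regCoreDomain := differentiableOn_logPrimeForm_joint.comp (f := fun y : (ℂ × ℂ) × ℂ => (y.1.2, y.1.1 + y.2)) (by fun_prop) hl
  have h4 : DifferentiableOn ℂ (fun y : (ℂ × ℂ) × ℂ => primeFormDeriv2 (y.1.1 + y.2) y.1.2)
      regCoreDomain := differentiableOn_primeFormDeriv2_joint.comp (f := fun y : (ℂ × ℂ) × ℂ => (y.1.2, y.1.1 + y.2)) (by fun_prop) hl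
  have h5 : DifferentiableOn ℂ (fun y : (ℂ × ℂ) × ℂ =>
      deriv (fun v => regLogDeriv v y.1.2) y.2) regCoreDomain :=
    (differentiableOn_partialDeriv isOpen_starDomain (f := fun τ v => regLogDeriv v τ)
      differentiableOn_regLogDeriv_joint).comp (f := fun y : (ℂ × ℂ) × ℂ => (y.1.2, y.2)) (by fun_prop) hs
  have h6 : DifferentiableOn ℂ (fun y : (ℂ × ℂ) × ℂ => y.2 ^ 2) regCoreDomain := by fun_prop
  have h7 := ((h1.mul (h2.const_mul (-1 / (p : ℂ))).cexp).mul (h3.const_mul (-1 / (p : ℂ))).cexp).mul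
    (((h6.mul h4).add_const 1).sub (h6.mul h5))
  exact h7

/-- The power t^(-1/p) comes from E(t)^(-1/p) and t^(-2) from the double pole of the second
logarithmic derivative at t = 0. That pole is also the source of the summand 1 in `regCore`. -/
theorem core_eq {p : ℕ} (n : ℤ) {z τ t : ℂ} (ht : (τ, t) ∈ logDomain) :
    core p n z τ t = exp ((-2 - 1 / (p : ℂ)) * Complex.log t) * regCore p n (z, τ) t := by
  have ht0 := ne_zero_of_mem_logDomain ht
  have hs := mem_starDomain_of_mem_logDomain ht
  have h1 : primeFormDeriv2 t τ = -1 / t ^ 2 + deriv (fun v => regLogDeriv v τ) t := by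
    have e : logDeriv (fun v => primeForm v τ) =ᶠ[𝓝 t] fun u => u⁻¹ + regLogDeriv u τ := by
      filter_upwards [(isOpen_starDomain_fiber τ).mem_nhds hs, isOpen_ne.mem_nhds ht0] with u hu hu0
      rw [logDeriv_primeForm hu hu0, one_div]
    rw [primeFormDeriv2, e.deriv_eq, deriv_fun_add (differentiableAt_inv ht0)
      ((differentiableOn_regLogDeriv τ).differentiableAt ((isOpen_starDomain_fiber τ).mem_nhds hs))]
    simp [div_eq_mul_inv]
  have h2 : exp ((-2 - 1 / (p : ℂ)) * Complex.log t) =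
      exp (-1 / (p : ℂ) * Complex.log t) * (t ^ 2)⁻¹ := by
    rw [show (-2 - 1 / (p : ℂ)) * Complex.log t = -1 / (p : ℂ) * Complex.log t +
      (-Complex.log t + -Complex.log t) by ring, Complex.exp_add, Complex.exp_add, Complex.exp_neg,
      Complex.exp_log ht0, sq, mul_inv]
  have h3 : primePow t τ (-1 / (p : ℂ)) =
      exp (-1 / (p : ℂ) * Complex.log t) * exp (-1 / (p : ℂ) * regLog t τ) := by
    rw [primePow, logPrimeForm_eq hs ht0, mul_add, Complex.exp_add]
  rw [core, h1, h2, h3, regCore, primePow]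
  field_simp
  ring

/-- The points `t` such that the rays `[0, t]` and `z + [0, t]` stay in the holomorphy domain. -/
def IsAdmissible (z τ t : ℂ) : Prop :=
  (τ, t) ∈ logDomain ∧ ∀ s ∈ Icc (0 : ℝ) 1, (τ, z + s * t) ∈ logDomain

/-- The primitive of `core p n z τ` normalised at `0`. -/
def prim (p : ℕ) (n : ℤ) (z τ t : ℂ) : ℂ := t * rayPart p (fun s => core p n z τ (s * t))

/-- A ray-star-shaped domain of `regCore`. -/
def rayDomain (x : ℂ × ℂ) : Set ℂ :=
  {t | (x.2, t) ∈ starDomain ∧ ∀ s ∈ Icc (0 : ℝ) 1, (x.2, x.1 + s * t) ∈ logDomain}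

theorem isOpen_rayDomain (x : ℂ × ℂ) : IsOpen (rayDomain x) := by
  refine (isOpen_starDomain_fiber x.2).inter ?_
  refine isOpen_iff_mem_nhds.2 fun t ht => ?_
  refine isCompact_Icc.eventually_forall_of_forall_eventually fun s hs => ?_
  exact (isOpen_logDomain.preimage (f := fun y : ℂ × ℝ => (x.2, x.1 + y.2 * y.1))
    (by fun_prop)).mem_nhds (ht s hs)

theorem real_mul_mem_rayDomain {x : ℂ × ℂ} : ∀ t ∈ rayDomain x, ∀ s ∈ Icc (0 : ℝ) 1,
    s * t ∈ rayDomain x := by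
  refine fun t ht s hs => ⟨real_mul_mem_starDomain ht.1 hs.1 hs.2, fun r hr => ?_⟩
  have := ht.2 (r * s) ⟨mul_nonneg hr.1 hs.1, mul_le_one₀ hr.2 hs.1 hs.2⟩
  rwa [Complex.ofReal_mul, mul_assoc] at this

theorem mem_regCoreDomain_of_mem_rayDomain {x : ℂ × ℂ} {t : ℂ} (h : t ∈ rayDomain x) :
    (x, t) ∈ regCoreDomain :=
  ⟨h.1, by simpa using h.2 1 ⟨zero_le_one, le_rfl⟩⟩

theorem differentiableOn_regCore_fiber {p : ℕ} (hp : 0 < p) (n : ℤ) (x : ℂ × ℂ) :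
    DifferentiableOn ℂ (regCore p n x) (rayDomain x) :=
  (differentiableOn_regCore hp n).comp (f := fun t => (x, t)) (by fun_prop)
    fun _ ht => mem_regCoreDomain_of_mem_rayDomain ht

theorem IsAdmissible.mem_rayDomain {z τ t : ℂ} (h : IsAdmissible z τ t) : t ∈ rayDomain (z, τ) :=
  ⟨mem_starDomain_of_mem_logDomain h.1, h.2⟩

theorem IsAdmissible.add_mem {z τ t : ℂ} (h : IsAdmissible z τ t) : (τ, z + t) ∈ logDomain := by
  simpa using h.2 1 ⟨zero_le_one, le_rfl⟩

theorem isOpen_setOf_isAdmissible (z τ : ℂ) : IsOpen {t | IsAdmissible z τ t} := by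
  have : {t | IsAdmissible z τ t} = {t | (τ, t) ∈ logDomain} ∩ rayDomain (z, τ) := by
    ext t
    exact ⟨fun h => ⟨h.1, h.mem_rayDomain⟩, fun h => ⟨h.1, h.2.2⟩⟩
  rw [this]
  exact (isOpen_logDomain_fiber τ).inter (isOpen_rayDomain _)

variable {p : ℕ} {z τ t : ℂ}

/-- For s > 0 the principal logarithm satisfies Log(st) = log s + Log t, so the singular power
splits into a real power of s and a constant. -/
theorem hasRayPart_core (hp : 1 < p) (n : ℤ) (h : IsAdmissible z τ t) :
    HasRayPart p (fun s => core p n z τ (s * t))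
      (exp ((-2 - 1 / (p : ℂ)) * Complex.log t) * rayKernel p (regCore p n (z, τ)) t) := by
  have h1 := (hasRayPart_rayKernel hp (isOpen_rayDomain (z, τ)) real_mul_mem_rayDomain
    (differentiableOn_regCore_fiber (zero_lt_one.trans hp) n (z, τ)) h.mem_rayDomain).const_mul
      (exp ((-2 - 1 / (p : ℂ)) * Complex.log t))
  refine h1.congr fun s hs0 hs1 => ?_
  rw [core_eq n (real_mul_mem_logDomain h.1 hs0 hs1),
    Complex.log_ofReal_mul hs0 (ne_zero_of_mem_logDomain h.1), mul_add, Complex.exp_add,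
    Real.rpow_def_of_pos hs0]
  push_cast
  rw [mul_comm ((Real.log s : ℂ))]
  ring

theorem prim_eq (hp : 1 < p) (n : ℤ) (h : IsAdmissible z τ t) : prim p n z τ t =
    t * (exp ((-2 - 1 / (p : ℂ)) * Complex.log t) * rayKernel p (regCore p n (z, τ)) t) := by
  rw [prim, (hasRayPart_core hp n h).rayPart_eq (zero_lt_one.trans hp)]

theorem hasDerivAt_prim (hp : 1 < p) (n : ℤ) (h : IsAdmissible z τ t) :
    HasDerivAt (prim p n z τ) (core p n z τ t) t := by
  have h1 := hasDerivAt_rayKernel hp (isOpen_rayDomain (z, τ)) real_mul_mem_rayDomain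
    (differentiableOn_regCore_fiber (zero_lt_one.trans hp) n (z, τ)) h.mem_rayDomain
    (mem_slitPlane_of_mem_logDomain h.1)
  rw [core_eq n h.1]
  refine h1.congr_of_eventuallyEq ?_
  filter_upwards [(isOpen_setOf_isAdmissible z τ).mem_nhds h] with u hu
  exact prim_eq hp n hu

/-- The kernel formula involves only `regCore`, its first two t-derivatives and a convergent
integral, all holomorphic in (z, τ). The endpoint T may move with (z, τ), as the continuation
requires. -/
theorem differentiableOn_prim (hp : 1 < p) (n : ℤ) {U : Set (ℂ × ℂ)} (hU : IsOpen U)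
    {T : ℂ × ℂ → ℂ} (hT : DifferentiableOn ℂ T U) (hadm : ∀ x ∈ U, IsAdmissible x.1 x.2 (T x)) :
    DifferentiableOn ℂ (fun x => prim p n x.1 x.2 (T x)) U := by
  have d0 := differentiableOn_regCore (zero_lt_one.trans hp) n
  have d1 : DifferentiableOn ℂ (Function.uncurry fun x => deriv (regCore p n x)) regCoreDomain :=
    differentiableOn_partialDeriv isOpen_regCoreDomain d0
  have d2 : DifferentiableOn ℂ (Function.uncurry fun x => deriv (deriv (regCore p n x)))
      regCoreDomain := differentiableOn_partialDeriv isOpen_regCoreDomain d1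
  have hmem : ∀ x ∈ U, ∀ s ∈ Icc (0 : ℝ) 1, (x, s * T x) ∈ regCoreDomain := fun x hx s hs =>
    mem_regCoreDomain_of_mem_rayDomain (real_mul_mem_rayDomain _ (hadm x hx).mem_rayDomain s hs)
  have hmem1 : MapsTo (fun x => (x, T x)) U regCoreDomain := fun x hx => by
    simpa using hmem x hx 1 ⟨zero_le_one, le_rfl⟩
  have hpair : DifferentiableOn ℂ (fun x => (x, T x)) U := differentiableOn_id.prodMk hT
  have i0 : DifferentiableOn ℂ (fun x => regCore p n x (T x)) U := d0.comp (f := fun x => (x, T x)) hpair hmem1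
  have i1 : DifferentiableOn ℂ (fun x => deriv (regCore p n x) (T x)) U := d1.comp (f := fun x => (x, T x)) hpair hmem1
  have i2 : DifferentiableOn ℂ (fun x => ∫ s in (0 : ℝ)..1, ((s ^ (-(1 / (p : ℝ))) : ℝ) : ℂ) *
      deriv (deriv (regCore p n x)) (s * T x)) U := by
    refine differentiableOn_intervalIntegral hU zero_le_one
      (f := fun x (s : ℝ) => deriv (deriv (regCore p n x)) (s * T x)) ?_ ?_ ?_
    · refine d2.continuousOn.comp (f := fun y : (ℂ × ℂ) × ℝ => (y.1, (y.2 : ℂ) * T y.1)) ?_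
        fun y hy => hmem y.1 hy.1 y.2 hy.2
      refine continuousOn_fst.prodMk (ContinuousOn.mul (by fun_prop) ?_)
      exact hT.continuousOn.comp continuousOn_fst fun y hy => hy.1
    · intro s hs
      exact d2.comp (f := fun x => (x, (s : ℂ) * T x))
        (differentiableOn_id.prodMk (hT.const_mul _)) fun x hx => hmem x hx s hs
    · exact intervalIntegrable_ofReal_rpow (by have := inv_natCast_lt_one hp; linarith) 0 1
  have ilog : DifferentiableOn ℂ (fun x => Complex.log (T x)) U := fun x hx =>
    (hT x hx).clog (mem_slitPlane_of_mem_logDomain (hadm x hx).1)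
  have key : DifferentiableOn ℂ (fun x => T x * (exp ((-2 - 1 / (p : ℂ)) * Complex.log (T x)) *
      rayKernel p (regCore p n x) (T x))) U := by
    refine hT.mul ((ilog.const_mul _).cexp.mul ?_)
    simp only [rayKernel, div_eq_mul_inv]
    refine DifferentiableOn.add (DifferentiableOn.sub ?_ ?_) (DifferentiableOn.mul ?_ ?_)
    · exact i0.mul_const _
    · exact (hT.mul i1).mul_const _
    · exact (hT.pow 2).mul_const _
    · simpa only [div_eq_mul_inv] using i2
  exact key.congr fun x hx => prim_eq hp n (hadm x hx)

end Core

/-! ### Symmetries of the integrand -/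

section Symmetry

open Set
open Complex (I exp)
open scoped Real

theorem theta_neg (a w T : ℂ) : theta (-a) 0 (-w) T = theta a 0 w T := by
  rw [theta, theta, ← (Equiv.neg ℤ).tsum_eq]
  congr 1
  ext l
  rw [Equiv.neg_apply]
  congr 1
  push_cast
  ring

theorem theta_add_intCast (a w T : ℂ) (m : ℤ) :
    theta a 0 (w + m) T = exp (2 * π * I * a * m) * theta a 0 w T := by
  rw [theta, theta, ← tsum_mul_left]
  congr 1
  ext l
  rw [← Complex.exp_add, Complex.exp_eq_exp_iff_exists_int]
  exact ⟨l * m, by push_cast; ring⟩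

/-- Completing the square: a shift of the argument by a multiple c of the period T is a shift of the
characteristic by c. -/
theorem theta_add_mul (a c w T : ℂ) :
    theta a 0 (w + c * T) T =
      exp (-(π * I * c ^ 2 * T) - 2 * π * I * c * w) * theta (a + c) 0 w T := by
  rw [theta, theta, ← tsum_mul_left]
  congr 1
  ext l
  rw [← Complex.exp_add]
  congr 1
  ring

theorem theta_add_one_left (a w T : ℂ) : theta (a + 1) 0 w T = theta a 0 w T := by
  rw [theta, theta, ← (Equiv.subRight (1 : ℤ)).tsum_eq]
  congr 1
  ext l
  rw [Equiv.subRight_apply]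
  congr 1
  push_cast
  ring

theorem qt_add (p : ℕ) (x y : ℂ) : qt p (x + y) = qt p x * qt p y := by
  rw [qt, qt, qt, mul_add, Complex.exp_add]

theorem qt_zero (p : ℕ) : qt p 0 = 1 := by simp [qt]

theorem qt_neg_mul (p : ℕ) (x : ℂ) : qt p (-x) * qt p x = 1 := by
  rw [← qt_add, neg_add_cancel, qt_zero]

variable {p : ℕ} {z τ t u : ℂ}

/-- Re-centring at -z exchanges the two branch points. The theta argument is unchanged, and the sign
comes from the difference of second derivatives. -/
theorem core_swap (p : ℕ) (n : ℤ) (z τ t : ℂ) : core p n (-z) τ (z + t) = -core p n z τ t := by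
  rw [core, core, show -z + (z + t) = t by ring, show - -z - 2 * (z + t) = -z - 2 * t by ring]
  ring

theorem core_add_period (hp : 0 < p) (n : ℤ) (z τ t : ℂ) :
    core p (n + 2 * p) z τ t = core p n z τ t := by
  have hp' : (p : ℂ) ≠ 0 := by exact_mod_cast hp.ne'
  have e : ((n + 2 * p : ℤ) : ℂ) / (2 * (p : ℂ)) = (n : ℂ) / (2 * (p : ℂ)) + 1 := by
    push_cast
    field_simp
  rw [core, core, e, theta_add_one_left]

/-- This brings the endpoint 1 to 0. The theta argument changes sign and shifts by 2, which flips
the index and produces the phase. -/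
theorem core_one_sub (hp : 0 < p) (n : ℤ) (ht : (τ, t) ∈ logDomain)
    (hz : (τ, z + t) ∈ logDomain) :
    core p n z τ t = qt p (-n) * core p (-n) (-z) τ (1 - t) := by
  have hp' : (p : ℂ) ≠ 0 := by exact_mod_cast hp.ne'
  have h1 : theta (((-n : ℤ) : ℂ) / (2 * (p : ℂ))) 0 (- -z - 2 * (1 - t)) (2 * (p : ℂ) * τ) =
      qt p n * theta ((n : ℂ) / (2 * (p : ℂ))) 0 (-z - 2 * t) (2 * (p : ℂ) * τ) := by
    rw [show ((-n : ℤ) : ℂ) / (2 * (p : ℂ)) = -((n : ℂ) / (2 * (p : ℂ))) by push_cast; ring,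
      show - -z - 2 * (1 - t) = -(-z - 2 * t + (2 : ℤ)) by push_cast; ring, theta_neg,
      theta_add_intCast, qt]
    congr 2
    push_cast
    field_simp
  have h2 : -z + (1 - t) = 1 - (z + t) := by ring
  rw [core, core, h1, h2, primePow, primePow, primePow, primePow, logPrimeForm_one_sub ht,
    logPrimeForm_one_sub hz, primeFormDeriv2_one_sub, primeFormDeriv2_one_sub]
  linear_combination (-(theta ((n : ℂ) / (2 * (p : ℂ))) 0 (-z - 2 * t) (2 * (p : ℂ) * τ)
    * exp (-1 / (p : ℂ) * logPrimeForm t τ) * exp (-1 / (p : ℂ) * logPrimeForm (z + t) τ)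
    * (primeFormDeriv2 (z + t) τ - primeFormDeriv2 t τ))) * qt_neg_mul p n

/-- The points u and z + u lie on opposite sides of the real axis, so their half turns have opposite
sense and the phases cancel. -/
theorem core_neg_neg (n : ℤ) (hτ : 0 < τ.im) (h0 : 0 < latY u τ) (h1 : latY u τ < 1)
    (h2 : -1 < latY (z + u) τ) (h3 : latY (z + u) τ < 0) :
    core p n (-z) τ (-u) = core p (-n) z τ u := by
  have e1 : theta ((n : ℂ) / (2 * (p : ℂ))) 0 (- -z - 2 * -u) (2 * (p : ℂ) * τ) =
      theta (((-n : ℤ) : ℂ) / (2 * (p : ℂ))) 0 (-z - 2 * u) (2 * (p : ℂ) * τ) := by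
    rw [← theta_neg]
    congr 1
    · push_cast; ring
    · ring
  have e2 : -z + -u = -(z + u) := by ring
  have e3 : exp (-1 / (p : ℂ) * (logPrimeForm u τ - π * I)) *
      exp (-1 / (p : ℂ) * (logPrimeForm (z + u) τ + π * I)) =
      exp (-1 / (p : ℂ) * logPrimeForm u τ) * exp (-1 / (p : ℂ) * logPrimeForm (z + u) τ) := by
    rw [← Complex.exp_add, ← Complex.exp_add]
    congr 1
    ring
  rw [core, core, e1, e2, primePow, primePow, primePow, primePow, logPrimeForm_neg hτ h0 h1,
    logPrimeForm_neg_of_neg hτ h3 h2, primeFormDeriv2_neg, primeFormDeriv2_neg]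
  linear_combination (theta (((-n : ℤ) : ℂ) / (2 * (p : ℂ))) 0 (-z - 2 * u) (2 * (p : ℂ) * τ)
    * (primeFormDeriv2 (z + u) τ - primeFormDeriv2 u τ)) * e3

/-- Here both points lie above the real axis; the two half turns have the same sense and add up to
the phase e^(2πi/p). -/
theorem core_neg (n : ℤ) (hτ : 0 < τ.im) (h0 : 0 < latY u τ) (h1 : latY u τ < 1)
    (h2 : 0 < latY (-z + u) τ) (h3 : latY (-z + u) τ < 1) :
    core p n z τ (-u) = qt p 1 * core p (-n) (-z) τ u := by
  have e1 : theta ((n : ℂ) / (2 * (p : ℂ))) 0 (-z - 2 * -u) (2 * (p : ℂ) * τ) =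
      theta (((-n : ℤ) : ℂ) / (2 * (p : ℂ))) 0 (- -z - 2 * u) (2 * (p : ℂ) * τ) := by
    rw [← theta_neg]
    congr 1
    · push_cast; ring
    · ring
  have e2 : z + -u = -(-z + u) := by ring
  have e3 : exp (-1 / (p : ℂ) * (logPrimeForm u τ - π * I)) *
      exp (-1 / (p : ℂ) * (logPrimeForm (-z + u) τ - π * I)) = qt p 1 *
      (exp (-1 / (p : ℂ) * logPrimeForm u τ) * exp (-1 / (p : ℂ) * logPrimeForm (-z + u) τ)) := by
    rw [← Complex.exp_add, ← Complex.exp_add, qt, ← Complex.exp_add]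
    congr 1
    ring
  rw [core, core, e1, e2, primePow, primePow, primePow, primePow, logPrimeForm_neg hτ h0 h1,
    logPrimeForm_neg hτ h2 h3, primeFormDeriv2_neg, primeFormDeriv2_neg]
  linear_combination (theta (((-n : ℤ) : ℂ) / (2 * (p : ℂ))) 0 (- -z - 2 * u) (2 * (p : ℂ) * τ)
    * (primeFormDeriv2 (-z + u) τ - primeFormDeriv2 u τ)) * e3

theorem mem_logDomain_of_or (hτ : 0 < τ.im)
    (hu : (0 < latX u τ ∧ latX u τ < 1) ∨ (-1 < latY u τ ∧ latY u τ < 0)) : (τ, u) ∈ logDomain :=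
  hu.elim (fun h => mem_logDomain_of_latX hτ h.1 h.2)
    (fun h => mem_logDomain_of_latY hτ h.2.ne (by rw [abs_of_neg h.2]; linarith [h.1]))

/-- The shift -2τ of the theta argument is -1/p times its period 2pτ, so the index drops by 2. The
exponential factors cancel those of the two prime forms, and their two phases e^(-πi/p) remain. -/
theorem core_add_tau (hp : 0 < p) (n : ℤ) (hτ : 0 < τ.im)
    (hu : (0 < latX u τ ∧ latX u τ < 1) ∨ (-1 < latY u τ ∧ latY u τ < 0))
    (hz : (0 < latX (z + u) τ ∧ latX (z + u) τ < 1) ∨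
      (-1 < latY (z + u) τ ∧ latY (z + u) τ < 0)) :
    core p n z τ (u + τ) = qt p (-1) * core p (n - 2) z τ u := by
  have hp' : (p : ℂ) ≠ 0 := by exact_mod_cast hp.ne'
  have e1 : theta ((n : ℂ) / (2 * (p : ℂ))) 0 (-z - 2 * (u + τ)) (2 * (p : ℂ) * τ) =
      exp (-(2 * π * I * τ / p) - 2 * π * I * (z + 2 * u) / p) *
        theta (((n - 2 : ℤ) : ℂ) / (2 * (p : ℂ))) 0 (-z - 2 * u) (2 * (p : ℂ) * τ) := by
    rw [show -z - 2 * (u + τ) = (-z - 2 * u) + (-1 / (p : ℂ)) * (2 * (p : ℂ) * τ) by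
      field_simp; ring, theta_add_mul]
    congr 2
    · field_simp
      ring
    · push_cast
      field_simp
      ring
  have e2 : z + (u + τ) = z + u + τ := by ring
  have e3 : exp (-(2 * π * I * τ / p) - 2 * π * I * (z + 2 * u) / p) *
      (exp (-1 / (p : ℂ) * (logPrimeForm u τ + π * I - π * I * τ - 2 * π * I * u)) *
      exp (-1 / (p : ℂ) * (logPrimeForm (z + u) τ + π * I - π * I * τ - 2 * π * I * (z + u)))) =
      qt p (-1) *
      (exp (-1 / (p : ℂ) * logPrimeForm u τ) * exp (-1 / (p : ℂ) * logPrimeForm (z + u) τ)) := by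
    rw [qt, ← Complex.exp_add, ← Complex.exp_add, ← Complex.exp_add, ← Complex.exp_add]
    congr 1
    field_simp
    ring
  have n1 := primeForm_ne_zero_of_mem (mem_logDomain_of_or hτ hu)
  have n2 := primeForm_ne_zero_of_mem (mem_logDomain_of_or hτ hz)
  rw [core, core, e1, e2, primePow, primePow, primePow, primePow, logPrimeForm_add_tau hτ hu,
    logPrimeForm_add_tau hτ hz, primeFormDeriv2_add_tau hτ n1, primeFormDeriv2_add_tau hτ n2]
  linear_combination (theta (((n - 2 : ℤ) : ℂ) / (2 * (p : ℂ))) 0 (-z - 2 * u) (2 * (p : ℂ) * τ)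
    * (primeFormDeriv2 (z + u) τ - primeFormDeriv2 u τ)) * e3

end Symmetry

/-! ### Contour integrals and their linear relations -/

section Relations

open Set
open Complex (I exp)
open scoped Real

variable {p : ℕ} {z ζ τ : ℂ}

/-- A condition under which the parallelogram spanned by `1` and `-ζ` consists of admissible
points. -/
structure IsCompatible (z ζ τ : ℂ) : Prop where
  im_pos : 0 < τ.im
  latX_eq : latX ζ τ = latX z τ
  latY_ne : latY ζ τ ≠ 0
  abs_latY_lt : |latY ζ τ| < 1
  segment : ∀ r : ℝ, 0 ≤ r → r < 1 → latY z τ - r * latY ζ τ ≠ 0 ∧ |latY z τ - r * latY ζ τ| < 1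

theorem IsCompatible.neg (h : IsCompatible z ζ τ) : IsCompatible (-z) (-ζ) τ where
  im_pos := h.im_pos
  latX_eq := by rw [latX_neg, latX_neg, h.latX_eq]
  latY_ne := by rw [latY_neg]; exact neg_ne_zero.2 h.latY_ne
  abs_latY_lt := by rw [latY_neg, abs_neg]; exact h.abs_latY_lt
  segment := fun r h0 h1 => by
    have := h.segment r h0 h1
    rw [latY_neg, latY_neg, show -latY z τ - r * -latY ζ τ = -(latY z τ - r * latY ζ τ) by ring,
      abs_neg]
    exact ⟨neg_ne_zero.2 this.1, this.2⟩

theorem isCompatible_self (hτ : 0 < τ.im) (h0 : -1 < latY z τ) (h1 : latY z τ < 0) :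
    IsCompatible z z τ where
  im_pos := hτ
  latX_eq := rfl
  latY_ne := h1.ne
  abs_latY_lt := by rw [abs_of_neg h1]; linarith
  segment := fun r hr0 hr1 => by
    have h : latY z τ - r * latY z τ < 0 := by nlinarith
    exact ⟨h.ne, by rw [abs_of_neg h]; nlinarith⟩

theorem isCompatible_tau_add (hτ : 0 < τ.im) (h0 : -1 < latY z τ) (h1 : latY z τ < 0) :
    IsCompatible z (τ + z) τ where
  im_pos := hτ
  latX_eq := by rw [latX_add, latX_self hτ, zero_add]
  latY_ne := by rw [latY_add, latY_self hτ]; linarith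
  abs_latY_lt := by rw [latY_add, latY_self hτ, abs_lt]; constructor <;> linarith
  segment := fun r hr0 hr1 => by
    rw [latY_add, latY_self hτ]
    have h : latY z τ - r * (1 + latY z τ) < 0 := by nlinarith
    exact ⟨h.ne, by rw [abs_of_neg h]; nlinarith⟩

/-- The two disjunctions remove the corners t = 0 and t = -ζ. For the choices ζ = z and ζ = τ + z
used below, t or z + t is a lattice point there. -/
theorem IsCompatible.isAdmissible (h : IsCompatible z ζ τ) {x y : ℝ} (hx0 : 0 ≤ x) (hx1 : x ≤ 1)
    (hy1 : y < 1) (hxy : 0 < x ∨ 0 < y) (hxy' : x < 1 ∨ 0 < y) :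
    IsAdmissible z τ (y - x * ζ) := by
  have hX : latX (y - x * ζ) τ = y - x * latX z τ := by
    rw [latX_sub, latX_ofReal, latX_real_mul, h.latX_eq]
  have hY : latY (y - x * ζ) τ = -(x * latY ζ τ) := by
    rw [latY_sub, latY_ofReal, latY_real_mul, zero_sub]
  refine ⟨?_, fun s hs => ?_⟩
  · rcases hx0.eq_or_lt with rfl | hx
    · have hy := hxy.resolve_left (lt_irrefl _)
      rw [zero_mul, sub_zero] at hX
      exact mem_logDomain_of_latX h.im_pos (by rw [hX]; exact hy) (by rw [hX]; exact hy1)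
    · refine mem_logDomain_of_latY h.im_pos ?_ ?_
      · rw [hY]
        exact neg_ne_zero.2 (mul_ne_zero hx.ne' h.latY_ne)
      · rw [hY, abs_neg, abs_mul, abs_of_pos hx]
        nlinarith [abs_nonneg (latY ζ τ), h.abs_latY_lt]
  · have hY' : latY (z + s * (y - x * ζ)) τ = latY z τ - s * x * latY ζ τ := by
      rw [latY_add, latY_real_mul, hY]; ring
    have hX' : latX (z + s * (y - x * ζ)) τ = latX z τ + s * (y - x * latX z τ) := by
      rw [latX_add, latX_real_mul, hX]
    -- The second coordinate of z + s t can vanish only when s = x = 1. There the first coordinate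
    -- equals y, which lies strictly between 0 and 1.
    rcases (mul_le_one₀ hs.2 hx0 hx1).lt_or_eq with hlt | heq
    · have := h.segment (s * x) (mul_nonneg hs.1 hx0) hlt
      exact mem_logDomain_of_latY h.im_pos (hY' ▸ this.1) (hY' ▸ this.2)
    · have hs1 : s = 1 := le_antisymm hs.2 (by nlinarith [hs.1])
      have hx : x = 1 := by rw [hs1, one_mul] at heq; exact heq
      have hy := hxy'.resolve_left (by rw [hx]; exact lt_irrefl _)
      have : latX (z + s * (y - x * ζ)) τ = y := by rw [hX', hs1, hx]; ring
      exact mem_logDomain_of_latX h.im_pos (by rw [this]; exact hy) (by rw [this]; exact hy1)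

/-- The finite part of the integral of `core` over `[0, 1]`. -/
def coreBlock (p : ℕ) (n : ℤ) (z τ : ℂ) : ℂ :=
  prim p n z τ (1 / 2) + qt p (-n) * prim p (-n) (-z) τ (1 / 2)

theorem exists_of_mem_segment {a b v : ℂ} (h : v ∈ segment ℝ a b) :
    ∃ r : ℝ, 0 ≤ r ∧ r ≤ 1 ∧ v = a + r * (b - a) := by
  rw [segment_eq_image'] at h
  obtain ⟨r, hr, rfl⟩ := h
  exact ⟨r, hr.1, hr.2, by simp⟩

/-- The path from 0 to 1 may be cut at 1/2 - ζ/2 instead of 1/2: by the reflection t ↦ 1 - t, the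
sum of the two primitives is constant along the segment between these points. -/
theorem IsCompatible.prim_add_prim_eq_coreBlock (h : IsCompatible z ζ τ) (hp : 1 < p) (n : ℤ) :
    prim p n z τ (1 / 2 - ζ / 2) + qt p (-n) * prim p (-n) (-z) τ (1 / 2 + ζ / 2) =
      coreBlock p n z τ := by
  have key := eq_of_hasDerivAt_zero_segment (a := 1 / 2 - ζ / 2) (b := 1 / 2)
    (g := fun v => prim p n z τ v + qt p (-n) * prim p (-n) (-z) τ (1 - v)) ?_
  · rw [coreBlock]
    rw [show (1 : ℂ) - (1 / 2 - ζ / 2) = 1 / 2 + ζ / 2 by ring,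
      show (1 : ℂ) - 1 / 2 = 1 / 2 by ring] at key
    exact key
  · intro v hv
    obtain ⟨r, hr0, hr1, rfl⟩ := exists_of_mem_segment hv
    set v := 1 / 2 - ζ / 2 + r * (1 / 2 - (1 / 2 - ζ / 2)) with hvdef
    have e1 : v = ((1 / 2 : ℝ) : ℂ) - (((1 - r) / 2 : ℝ) : ℂ) * ζ := by
      rw [hvdef]; push_cast; ring
    have e2 : 1 - v = ((1 / 2 : ℝ) : ℂ) - (((1 - r) / 2 : ℝ) : ℂ) * -ζ := by
      rw [hvdef]; push_cast; ring
    have a1 : IsAdmissible z τ v := by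
      rw [e1]
      refine h.isAdmissible ?_ ?_ ?_ (Or.inr ?_) (Or.inr ?_) <;> linarith
    have a2 : IsAdmissible (-z) τ (1 - v) := by
      rw [e2]
      refine h.neg.isAdmissible ?_ ?_ ?_ (Or.inr ?_) (Or.inr ?_) <;> linarith
    have d1 := hasDerivAt_prim hp n a1
    have d2 := (hasDerivAt_prim hp (-n) a2).comp v ((hasDerivAt_id v).const_sub 1)
    refine (d1.add (d2.const_mul (qt p (-n)))).congr_deriv ?_
    rw [core_one_sub (zero_lt_one.trans hp) n a1.1 a1.add_mem]
    ring

/-- A symmetry of `core` along the whole ray passes to the finite part. The outer sign comes from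
the factor t in `prim`. -/
theorem prim_neg_arg (hp : 1 < p) {n m : ℤ} {z' v c : ℂ} (h : IsAdmissible z' τ v)
    (hc : ∀ s : ℝ, 0 < s → s ≤ 1 → core p n z τ (-(s * v)) = c * core p m z' τ (s * v)) :
    prim p n z τ (-v) = -(c * prim p m z' τ v) := by
  rw [prim, prim, ← neg_mul, ← mul_assoc, rayPart_congr (g₂ := fun s => c * core p m z' τ (s * v)),
    rayPart_const_mul (zero_lt_one.trans hp) c (hasRayPart_core hp m h)]
  · ring
  · intro s h0 h1
    rw [← hc s h0 h1]
    congr 1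
    ring

theorem IsCompatible.isAdmissible_half (h : IsCompatible z ζ τ) : IsAdmissible z τ (-(ζ / 2)) := by
  have := h.isAdmissible (x := 1 / 2) (y := 0) (by norm_num)
    (by norm_num) one_pos (Or.inl (by norm_num)) (Or.inl (by norm_num))
  rwa [show ((0 : ℝ) : ℂ) - ((1 / 2 : ℝ) : ℂ) * ζ = -(ζ / 2) by push_cast; ring] at this

theorem prim_neg_neg (hp : 1 < p) (n : ℤ) (hτ : 0 < τ.im) (h0 : -1 < latY z τ)
    (h1 : latY z τ < 0) : prim p n (-z) τ (z / 2) = -prim p (-n) z τ (-(z / 2)) := by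
  have hadm := (isCompatible_self hτ h0 h1).isAdmissible_half
  have := prim_neg_arg (z := -z) (n := n) (m := -n) (c := 1) hp hadm fun s hs0 hs1 => ?_
  · rw [one_mul, neg_neg] at this
    exact this
  · have hY : latY (s * -(z / 2)) τ = -(s * latY z τ / 2) := by
      rw [latY_real_mul, latY_neg, latY_div_two]; ring
    have hZ : latY (z + s * -(z / 2)) τ = (1 - s / 2) * latY z τ := by
      rw [latY_add, hY]; ring
    rw [one_mul]
    refine core_neg_neg n hτ ?_ ?_ ?_ ?_ <;> rw [‹latY _ τ = _›] <;> nlinarith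

theorem prim_neg_tau_add (hp : 1 < p) (n : ℤ) (hτ : 0 < τ.im) (h0 : -1 < latY z τ)
    (h1 : latY z τ < 0) : prim p n z τ (-((τ + z) / 2)) =
      -(qt p 1 * prim p (-n) (-z) τ ((τ + z) / 2)) := by
  have hadm := (isCompatible_tau_add hτ h0 h1).neg.isAdmissible_half
  rw [neg_div, neg_neg] at hadm
  refine prim_neg_arg hp hadm fun s hs0 hs1 => ?_
  have hY : latY (s * ((τ + z) / 2)) τ = s * ((1 + latY z τ) / 2) := by
    rw [latY_real_mul, latY_div_two, latY_add, latY_self hτ]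
  have hZ : latY (-z + s * ((τ + z) / 2)) τ = -latY z τ + s * ((1 + latY z τ) / 2) := by
    rw [latY_add, hY, latY_neg]
  refine core_neg n hτ ?_ ?_ ?_ ?_ <;> rw [‹latY _ τ = _›] <;> nlinarith

/-- The two primitives belong to the two ends of one path, so their combination does not depend on
where the path is cut. The cut is moved from the midpoint -ζ/2 to 1/2 - xζ inside the parallelogram.
-/
theorem IsCompatible.prim_const (h : IsCompatible z ζ τ) (hp : 1 < p) {n m : ℤ} {c : ℂ}
    (hc : ∀ x y : ℝ, 1 / 2 ≤ x → x ≤ 1 → 0 ≤ y → y < 1 → (x < 1 ∨ 0 < y) →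
      core p n (-z) τ (ζ + (y - x * ζ)) + c * core p m z τ (y - x * ζ) = 0)
    {x : ℝ} (hx0 : 1 / 2 ≤ x) (hx1 : x ≤ 1) :
    prim p n (-z) τ (ζ / 2) + c * prim p m z τ (-(ζ / 2)) =
      prim p n (-z) τ (1 / 2 + (1 - x) * ζ) + c * prim p m z τ (1 / 2 - x * ζ) := by
  have key := eq_of_hasDerivAt_zero_segment (a := -(ζ / 2)) (b := 1 / 2 - x * ζ)
    (g := fun w => prim p n (-z) τ (ζ + w) + c * prim p m z τ w) ?_
  · rw [show ζ + -(ζ / 2) = ζ / 2 by ring,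
      show ζ + (1 / 2 - x * ζ) = 1 / 2 + (1 - x) * ζ by ring] at key
    exact key
  · intro v hv
    obtain ⟨r, hr0, hr1, rfl⟩ := exists_of_mem_segment hv
    set w := -(ζ / 2) + r * (1 / 2 - x * ζ - -(ζ / 2)) with hw
    have e1 : w = ((r / 2 : ℝ) : ℂ) - ((1 / 2 + r * (x - 1 / 2) : ℝ) : ℂ) * ζ := by
      rw [hw]; push_cast; ring
    have e2 : ζ + w = ((r / 2 : ℝ) : ℂ) - ((1 / 2 - r * (x - 1 / 2) : ℝ) : ℂ) * -ζ := by
      rw [hw]; push_cast; ring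
    have hor : r = 0 ∨ 0 < r / 2 := hr0.eq_or_lt.imp Eq.symm fun h => by linarith
    have a1 : IsAdmissible z τ w := by
      rw [e1]
      refine h.isAdmissible ?_ ?_ ?_ (Or.inl ?_) (hor.imp_left fun h0 => ?_)
      · nlinarith
      · nlinarith
      · linarith
      · nlinarith
      · rw [h0]; norm_num
    have a2 : IsAdmissible (-z) τ (ζ + w) := by
      rw [e2]
      refine h.neg.isAdmissible ?_ ?_ ?_ (hor.imp_left fun h0 => ?_) (Or.inl ?_)
      · nlinarith
      · nlinarith
      · linarith
      · rw [h0]; norm_num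
      · nlinarith
    have d1 := hasDerivAt_prim hp m a1
    have d2 := (hasDerivAt_prim hp n a2).comp w ((hasDerivAt_id w).const_add ζ)
    refine (d2.add (d1.const_mul c)).congr_deriv ?_
    rw [mul_one, e1]
    refine hc _ _ ?_ ?_ ?_ ?_ (hor.imp_left fun h0 => ?_)
    · nlinarith
    · nlinarith
    · linarith
    · linarith
    · rw [h0]; norm_num

/-- The integral of `core` from `0` to `-z`. -/
def coreX (p : ℕ) (n : ℤ) (z τ : ℂ) : ℂ := prim p n z τ (-(z / 2)) - prim p (-n) z τ (-(z / 2))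

/-- The integral of `core` from `-z` to `τ`. -/
def coreY (p : ℕ) (n : ℤ) (z τ : ℂ) : ℂ :=
  prim p (2 - n) (-z) τ ((τ + z) / 2) - prim p n (-z) τ ((τ + z) / 2)

theorem coreX_neg (p : ℕ) (n : ℤ) (z τ : ℂ) : coreX p (-n) z τ = -coreX p n z τ := by
  rw [coreX, coreX, neg_neg, neg_sub]

theorem coreY_two_sub (p : ℕ) (n : ℤ) (z τ : ℂ) : coreY p (2 - n) z τ = -coreY p n z τ := by
  rw [coreY, coreY, sub_sub_cancel, neg_sub]

/-- The definition cuts the path from 0 to -z at its midpoint, which shows the antisymmetry in n.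
Here the cut lies at 1/2 - xz: x = 1/2 is used for comparison with the blocks, and x = 1 for X + Y.
-/
theorem coreX_eq (hp : 1 < p) (n : ℤ) (hτ : 0 < τ.im) (h0 : -1 < latY z τ) (h1 : latY z τ < 0)
    {x : ℝ} (hx0 : 1 / 2 ≤ x) (hx1 : x ≤ 1) : coreX p n z τ =
      prim p n (-z) τ (1 / 2 + (1 - x) * z) + prim p n z τ (1 / 2 - x * z) := by
  have := (isCompatible_self hτ h0 h1).prim_const hp (n := n) (m := n) (c := 1)
    (fun x y _ _ _ _ _ => by rw [core_swap]; ring) hx0 hx1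
  rw [one_mul, one_mul] at this
  rw [← this, prim_neg_neg hp n hτ h0 h1, coreX]
  ring

/-- The analogue for the path from -z to τ. The end at τ is brought to 0 by `core_add_tau`, which
replaces n by n - 2. -/
theorem coreY_eq (hp : 1 < p) (n : ℤ) (hτ : 0 < τ.im) (h0 : -1 < latY z τ) (h1 : latY z τ < 0)
    {x : ℝ} (hx0 : 1 / 2 ≤ x) (hx1 : x ≤ 1) : coreY p n z τ =
      -(prim p n (-z) τ (1 / 2 + (1 - x) * (τ + z))
        + qt p (-1) * prim p (n - 2) z τ (1 / 2 - x * (τ + z))) := by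
  have hq := qt_neg_mul p 1
  have := (isCompatible_tau_add hτ h0 h1).prim_const hp (n := n) (m := n - 2) (c := qt p (-1))
    (fun x y hx0 hx1 hy0 hy1 hxy => ?_) hx0 hx1
  · rw [← this, prim_neg_tau_add hp (n - 2) hτ h0 h1, coreY, neg_sub]
    linear_combination prim p (2 - n) (-z) τ ((τ + z) / 2) * (-hq)
  · set w : ℂ := y - x * (τ + z) with hw
    have hY : latY w τ = -(x * (1 + latY z τ)) := by
      rw [hw, latY_sub, latY_ofReal, latY_real_mul, latY_add, latY_self hτ]; ring
    have hZ : latY (z + w) τ = latY z τ - x * (1 + latY z τ) := by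
      rw [latY_add, hY]; ring
    have hZX : latX (z + w) τ = latX z τ + (y - x * latX z τ) := by
      rw [latX_add, hw, latX_sub, latX_ofReal, latX_real_mul, latX_add, latX_self hτ, zero_add]
    rw [show τ + z + w = z + (w + τ) by ring, core_swap,
      core_add_tau (zero_lt_one.trans hp) n hτ]
    · ring
    · right
      rw [hY]
      constructor <;> nlinarith
    · rcases hxy with hx | hy
      · right
        rw [hZ]
        constructor <;> nlinarith
      · rcases hx1.lt_or_eq with hx | rfl
        · right
          rw [hZ]
          constructor <;> nlinarith
        · left
          rw [hZX]
          constructor <;> linarith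

/-- With x = 1 both paths pass through 1/2 - z, and the primitive based at -z cancels. What remains
is the path 0 → 1/2 - z → τ, with no restriction on the first coordinate of z. -/
theorem coreX_add_coreY (hp : 1 < p) (n : ℤ) (hτ : 0 < τ.im) (h0 : -1 < latY z τ)
    (h1 : latY z τ < 0) : coreX p n z τ + coreY p n z τ =
      prim p n z τ (1 / 2 - z) - qt p (-1) * prim p (n - 2) z τ (1 / 2 - z - τ) := by
  have h2 : (1 / 2 : ℝ) ≤ 1 := by norm_num
  rw [coreX_eq hp n hτ h0 h1 h2 le_rfl, coreY_eq hp n hτ h0 h1 h2 le_rfl]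
  simp only [Complex.ofReal_one, sub_self, zero_mul, add_zero, one_mul]
  rw [show (1 : ℂ) / 2 - (τ + z) = 1 / 2 - z - τ by ring]
  ring

/-- With the cuts at 1/2 ± z/2, each of X_n, X_(-n) = -X_n, F_n and F_(-n) is a combination of two
among four values of `prim`. Eliminating these four values leaves the relation. -/
theorem coreX_relation (hp : 1 < p) (n : ℤ) (hτ : 0 < τ.im) (h0 : -1 < latY z τ)
    (h1 : latY z τ < 0) : (1 - qt p (-n)) * coreX p n z τ =
      coreBlock p n z τ + qt p (-n) * coreBlock p (-n) z τ := by
  have hc := isCompatible_self hτ h0 h1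
  have h2 : (1 / 2 : ℝ) ≤ 1 := by norm_num
  have e1 := coreX_eq hp n hτ h0 h1 le_rfl h2
  have e2 := coreX_eq hp (-n) hτ h0 h1 le_rfl h2
  have f1 := hc.prim_add_prim_eq_coreBlock hp n
  have f2 := hc.prim_add_prim_eq_coreBlock hp (-n)
  have hq := qt_neg_mul p n
  rw [coreX_neg] at e2
  push_cast at e1 e2 f2
  rw [show (1 : ℂ) / 2 + (1 - 1 / 2) * z = 1 / 2 + z / 2 by ring,
    show (1 : ℂ) / 2 - 1 / 2 * z = 1 / 2 - z / 2 by ring] at e1 e2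
  rw [neg_neg, neg_neg] at f2
  linear_combination e1 + qt p (-n) * e2 + f1 + qt p (-n) * f2 -
    prim p n (-z) τ (1 / 2 + z / 2) * hq

/-- The same elimination with τ + z in place of z. The shift by τ makes n - 2 appear, so Y_n is
paired with Y_(2-n) = -Y_n. -/
theorem coreY_relation (hp : 1 < p) (n : ℤ) (hτ : 0 < τ.im) (h0 : -1 < latY z τ)
    (h1 : latY z τ < 0) : (1 - qt p (1 - n)) * coreY p n z τ =
      -(qt p (-n) * coreBlock p (-n) z τ) - qt p (-1) * coreBlock p (n - 2) z τ := by
  have hc := isCompatible_tau_add hτ h0 h1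
  have h2 : (1 / 2 : ℝ) ≤ 1 := by norm_num
  have e1 := coreY_eq hp n hτ h0 h1 le_rfl h2
  have e2 := coreY_eq hp (2 - n) hτ h0 h1 le_rfl h2
  have f1 := hc.prim_add_prim_eq_coreBlock hp (-n)
  have f2 := hc.prim_add_prim_eq_coreBlock hp (n - 2)
  have hq := qt_neg_mul p n
  have hq2 : qt p (-1) * qt p (-((n : ℂ) - 2)) = qt p (1 - n) := by rw [← qt_add]; ring_nf
  have hq3 : qt p (1 - n) * qt p (-1) = qt p (-n) := by rw [← qt_add]; ring_nf
  rw [coreY_two_sub] at e2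
  rw [show -(n - 2) = 2 - n by ring] at f2
  push_cast at e1 e2 f1 f2
  rw [show (1 : ℂ) / 2 + (1 - 1 / 2) * (τ + z) = 1 / 2 + (τ + z) / 2 by ring,
    show (1 : ℂ) / 2 - 1 / 2 * (τ + z) = 1 / 2 - (τ + z) / 2 by ring] at e1 e2
  rw [show 2 - n - 2 = -n by ring] at e2
  rw [neg_neg, neg_neg] at f1
  linear_combination e1 + qt p (1 - n) * e2 - qt p (-n) * f1 - qt p (-1) * f2 +
    prim p n (-z) τ (1 / 2 + (τ + z) / 2) * hq
    - prim p (-n) z τ (1 / 2 - (τ + z) / 2) * hq3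
    + prim p (2 - n) (-z) τ (1 / 2 + (τ + z) / 2) * hq2

/-- The path from 0 to τ, cut at its midpoint, may be bent through 1/2 - z. The bound 0 < `latX z τ`
puts -z to the left of it, so no branch point is crossed. -/
theorem prim_sub_prim_tau (hp : 1 < p) (n : ℤ) (hτ : 0 < τ.im) (hx0 : 0 < latX z τ)
    (hx1 : latX z τ < 1) (h0 : -1 < latY z τ) (h1 : latY z τ < 0) :
    prim p n z τ (τ / 2) - qt p (-1) * prim p (n - 2) z τ (-(τ / 2)) =
      prim p n z τ (1 / 2 - z) - qt p (-1) * prim p (n - 2) z τ (1 / 2 - z - τ) := by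
  have key := eq_of_hasDerivAt_zero_segment (a := -(τ / 2)) (b := 1 / 2 - z - τ)
    (g := fun w => prim p n z τ (w + τ) - qt p (-1) * prim p (n - 2) z τ w) ?_
  · rw [show -(τ / 2) + τ = τ / 2 by ring, show 1 / 2 - z - τ + τ = 1 / 2 - z by ring] at key
    exact key
  · intro v hv
    obtain ⟨r, hr0, hr1, rfl⟩ := exists_of_mem_segment hv
    set w := -(τ / 2) + r * (1 / 2 - z - τ - -(τ / 2)) with hw
    have e1 : w = ((r / 2 : ℝ) : ℂ) - (r : ℝ) * z - ((1 / 2 + r / 2 : ℝ) : ℂ) * τ := by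
      rw [hw]; push_cast; ring
    have hX : latX w τ = r / 2 - r * latX z τ := by
      rw [e1, latX_sub, latX_sub, latX_ofReal, latX_real_mul, latX_real_mul, latX_self hτ]; ring
    have hY : latY w τ = -(r * latY z τ) - (1 / 2 + r / 2) := by
      rw [e1, latY_sub, latY_sub, latY_ofReal, latY_real_mul, latY_real_mul, latY_self hτ]; ring
    have hX' : latX (w + τ) τ = r / 2 - r * latX z τ := by rw [latX_add, hX, latX_self hτ, add_zero]
    have hY' : latY (w + τ) τ = 1 / 2 - r / 2 - r * latY z τ := by
      rw [latY_add, hY, latY_self hτ]; ring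
    have hs : ∀ s ∈ Icc (0 : ℝ) 1, 0 < latX z τ + s * (r / 2 - r * latX z τ) ∧
        latX z τ + s * (r / 2 - r * latX z τ) < 1 := by
      intro s hs
      have h3 : 0 ≤ s * r := mul_nonneg hs.1 hr0
      have h4 : s * r ≤ 1 := mul_le_one₀ hs.2 hr0 hr1
      constructor <;> nlinarith
    have a1 : IsAdmissible z τ w := by
      refine ⟨mem_logDomain_of_or hτ (Or.inr ?_), fun s h => mem_logDomain_of_or hτ (Or.inl ?_)⟩
      · rw [hY]
        constructor <;> nlinarith
      · rw [latX_add, latX_real_mul, hX]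
        exact hs s h
    have a2 : IsAdmissible z τ (w + τ) := by
      refine ⟨mem_logDomain_of_latY hτ ?_ ?_, fun s h => mem_logDomain_of_or hτ (Or.inl ?_)⟩
      · rw [hY']
        nlinarith
      · rw [hY', abs_lt]
        constructor <;> nlinarith
      · rw [latX_add, latX_real_mul, hX']
        exact hs s h
    have d1 := hasDerivAt_prim hp (n - 2) a1
    have d2 := (hasDerivAt_prim hp n a2).comp w ((hasDerivAt_id w).add_const τ)
    refine (d2.sub (d1.const_mul (qt p (-1)))).congr_deriv ?_
    rw [mul_one, core_add_tau (zero_lt_one.trans hp) n hτ, sub_self]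
    · right
      rw [hY]
      constructor <;> nlinarith
    · left
      rw [latX_add, hX]
      have := hs 1 ⟨zero_le_one, le_rfl⟩
      rwa [one_mul] at this

theorem hasRayPart_core_half (hp : 1 < p) (n : ℤ) (h : IsAdmissible z τ (1 / 2)) :
    HasRayPart p (fun s => core p n z τ (s * (1 / 2))) (2 * prim p n z τ (1 / 2)) := by
  have h1 := hasRayPart_core hp n h
  have : 2 * prim p n z τ (1 / 2) = exp ((-2 - 1 / (p : ℂ)) * Complex.log (1 / 2)) *
      rayKernel p (regCore p n (z, τ)) (1 / 2) := by
    rw [prim_eq hp n h]; ring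
  rwa [this]

theorem hasFinitePart_core (hp : 1 < p) (n : ℤ) (hτ : 0 < τ.im) (h0 : -1 < latY z τ)
    (h1 : latY z τ < 0) :
    HasFinitePart p (fun t : ℝ => core p n z τ t) (coreBlock p n z τ) := by
  have hc := isCompatible_self hτ h0 h1
  have hh : ∀ {y : ℂ}, IsCompatible y y τ → IsAdmissible y τ (1 / 2) := fun hy => by
    have := hy.isAdmissible (x := 0) (y := 1 / 2) le_rfl zero_le_one (by norm_num)
      (Or.inr (by norm_num)) (Or.inr (by norm_num))
    simpa using this
  have r0 : HasRayPart p (fun s : ℝ => core p n z τ ((s / 2 : ℝ) : ℂ)) _ :=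
    (hasRayPart_core_half hp n (hh hc)).congr fun s _ _ => by push_cast; ring_nf
  have r1 : HasRayPart p (fun s : ℝ => core p n z τ ((1 - s / 2 : ℝ) : ℂ)) _ :=
    ((hasRayPart_core_half hp (-n) (hh hc.neg)).const_mul (qt p (-n))).congr fun s hs0 hs1 => by
      have ha : IsAdmissible z τ ((1 - s / 2 : ℝ) : ℂ) := by
        have := hc.isAdmissible (x := 0) (y := 1 - s / 2) le_rfl zero_le_one (by linarith)
          (Or.inr (by linarith)) (Or.inr (by linarith))
        simpa using this
      rw [core_one_sub (zero_lt_one.trans hp) n ha.1 ha.add_mem]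
      push_cast
      ring_nf
  have := HasRayPart.hasFinitePart (f := fun t : ℝ => core p n z τ t) r0 r1
  rw [coreBlock]
  convert this using 1
  ring

end Relations

/-! ### The integrand under τ ↦ -1/τ -/

section ModularTransformation

open Set
open Complex (I exp)
open scoped Real

variable {p : ℕ} {z τ u : ℂ}

theorem im_neg_one_div (hτ : 0 < τ.im) : 0 < (-1 / τ).im := by
  have h : 0 < Complex.normSq τ := Complex.normSq_pos.2 (by rintro rfl; simp at hτ)
  have : (-1 / τ).im = τ.im / Complex.normSq τ := by
    simp [neg_div]
  rw [this]
  positivity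

theorem latX_latY_div (hτ : 0 < τ.im) (u : ℂ) :
    latX (u / τ) (-1 / τ) = latY u τ ∧ latY (u / τ) (-1 / τ) = -latX u τ := by
  have hτ0 : τ ≠ 0 := by rintro rfl; simp at hτ
  have e : u / τ = (latY u τ : ℝ) + ((-latX u τ : ℝ) : ℂ) * (-1 / τ) := by
    conv_lhs => rw [← latX_add_latY hτ u]
    push_cast
    field_simp
    ring
  rw [e, latX_lattice (im_neg_one_div hτ), latY_lattice (im_neg_one_div hτ)]
  exact ⟨rfl, rfl⟩

theorem log_neg_I_mul (hτ : 0 < τ.im) :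
    Complex.log (-I * τ) = Complex.log τ - π / 2 * I := by
  have hτ0 : τ ≠ 0 := by rintro rfl; simp at hτ
  have h0 : 0 < Complex.arg τ := by
    rcases (Complex.arg_nonneg_iff.2 hτ.le).eq_or_lt with h | h
    · exact absurd (Complex.arg_eq_zero_iff.1 h.symm).2 hτ.ne'
    · exact h
  have h1 := Complex.arg_le_pi τ
  rw [(Complex.log_mul_eq_add_log_iff (neg_ne_zero.2 Complex.I_ne_zero) hτ0).2, Complex.log_neg_I]
  · ring
  · rw [Complex.arg_neg_I]
    constructor <;> linarith [Real.pi_pos]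

/-- One square root κ of -iτ serves both the eta and the theta function. Only κ/κ³ = i/τ enters
later, so the choice of root disappears. -/
theorem exists_eta_sqrt (hτ : 0 < τ.im) : ∃ κ : ℂ, κ ^ 2 = -I * τ ∧
    ModularForm.eta (-1 / τ) = κ * ModularForm.eta τ ∧
    ∀ N : ℕ, 0 < N → (-I * (τ / N)) ^ (1 / 2 : ℂ) = κ / ((Real.sqrt N : ℝ) : ℂ) := by
  have hτ0 : τ ≠ 0 := by rintro rfl; simp at hτ
  have hI : -I * τ ≠ 0 := mul_ne_zero (neg_ne_zero.2 Complex.I_ne_zero) hτ0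
  refine ⟨(-I * τ) ^ (1 / 2 : ℂ), ?_, ?_, fun N hN => ?_⟩
  · rw [← Complex.cpow_nat_mul]
    norm_num
  · have h := ModularForm.eta_comp_eq_csqrt_I_inv hτ
    simp only [Function.comp_apply, Pi.smul_apply, Pi.mul_apply, smul_eq_mul] at h
    rw [h, ← mul_assoc]
    congr 1
    rw [Complex.sqrt, Complex.sqrt, Complex.cpow_def_of_ne_zero Complex.I_ne_zero,
      Complex.cpow_def_of_ne_zero hτ0, Complex.cpow_def_of_ne_zero hI, log_neg_I_mul hτ,
      Complex.log_I, ← Complex.exp_neg, ← Complex.exp_add]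
    congr 1
    ring
  · have hN' : (0 : ℝ) < N := by exact_mod_cast hN
    have hNc : (N : ℂ) ≠ 0 := by exact_mod_cast hN.ne'
    have e : -I * τ = (N : ℝ) * (-I * (τ / N)) := by push_cast; field_simp
    have h0 : -I * (τ / N) ≠ 0 := mul_ne_zero (neg_ne_zero.2 Complex.I_ne_zero) (div_ne_zero hτ0 hNc)
    have hs : ((Real.sqrt N : ℝ) : ℂ) = exp ((Real.log N : ℝ) * (1 / 2)) := by
      rw [Real.sqrt_eq_rpow, Real.rpow_def_of_pos hN']
      push_cast
      rfl
    rw [eq_div_iff (by rw [hs]; exact Complex.exp_ne_zero _), e,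
      Complex.cpow_def_of_ne_zero h0, Complex.cpow_def_of_ne_zero (e ▸ hI),
      Complex.log_ofReal_mul hN' h0, hs, ← Complex.exp_add]
    congr 1
    ring

/-- The summation index is split into its residue μ and its quotient l modulo N; the phase e^(-2πi n
l) is 1. -/
theorem jacobiTheta₂_eq_sum_theta {N : ℕ} (hN : 0 < N) (hτ : 0 < τ.im) (n : ℤ) (w : ℂ) :
    jacobiTheta₂ ((w - n) / N) (τ / N) = ∑ μ ∈ Finset.range N,
      exp (-(2 * π * I * n * μ / N)) * theta ((μ : ℂ) / N) 0 w (N * τ) := by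
  have hNc : (N : ℂ) ≠ 0 := by exact_mod_cast hN.ne'
  have : NeZero N := ⟨hN.ne'⟩
  have him : 0 < (τ / N).im := by
    rw [Complex.div_natCast_im]
    positivity
  have hsum := (summable_jacobiTheta₂_term_iff ((w - n) / N) (τ / N)).2 him
  rw [jacobiTheta₂, ← ((Int.divModEquiv N).trans (Equiv.prodComm _ _)).symm.tsum_eq]
  have hsum' := ((Int.divModEquiv N).trans (Equiv.prodComm _ _)).symm.summable_iff.2 hsum
  simp only [Function.comp_def] at hsum'
  rw [hsum'.tsum_prod, tsum_fintype, ← Fin.sum_univ_eq_sum_range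
    (fun μ => exp (-(2 * π * I * n * μ / N)) * theta ((μ : ℂ) / N) 0 w (N * τ))]
  refine Finset.sum_congr rfl fun μ _ => ?_
  rw [theta, ← tsum_mul_left]
  congr 1
  ext l
  rw [← Complex.exp_add]
  simp only [Equiv.symm_trans_apply, Equiv.prodComm_symm, Equiv.prodComm_apply, Prod.swap_prod_mk,
    Int.divModEquiv_symm_apply, jacobiTheta₂_term]
  rw [Complex.exp_eq_exp_iff_exists_int]
  refine ⟨-(n * l), ?_⟩
  push_cast
  field_simp
  ring

/-- Jacobi's inversion leads from period 2p(-1/τ) to period τ/(2p), and a series with that period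
splits by residues modulo 2p. -/
theorem theta_div (hp : 0 < p) (hτ : 0 < τ.im) {κ : ℂ} (n : ℤ)
    (hκ : (-I * (τ / (2 * p : ℕ))) ^ (1 / 2 : ℂ) = κ / ((Real.sqrt (2 * p : ℕ) : ℝ) : ℂ)) (w : ℂ) :
    theta ((n : ℂ) / (2 * (p : ℂ))) 0 (w / τ) (2 * (p : ℂ) * (-1 / τ)) =
      κ / ((Real.sqrt (2 * (p : ℝ)) : ℝ) : ℂ) * exp (π * I * w ^ 2 / (2 * p * τ)) *
      ∑ μ ∈ Finset.range (2 * p), qt p (-((n : ℂ) * μ) / 2) *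
        theta ((μ : ℂ) / (2 * (p : ℂ))) 0 w (2 * (p : ℂ) * τ) := by
  have hτ0 : τ ≠ 0 := by rintro rfl; simp at hτ
  have hpc : (p : ℂ) ≠ 0 := by exact_mod_cast hp.ne'
  have hT : -I * (τ / (2 * p : ℕ)) ≠ 0 := by
    refine mul_ne_zero (neg_ne_zero.2 Complex.I_ne_zero) (div_ne_zero hτ0 ?_)
    push_cast
    exact mul_ne_zero two_ne_zero hpc
  have h1 := jacobiTheta₂_eq_sum_theta (N := 2 * p) (by lia) hτ n w
  have h2 := jacobiTheta₂_functional_equation ((w - n) / (2 * p : ℕ)) (τ / (2 * p : ℕ))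
  have h3 : (-I * (τ / (2 * p : ℕ))) ^ (1 / 2 : ℂ) ≠ 0 := by
    rw [Complex.cpow_def_of_ne_zero hT]
    exact Complex.exp_ne_zero _
  rw [h1, hκ] at h2
  rw [hκ] at h3
  rw [theta_eq_jacobiTheta₂]
  have e1 : (w - n) / ((2 * p : ℕ) : ℂ) / (τ / (2 * p : ℕ)) =
      w / τ + 0 + (n : ℂ) / (2 * (p : ℂ)) * (2 * (p : ℂ) * (-1 / τ)) := by
    push_cast
    field_simp
    ring
  have e2 : -1 / (τ / ((2 * p : ℕ) : ℂ)) = 2 * (p : ℂ) * (-1 / τ) := by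
    push_cast
    field_simp
  rw [e1, e2] at h2
  have h4 : ∑ μ ∈ Finset.range (2 * p), qt p (-((n : ℂ) * μ) / 2) *
      theta ((μ : ℂ) / (2 * (p : ℂ))) 0 w (2 * (p : ℂ) * τ) =
      ∑ μ ∈ Finset.range (2 * p), exp (-(2 * π * I * n * μ / (2 * p : ℕ))) *
        theta ((μ : ℂ) / (2 * p : ℕ)) 0 w ((2 * p : ℕ) * τ) := by
    refine Finset.sum_congr rfl fun μ _ => ?_
    push_cast
    rw [qt]
    congr 2
    field_simp
  rw [h4, h2]
  have e3 : ((2 * p : ℕ) : ℝ) = 2 * (p : ℝ) := by push_cast; rfl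
  rw [e3] at h3 ⊢
  set c := κ / ((Real.sqrt (2 * (p : ℝ)) : ℝ) : ℂ)
  have e4 : exp (π * I * w ^ 2 / (2 * p * τ)) *
      exp (-π * I * ((w - n) / ((2 * p : ℕ) : ℂ)) ^ 2 / (τ / (2 * p : ℕ))) =
      exp (π * I * ((n : ℂ) / (2 * (p : ℂ))) ^ 2 * (2 * (p : ℂ) * (-1 / τ)) +
        2 * π * I * ((n : ℂ) / (2 * (p : ℂ))) * (w / τ + 0)) := by
    rw [← Complex.exp_add]
    congr 1
    push_cast
    field_simp
    ring
  rw [← e4]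
  field_simp

/-- The identity could fail only if arg u - arg τ ≤ -π. For Im u > 0 this is impossible, and
otherwise it would give Im(u/τ) ≥ 0, while `latX u τ` > 0 means Im(u/τ) < 0. -/
theorem log_div_eq (hτ : 0 < τ.im) (h : 0 < latX u τ ∨ 0 < u.im) :
    Complex.log (u / τ) = Complex.log u - Complex.log τ := by
  have hτ0 : τ ≠ 0 := by rintro rfl; simp at hτ
  have hu0 : u ≠ 0 := by
    rintro rfl
    simp [latX_zero] at h
  have t0 : 0 < Complex.arg τ := by
    rcases (Complex.arg_nonneg_iff.2 hτ.le).eq_or_lt with h | h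
    · exact absurd (Complex.arg_eq_zero_iff.1 h.symm).2 hτ.ne'
    · exact h
  have t1 : Complex.arg τ < π := Complex.arg_lt_pi_iff.2 (Or.inr hτ.ne')
  have e : exp (Complex.log u - Complex.log τ) = u / τ := by
    rw [Complex.exp_sub, Complex.exp_log hu0, Complex.exp_log hτ0]
  have him : (Complex.log u - Complex.log τ).im = Complex.arg u - Complex.arg τ := by
    simp [Complex.log_im]
  have hle : Complex.arg u - Complex.arg τ < π := by linarith [Complex.arg_le_pi u]
  have hlt : -π < Complex.arg u - Complex.arg τ := by
    rcases h with h | h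
    · by_contra! hc
      have h2 := (latX_latY_div hτ u).2
      have h3 : (u / τ).im < 0 := by
        rw [latY, div_eq_iff (im_neg_one_div hτ).ne'] at h2
        rw [h2]
        nlinarith [im_neg_one_div hτ]
      rw [← e, Complex.exp_im, him] at h3
      have h4 : 0 ≤ Real.sin (Complex.arg u - Complex.arg τ) := by
        rw [← Real.sin_add_two_pi]
        refine Real.sin_nonneg_of_nonneg_of_le_pi ?_ ?_ <;>
          linarith [Complex.neg_pi_lt_arg u]
      have := mul_nonneg (Real.exp_pos (Complex.log u - Complex.log τ).re).le h4
      linarith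
    · have : 0 ≤ Complex.arg u := Complex.arg_nonneg_iff.2 h.le
      linarith
  rw [← e, Complex.log_exp (by rw [him]; exact hlt) (by rw [him]; exact hle.le)]

theorem logPrimeForm_div_of_mem (hτ : 0 < τ.im) (h : (τ, u) ∈ starDomain)
    (h' : (-1 / τ, u / τ) ∈ starDomain) (hu : 0 < latX u τ ∨ 0 < u.im) :
    logPrimeForm (u / τ) (-1 / τ) = logPrimeForm u τ - Complex.log τ + π * I * u ^ 2 / τ := by
  refine logPrimeForm_div h h' ?_ (log_div_eq hτ hu)
  rintro rfl
  simp [latX_zero] at hu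

theorem logPrimeForm_real_mul_tau (hτ : 0 < τ.im) {r : ℝ} (h0 : 0 < r) (h1 : r < 1) :
    (τ, (r * τ : ℂ)) ∈ logDomain ∧
    logPrimeForm r (-1 / τ) =
      logPrimeForm (r * τ) τ - Complex.log τ + π * I * (r * τ) ^ 2 / τ := by
  have hτ0 : τ ≠ 0 := by rintro rfl; simp at hτ
  have hY : latY (r * τ) τ = r := by rw [latY_real_mul, latY_self hτ, mul_one]
  have hX : latX (r * τ) τ = 0 := by rw [latX_real_mul, latX_self hτ, mul_zero]
  have e : (r : ℂ) = r * τ / τ := by field_simp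
  have hm : (τ, (r * τ : ℂ)) ∈ logDomain :=
    mem_logDomain_of_latY hτ (by rw [hY]; exact h0.ne') (by rw [hY, abs_of_pos h0]; exact h1)
  refine ⟨hm, ?_⟩
  conv_lhs => rw [e]
  refine logPrimeForm_div_of_mem hτ (mem_starDomain_of_mem_logDomain hm)
    (mem_starDomain_of_mem_logDomain ?_) (Or.inr ?_)
  · rw [← e]
    exact mem_logDomain_of_latX (im_neg_one_div hτ) (by rw [latX_ofReal]; exact h0)
      (by rw [latX_ofReal]; exact h1)
  · rw [Complex.im_ofReal_mul]
    positivity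

theorem logPrimeForm_div_of_latX (hτ : 0 < τ.im) (h0 : 0 < latX u τ) (h1 : latX u τ < 1) :
    logPrimeForm (u / τ) (-1 / τ) = logPrimeForm u τ - Complex.log τ + π * I * u ^ 2 / τ := by
  refine logPrimeForm_div_of_mem hτ
    (mem_starDomain_of_mem_logDomain (mem_logDomain_of_latX hτ h0 h1))
    (mem_starDomain_of_mem_logDomain (mem_logDomain_of_latY (im_neg_one_div hτ) ?_ ?_)) (Or.inl h0)
  all_goals rw [(latX_latY_div hτ u).2]
  · exact neg_ne_zero.2 h0.ne'
  · rw [abs_neg, abs_of_pos h0]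
    exact h1

theorem logPrimeForm_div_of_latY (hτ : 0 < τ.im) (h0 : 0 < latY u τ) (h1 : latY u τ < 1) :
    logPrimeForm (u / τ) (-1 / τ) = logPrimeForm u τ - Complex.log τ + π * I * u ^ 2 / τ := by
  refine logPrimeForm_div_of_mem hτ (mem_starDomain_of_mem_logDomain
      (mem_logDomain_of_latY hτ h0.ne' (by rw [abs_of_pos h0]; exact h1)))
    (mem_starDomain_of_mem_logDomain (mem_logDomain_of_latX (im_neg_one_div hτ) ?_ ?_)) (Or.inr ?_)
  · rw [(latX_latY_div hτ u).1]; exact h0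
  · rw [(latX_latY_div hτ u).1]; exact h1
  · rw [latY] at h0
    have := mul_pos h0 hτ
    rwa [div_mul_cancel₀ _ hτ.ne'] at this

/-- The factor of `blockForm` that does not depend on `t`. -/
def prefactor (p : ℕ) (z τ : ℂ) : ℂ :=
  1 / ModularForm.eta τ ^ 3 * primePow (-z) τ (1 / (2 * (p : ℂ)))

/-- The Gaussian exponents cancel: with w = rτ, (z+2w)²/(2p) - w²/p - (z+w)²/p + z²/(2p) = 0. The
terms log τ of the three prime forms add up to 1/p + 1/p - 1/(2p) = 3/(2p). The second derivatives
give τ², and theta with eta³ gives i/τ. -/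
theorem prefactor_mul_core_div (hp : 0 < p) (n : ℤ) (hτ : 0 < τ.im) (hx0 : 0 < latX z τ)
    (hx1 : latX z τ < 1) (h0 : -1 < latY z τ) (h1 : latY z τ < 0) {r : ℝ} (hr0 : 0 < r)
    (hr1 : r < 1) (hX : 0 < latX (z + r * τ) τ ∧ latX (z + r * τ) τ < 1) :
    prefactor p (z / τ) (-1 / τ) * core p n (z / τ) (-1 / τ) r =
      I / ((Real.sqrt (2 * (p : ℝ)) : ℝ) : ℂ) * τ ^ (3 / (2 * (p : ℂ))) * τ *
        ∑ μ ∈ Finset.range (2 * p), qt p (-((n : ℂ) * μ) / 2) *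
          (prefactor p z τ * core p μ z τ (r * τ)) := by
  have hτ0 : τ ≠ 0 := by rintro rfl; simp at hτ
  have hpc : (p : ℂ) ≠ 0 := by exact_mod_cast hp.ne'
  obtain ⟨κ, hκ2, hη, hκ⟩ := exists_eta_sqrt hτ
  have hκ0 : κ ≠ 0 := by
    rintro rfl
    rw [zero_pow two_ne_zero] at hκ2
    exact mul_ne_zero (neg_ne_zero.2 Complex.I_ne_zero) hτ0 hκ2.symm
  have hη0 : ModularForm.eta τ ≠ 0 := ModularForm.eta_ne_zero hτ
  obtain ⟨hm, l1⟩ := logPrimeForm_real_mul_tau hτ hr0 hr1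
  have hz : z / τ + r = (z + r * τ) / τ := by field_simp
  have l2 := logPrimeForm_div_of_latX hτ hX.1 hX.2
  have l3 := logPrimeForm_div_of_latY (u := -z) hτ (by rw [latY_neg]; linarith)
    (by rw [latY_neg]; linarith)
  have d1 := primeFormDeriv2_div hτ (primeForm_ne_zero_of_mem hm)
  have d2 := primeFormDeriv2_div hτ (primeForm_ne_zero_of_mem (mem_logDomain_of_latX hτ hX.1 hX.2))
  rw [mul_div_cancel_right₀ _ hτ0] at d1
  have ht := theta_div hp hτ n (hκ (2 * p) (by lia)) (-z - 2 * (r * τ))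
  have e1 : -(z / τ) - 2 * (r : ℂ) = (-z - 2 * (r * τ)) / τ := by field_simp
  have e2 : κ / κ ^ 3 = I / τ := by
    have : κ / κ ^ 3 = 1 / κ ^ 2 := by field_simp
    rw [this, hκ2]
    field_simp
    rw [Complex.I_sq]
  have e3 : exp (π * I * (-z - 2 * (r * τ)) ^ 2 / (2 * p * τ)) *
      exp (-1 / (p : ℂ) * (logPrimeForm (r * τ) τ - Complex.log τ + π * I * (r * τ) ^ 2 / τ)) *
      exp (-1 / (p : ℂ) * (logPrimeForm (z + r * τ) τ - Complex.log τ
        + π * I * (z + r * τ) ^ 2 / τ)) *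
      exp (1 / (2 * (p : ℂ)) * (logPrimeForm (-z) τ - Complex.log τ + π * I * (-z) ^ 2 / τ)) =
      exp (Complex.log τ * (3 / (2 * (p : ℂ)))) *
        (exp (-1 / (p : ℂ) * logPrimeForm (r * τ) τ) *
          exp (-1 / (p : ℂ) * logPrimeForm (z + r * τ) τ) *
          exp (1 / (2 * (p : ℂ)) * logPrimeForm (-z) τ)) := by
    simp only [← Complex.exp_add]
    congr 1
    field_simp
    ring
  have e4 : ∑ μ ∈ Finset.range (2 * p), qt p (-((n : ℂ) * μ) / 2) *
      (prefactor p z τ * core p μ z τ (r * τ)) = (∑ μ ∈ Finset.range (2 * p),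
        qt p (-((n : ℂ) * μ) / 2) *
        theta ((μ : ℂ) / (2 * (p : ℂ))) 0 (-z - 2 * (r * τ)) (2 * (p : ℂ) * τ)) *
      (1 / ModularForm.eta τ ^ 3 * (exp (-1 / (p : ℂ) * logPrimeForm (r * τ) τ) *
          exp (-1 / (p : ℂ) * logPrimeForm (z + r * τ) τ) *
          exp (1 / (2 * (p : ℂ)) * logPrimeForm (-z) τ)) *
        (primeFormDeriv2 (z + r * τ) τ - primeFormDeriv2 (r * τ) τ)) := by
    rw [Finset.sum_mul]
    refine Finset.sum_congr rfl fun μ _ => ?_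
    rw [prefactor, core, primePow, primePow, primePow]
    push_cast
    ring
  rw [e4, prefactor, core, e1, hz, ht, hη, primePow, primePow, primePow, ← neg_div, l1, l2, l3, d1,
    d2, Complex.cpow_def_of_ne_zero hτ0]
  set S := ∑ μ ∈ Finset.range (2 * p), qt p (-((n : ℂ) * μ) / 2) *
        theta ((μ : ℂ) / (2 * (p : ℂ))) 0 (-z - 2 * (r * τ)) (2 * (p : ℂ) * τ)
  have e5 : I / ((Real.sqrt (2 * (p : ℝ)) : ℝ) : ℂ) = (κ / κ ^ 3) * τ /
      ((Real.sqrt (2 * (p : ℝ)) : ℝ) : ℂ) := by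
    rw [e2]
    field_simp
  have e6 : 1 / (κ * ModularForm.eta τ) ^ 3 = 1 / κ ^ 3 * (1 / ModularForm.eta τ ^ 3) := by
    field_simp
  rw [e5, e6]
  linear_combination (κ / κ ^ 3 / ((Real.sqrt (2 * (p : ℝ)) : ℝ) : ℂ) *
    (1 / ModularForm.eta τ ^ 3) * S * τ ^ 2 *
    (primeFormDeriv2 (z + r * τ) τ - primeFormDeriv2 (r * τ) τ)) * e3

end ModularTransformation

/-! ### Holomorphic continuation of the blocks -/

section Continuation

open Set
open Complex (I exp)
open scoped Real

variable {p : ℕ} {z τ : ℂ}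

theorem HasFinitePart.const_mul_congr {f g : ℝ → ℂ} {J : ℂ} (h : HasFinitePart p g J) (c : ℂ)
    (hfg : ∀ t ∈ Ioo (0 : ℝ) 1, c * g t = f t) : HasFinitePart p f (c * J) := by
  obtain ⟨hi, A, B, ht⟩ := h
  have hsub : ∀ ε : ℝ, 0 < ε → ε < 1 / 2 → ∀ t ∈ uIcc ε (1 - ε), c * g t = f t := by
    intro ε h0 h1 t ht
    rw [uIcc_of_le (by linarith)] at ht
    exact hfg t ⟨h0.trans_le ht.1, ht.2.trans_lt (by linarith)⟩
  refine ⟨fun ε h0 h1 => ((hi ε h0 h1).const_mul c).congr fun t ht =>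
    hsub ε h0 h1 t (uIoc_subset_uIcc ht), c * A, c * B, (ht.const_mul c).congr' ?_⟩
  filter_upwards [Ioo_mem_nhdsGT (show (0 : ℝ) < 1 / 2 by norm_num)] with ε hε
  rw [← intervalIntegral.integral_congr (hsub ε hε.1 hε.2), intervalIntegral.integral_const_mul]
  ring

theorem hasFinitePart_blockForm (hp : 1 < p) (n : ℤ) (hτ : 0 < τ.im) (h0 : -1 < latY z τ)
    (h1 : latY z τ < 0) : HasFinitePart p (fun t : ℝ => blockForm p n z τ t)
      (prefactor p z τ * coreBlock p n z τ) := by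
  refine (hasFinitePart_core hp n hτ h0 h1).const_mul_congr _ fun t ht => ?_
  have ha : IsAdmissible z τ t := by
    have := (isCompatible_self hτ h0 h1).isAdmissible (x := 0) (y := t) le_rfl zero_le_one ht.2
      (Or.inr ht.1) (Or.inr ht.1)
    simpa using this
  rw [blockForm_eq p n ha.1 ha.add_mem, prefactor]

theorem blockPlus_eq (hp : 1 < p) (n : ℤ) (hτ : 0 < τ.im) (h0 : -1 < latY z τ)
    (h1 : latY z τ < 0) : blockPlus p n z τ = prefactor p z τ * coreBlock p n z τ :=
  (hasFinitePart_blockForm hp n hτ h0 h1).finitePart_eq (zero_lt_one.trans hp)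

theorem hasRayPart_prim (hp : 1 < p) (n : ℤ) {t : ℂ} (h : IsAdmissible z τ t) :
    HasRayPart p (fun s => core p n z τ (s * t)) (prim p n z τ t / t) := by
  have h1 := hasRayPart_core hp n h
  rwa [prim, h1.rayPart_eq (zero_lt_one.trans hp),
    mul_div_cancel_left₀ _ (ne_zero_of_mem_logDomain h.1)]

/-- The constant in the modular transformation. -/
def sConst (p : ℕ) (τ : ℂ) : ℂ :=
  I / ((Real.sqrt (2 * (p : ℝ)) : ℝ) : ℂ) * τ ^ (3 / (2 * (p : ℂ)))

/-- The transformed block, written in the coordinates before the transformation. -/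
def transBlock (p : ℕ) (n : ℤ) (z τ : ℂ) : ℂ :=
  sConst p τ * ∑ μ ∈ Finset.range (2 * p), qt p (-((n : ℂ) * μ) / 2) * (prefactor p z τ *
    (prim p μ z τ (1 / 2 - z) - qt p (-1) * prim p ((μ : ℤ) - 2) z τ (1 / 2 - z - τ)))

/-- The substitution t ↦ tτ is made on each half of [0, 1], and uniqueness of the one-sided finite
parts compares both sides. Here (z/τ, -1/τ) lies in the cell, so no continuation is involved yet. -/
theorem blockPlus_div (hp : 1 < p) (n : ℤ) (hτ : 0 < τ.im) (hx0 : 0 < latX z τ)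
    (hx1 : latX z τ < 1) (h0 : -1 < latY z τ) (h1 : latY z τ < 0) :
    blockPlus p n (z / τ) (-1 / τ) = transBlock p n z τ := by
  have hp0 := zero_lt_one.trans hp
  have hτ0 : τ ≠ 0 := by rintro rfl; simp at hτ
  have hτ' := im_neg_one_div hτ
  obtain ⟨hX', hY'⟩ := latX_latY_div hτ z
  have y0 : -1 < latY (z / τ) (-1 / τ) := by rw [hY']; linarith
  have y1 : latY (z / τ) (-1 / τ) < 0 := by rw [hY']; linarith
  have hc := isCompatible_self hτ' y0 y1
  have hadm : ∀ r : ℝ, 0 < r → r < 1 → IsAdmissible (z / τ) (-1 / τ) r := fun r r0 r1 => by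
    have := hc.isAdmissible (x := 0) (y := r) le_rfl zero_le_one r1 (Or.inr r0) (Or.inr r0)
    simpa using this
  have hadm' : IsAdmissible (-(z / τ)) (-1 / τ) (1 / 2) := by
    have := hc.neg.isAdmissible (x := 0) (y := 1 / 2) le_rfl zero_le_one (by norm_num)
      (Or.inr (by norm_num)) (Or.inr (by norm_num))
    simpa using this
  have hXr : ∀ r : ℝ, latX (z + r * τ) τ = latX z τ := fun r => by
    rw [latX_add, latX_real_mul, latX_self hτ]; ring
  have hS : ∀ r : ℝ, 0 < r → r < 1 → _ := fun r r0 r1 =>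
    prefactor_mul_core_div hp0 n hτ hx0 hx1 h0 h1 r0 r1 (by rw [hXr]; exact ⟨hx0, hx1⟩)
  have ht1 : IsAdmissible z τ (τ / 2) := by
    refine ⟨mem_logDomain_of_latY hτ ?_ ?_, fun s _ => mem_logDomain_of_latX hτ ?_ ?_⟩
    · rw [latY_div_two, latY_self hτ]; norm_num
    · rw [latY_div_two, latY_self hτ]; norm_num
    · rw [latX_add, latX_real_mul, latX_div_two, latX_self hτ]; linarith
    · rw [latX_add, latX_real_mul, latX_div_two, latX_self hτ]; linarith
  have ht2 : IsAdmissible z τ (-(τ / 2)) := by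
    refine ⟨mem_logDomain_of_latY hτ ?_ ?_, fun s _ => mem_logDomain_of_latX hτ ?_ ?_⟩
    · rw [latY_neg, latY_div_two, latY_self hτ]; norm_num
    · rw [latY_neg, latY_div_two, latY_self hτ]; norm_num
    · rw [latX_add, latX_real_mul, latX_neg, latX_div_two, latX_self hτ]; linarith
    · rw [latX_add, latX_real_mul, latX_neg, latX_div_two, latX_self hτ]; linarith
  have half : ((1 / 2 : ℝ) : ℂ) = 1 / 2 := by push_cast; rfl
  have i1 := (hasRayPart_prim hp n (half ▸ hadm (1 / 2) (by norm_num) (by norm_num))).const_mul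
    (prefactor p (z / τ) (-1 / τ))
  have j1 := (HasRayPart.sum (Finset.range (2 * p)) fun μ _ => ((hasRayPart_prim hp μ ht1).const_mul
    (prefactor p z τ)).const_mul (qt p (-((n : ℂ) * μ) / 2))).const_mul (sConst p τ * τ)
  have k1 := i1.unique hp0 (j1.congr fun s s0 s1 => by
    have := hS (s / 2) (by linarith) (by linarith)
    push_cast at this
    rw [show (s : ℂ) * (1 / 2) = s / 2 by ring, show (s : ℂ) * (τ / 2) = s / 2 * τ by ring, this,
      sConst])
  have i2 := ((hasRayPart_prim hp (-n) hadm').const_mul (qt p (-n))).const_mul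
    (prefactor p (z / τ) (-1 / τ))
  have j2 := (HasRayPart.sum (Finset.range (2 * p)) fun μ _ =>
    (((hasRayPart_prim hp (μ - 2) ht2).const_mul (qt p (-1))).const_mul
    (prefactor p z τ)).const_mul (qt p (-((n : ℂ) * μ) / 2))).const_mul (sConst p τ * τ)
  -- The half next to t = 1 is reflected to 0. On the other side the endpoint τ is brought to 0,
  -- which produces q̃^(-1) and the index μ - 2.
  have k2 := i2.unique hp0 (j2.congr fun s s0 s1 => by
    have := hS (1 - s / 2) (by linarith) (by linarith)
    have ha := hadm (1 - s / 2) (by linarith) (by linarith)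
    rw [core_one_sub hp0 n ha.1 ha.add_mem] at this
    push_cast at this
    rw [show (s : ℂ) * (1 / 2) = 1 - (1 - s / 2) by ring, this, sConst]
    refine congrArg _ (Finset.sum_congr rfl fun μ _ => ?_)
    have hY : latY (s * -(τ / 2)) τ = -(s / 2) := by
      rw [latY_real_mul, latY_neg, latY_div_two, latY_self hτ]; ring
    rw [show (1 - (s : ℂ) / 2) * τ = s * -(τ / 2) + τ by ring, core_add_tau hp0 μ hτ]
    · right
      rw [hY]
      constructor <;> linarith
    · left
      rw [latX_add, latX_real_mul, latX_neg, latX_div_two, latX_self hτ]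
      constructor <;> linarith)
  rw [blockPlus_eq hp n hτ' y0 y1, coreBlock, transBlock]
  have e1 : ∀ μ : ℤ, prim p μ z τ (τ / 2) / (τ / 2) = prim p μ z τ (τ / 2) * (2 / τ) := fun μ => by
    field_simp
  have e2 : ∀ μ : ℤ, prim p μ z τ (-(τ / 2)) / (-(τ / 2)) = -prim p μ z τ (-(τ / 2)) * (2 / τ) :=
    fun μ => by field_simp
  simp only [e1, e2] at k1 k2
  -- The path is bent through 1/2 - z, the form that survives the continuation.
  have e3 : ∀ μ : ℕ, prefactor p z τ *
      (prim p μ z τ (1 / 2 - z) - qt p (-1) * prim p ((μ : ℤ) - 2) z τ (1 / 2 - z - τ)) =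
      prefactor p z τ *
      (prim p μ z τ (τ / 2) - qt p (-1) * prim p ((μ : ℤ) - 2) z τ (-(τ / 2))) := fun μ => by
    rw [prim_sub_prim_tau hp μ hτ hx0 hx1 h0 h1]
  simp only [e3]
  have e4 : ∑ μ ∈ Finset.range (2 * p), qt p (-((n : ℂ) * μ) / 2) * (prefactor p z τ *
      (prim p μ z τ (τ / 2) - qt p (-1) * prim p ((μ : ℤ) - 2) z τ (-(τ / 2)))) * (2 / τ) =
      ∑ μ ∈ Finset.range (2 * p), qt p (-((n : ℂ) * μ) / 2) * (prefactor p z τ *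
        (prim p μ z τ (τ / 2) * (2 / τ))) +
      ∑ μ ∈ Finset.range (2 * p), qt p (-((n : ℂ) * μ) / 2) * (prefactor p z τ *
        (qt p (-1) * (-prim p ((μ : ℤ) - 2) z τ (-(τ / 2)) * (2 / τ)))) := by
    rw [← Finset.sum_add_distrib]
    refine Finset.sum_congr rfl fun μ _ => ?_
    ring
  rw [← Finset.sum_mul] at e4
  have e5 : ∀ x : ℂ, x = x * (2 / τ) * τ / 2 := fun x => by field_simp
  rw [e5 (∑ μ ∈ Finset.range (2 * p), _), e4]
  linear_combination (k1 + k2) / 2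

/-- The domain of `transBlock`. -/
def transDomain : Set (ℂ × ℂ) :=
  {x | 0 < x.2.im ∧ |latX x.1 x.2| < 1 ∧ -1 < latY x.1 x.2 ∧ latY x.1 x.2 < 0}

theorem isOpen_transDomain : IsOpen transDomain := by
  have h : transDomain = (fun x : ℂ × ℂ => (x.2, x.1)) ⁻¹' ({y : ℂ × ℂ | 0 < y.1.im} ∩
      (fun y => (latX y.2 y.1, latY y.2 y.1)) ⁻¹'
        {x : ℝ × ℝ | |x.1| < 1 ∧ -1 < x.2 ∧ x.2 < 0}) := by
    ext x; simp [transDomain]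
  rw [h]
  refine ((continuousOn_latX.prodMk continuousOn_latY).isOpen_inter_preimage isOpen_upper
    ?_).preimage (by fun_prop)
  exact (isOpen_lt continuous_fst.abs continuous_const).inter
    ((isOpen_lt continuous_const continuous_snd).inter (isOpen_lt continuous_snd continuous_const))

/-- The cut point 1/2 - z moves along with -z and stays to its right, so it remains admissible for
`latX z τ` of either sign. This is what lets -z cross the segment [0, τ]. -/
theorem differentiableOn_transBlock (hp : 1 < p) (n : ℤ) :
    DifferentiableOn ℂ (fun x : ℂ × ℂ => transBlock p n x.1 x.2) transDomain := by
  have hτ : ∀ x ∈ transDomain, x.2 ∈ Complex.slitPlane := fun x hx => Or.inr hx.1.ne'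
  have heta : DifferentiableOn ℂ (fun x : ℂ × ℂ => ModularForm.eta x.2) transDomain := fun x hx =>
    ((ModularForm.differentiableAt_eta_of_mem_upperHalfPlaneSet hx.1).comp x
      (f := fun x : ℂ × ℂ => x.2) differentiableAt_snd).differentiableWithinAt
  have hlog : DifferentiableOn ℂ (fun x : ℂ × ℂ => logPrimeForm (-x.1) x.2) transDomain := by
    refine differentiableOn_logPrimeForm_joint.comp (f := fun x : ℂ × ℂ => (x.2, -x.1))
      (by fun_prop) fun x hx => mem_logDomain_of_latY hx.1 ?_ ?_
    · rw [latY_neg]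
      exact (neg_pos.2 hx.2.2.2).ne'
    · rw [latY_neg, abs_neg, abs_of_neg hx.2.2.2]
      linarith [hx.2.2.1]
  have hpre : DifferentiableOn ℂ (fun x : ℂ × ℂ => prefactor p x.1 x.2) transDomain := by
    simp only [prefactor, one_div, primePow]
    exact ((heta.pow 3).inv fun x hx => pow_ne_zero 3 (ModularForm.eta_ne_zero hx.1)).mul
      (hlog.const_mul _).cexp
  have h1 : ∀ m : ℤ, DifferentiableOn ℂ (fun x : ℂ × ℂ => prim p m x.1 x.2 (1 / 2 - x.1))
      transDomain := fun m => by
    refine differentiableOn_prim hp m isOpen_transDomain (T := fun x : ℂ × ℂ => 1 / 2 - x.1)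
      (by fun_prop) fun x hx => ?_
    have := (isCompatible_self hx.1 hx.2.2.1 hx.2.2.2).isAdmissible (x := 1) (y := 1 / 2)
      zero_le_one le_rfl (by norm_num) (Or.inl one_pos) (Or.inr (by norm_num))
    simpa using this
  have h2 : ∀ m : ℤ, DifferentiableOn ℂ (fun x : ℂ × ℂ => prim p m x.1 x.2 (1 / 2 - x.1 - x.2))
      transDomain := fun m => by
    refine differentiableOn_prim hp m isOpen_transDomain (T := fun x : ℂ × ℂ => 1 / 2 - x.1 - x.2)
      (by fun_prop) fun x hx => ?_
    have := (isCompatible_tau_add hx.1 hx.2.2.1 hx.2.2.2).isAdmissible (x := 1) (y := 1 / 2)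
      zero_le_one le_rfl (by norm_num) (Or.inl one_pos) (Or.inr (by norm_num))
    rwa [show ((1 / 2 : ℝ) : ℂ) - ((1 : ℝ) : ℂ) * (x.2 + x.1) = 1 / 2 - x.1 - x.2 by
      push_cast; ring] at this
  have hs : DifferentiableOn ℂ (fun x : ℂ × ℂ => sConst p x.2) transDomain := by
    unfold sConst
    exact (DifferentiableOn.cpow_const (f := fun x : ℂ × ℂ => x.2) (by fun_prop) hτ).const_mul _
  unfold transBlock
  refine hs.mul (DifferentiableOn.fun_sum fun μ _ => ?_)
  exact (hpre.mul ((h1 μ).sub ((h2 (μ - 2)).const_mul _))).const_mul _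

theorem mem_doubleCell_iff {x : ℂ × ℂ} : x ∈ doubleCell ↔
    0 < x.2.im ∧ -1 < latX x.1 x.2 ∧ latX x.1 x.2 < 0 ∧ -1 < latY x.1 x.2 ∧ latY x.1 x.2 < 1 := by
  constructor
  · rintro ⟨hτ, a, b, a0, a1, b0, b1, e⟩
    have hX := latX_lattice hτ a b
    have hY := latY_lattice hτ a b
    rw [← e, latX_neg] at hX
    rw [← e, latY_neg] at hY
    refine ⟨hτ, ?_, ?_, ?_, ?_⟩ <;> linarith
  · rintro ⟨hτ, h0, h1, h2, h3⟩
    refine ⟨hτ, -latX x.1 x.2, -latY x.1 x.2, by linarith, by linarith, by linarith, by linarith, ?_⟩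
    conv_lhs => rw [← latX_add_latY hτ x.1]
    push_cast
    ring

theorem mem_cell_iff {x : ℂ × ℂ} : x ∈ cell ↔
    0 < x.2.im ∧ -1 < latX x.1 x.2 ∧ latX x.1 x.2 < 0 ∧ -1 < latY x.1 x.2 ∧ latY x.1 x.2 < 0 := by
  constructor
  · rintro ⟨hτ, a, b, a0, a1, b0, b1, e⟩
    have hX := latX_lattice hτ a b
    have hY := latY_lattice hτ a b
    rw [← e, latX_neg] at hX
    rw [← e, latY_neg] at hY
    refine ⟨hτ, ?_, ?_, ?_, ?_⟩ <;> linarith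
  · rintro ⟨hτ, h0, h1, h2, h3⟩
    refine ⟨hτ, -latX x.1 x.2, -latY x.1 x.2, by linarith, by linarith, by linarith, by linarith, ?_⟩
    conv_lhs => rw [← latX_add_latY hτ x.1]
    push_cast
    ring

/-- The continuation of the block `F_n^+`. -/
def contBlock (p : ℕ) (n : ℤ) (x : ℂ × ℂ) : ℂ := transBlock p n (-(x.1 / x.2)) (-1 / x.2)

/-- Two inversions lead from (z, τ) to (-z, τ), whence the sign in `contBlock`. In lattice
coordinates the point (-z/τ, -1/τ) runs over `transDomain` as (z, τ) runs over `doubleCell`, and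
`blockPlus_div` applies on the cell. -/
theorem isClockwiseContinuation_contBlock (hp : 1 < p) (n : ℤ) :
    IsClockwiseContinuation (blockPlus p n) (contBlock p n) := by
  constructor
  · refine (differentiableOn_transBlock hp n).comp
      (f := fun x : ℂ × ℂ => (-(x.1 / x.2), -1 / x.2)) ?_ fun x hx => ?_
    · have hinv : DifferentiableOn ℂ (fun x : ℂ × ℂ => x.2⁻¹) doubleCell :=
        DifferentiableOn.inv (by fun_prop) fun x hx => by
          have := hx.1
          rintro h
          rw [h] at this
          simp at this
      simp only [div_eq_mul_inv]
      exact (DifferentiableOn.mul (by fun_prop) hinv).neg.prodMk (hinv.const_mul _)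
    · obtain ⟨hτ, h0, h1, h2, h3⟩ := mem_doubleCell_iff.1 hx
      obtain ⟨hX, hY⟩ := latX_latY_div hτ x.1
      refine ⟨im_neg_one_div hτ, ?_, ?_, ?_⟩
      · simp only [latX_neg, hX, abs_neg, abs_lt]
        exact ⟨h2, h3⟩
      · simp only [latY_neg, hY]; linarith
      · simp only [latY_neg, hY]; linarith
  · intro x hx
    obtain ⟨hτ, h0, h1, h2, h3⟩ := mem_cell_iff.1 hx
    obtain ⟨hX, hY⟩ := latX_latY_div hτ x.1
    have hτ0 : x.2 ≠ 0 := by rintro h; rw [h] at hτ; simp at hτ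
    rw [contBlock, ← blockPlus_div hp n (im_neg_one_div hτ) (by rw [latX_neg, hX]; linarith)
      (by rw [latX_neg, hX]; linarith) (by rw [latY_neg, hY]; linarith)
      (by rw [latY_neg, hY]; linarith)]
    congr 1
    · field_simp
    · field_simp

theorem isOpen_doubleCell : IsOpen doubleCell := by
  have h : doubleCell = (fun x : ℂ × ℂ => (x.2, x.1)) ⁻¹' ({y : ℂ × ℂ | 0 < y.1.im} ∩
      (fun y => (latX y.2 y.1, latY y.2 y.1)) ⁻¹' (Ioo (-1 : ℝ) 0 ×ˢ Ioo (-1 : ℝ) 1)) := by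
    ext x
    rw [mem_doubleCell_iff]
    simp [and_assoc]
  rw [h]
  exact ((continuousOn_latX.prodMk continuousOn_latY).isOpen_inter_preimage isOpen_upper
    (isOpen_Ioo.prod isOpen_Ioo)).preimage (by fun_prop)

theorem isOpen_cell : IsOpen cell := by
  have h : cell = (fun x : ℂ × ℂ => (x.2, x.1)) ⁻¹' ({y : ℂ × ℂ | 0 < y.1.im} ∩
      (fun y => (latX y.2 y.1, latY y.2 y.1)) ⁻¹' (Ioo (-1 : ℝ) 0 ×ˢ Ioo (-1 : ℝ) 0)) := by
    ext x
    rw [mem_cell_iff]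
    simp [and_assoc]
  rw [h]
  exact ((continuousOn_latX.prodMk continuousOn_latY).isOpen_inter_preimage isOpen_upper
    (isOpen_Ioo.prod isOpen_Ioo)).preimage (by fun_prop)

theorem convex_doubleCell_fiber (τ : ℂ) : Convex ℝ {z | (z, τ) ∈ doubleCell} := by
  intro u hu v hv a b ha hb hab
  obtain ⟨hτ, h0, h1, h2, h3⟩ := mem_doubleCell_iff.1 hu
  obtain ⟨-, g0, g1, g2, g3⟩ := mem_doubleCell_iff.1 hv
  have hb' : b = 1 - a := by linarith
  refine mem_doubleCell_iff.2 ⟨hτ, ?_, ?_, ?_, ?_⟩ <;>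
    simp only [Complex.real_smul, latX_add, latY_add, latX_real_mul, latY_real_mul] <;>
    simp only at h0 h1 h2 h3 g0 g1 g2 g3 <;> rcases ha.eq_or_lt with rfl | ha
  all_goals first | (rw [hb']; linarith) | (subst hb'; nlinarith)

/-- Continuations to the double cell are unique. -/
theorem IsClockwiseContinuation.eqOn {f : ℂ → ℂ → ℂ} {G₁ G₂ : ℂ × ℂ → ℂ}
    (h₁ : IsClockwiseContinuation f G₁) (h₂ : IsClockwiseContinuation f G₂) :
    EqOn G₁ G₂ doubleCell := by
  rintro ⟨z, τ⟩ hx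
  have hτ := hx.1
  have hD : IsOpen {z | (z, τ) ∈ doubleCell} :=
    isOpen_doubleCell.preimage (f := fun z : ℂ => (z, τ)) (by fun_prop)
  have ha : ∀ {G : ℂ × ℂ → ℂ}, DifferentiableOn ℂ G doubleCell →
      AnalyticOnNhd ℂ (fun z => G (z, τ)) {z | (z, τ) ∈ doubleCell} := fun hG =>
    (hG.comp (f := fun z : ℂ => (z, τ)) (by fun_prop) fun z hz => hz).analyticOnNhd hD
  -- The centre of the cell: both continuations agree near it, and the fibre of the double cell over
  -- τ is convex, hence connected.
  have hc : ((-((1 / 2 : ℝ) + (1 / 2 : ℝ) * τ) : ℂ), τ) ∈ cell :=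
    ⟨hτ, 1 / 2, 1 / 2, by norm_num, by norm_num, by norm_num, by norm_num, by simp⟩
  have hc' : ((-((1 / 2 : ℝ) + (1 / 2 : ℝ) * τ) : ℂ), τ) ∈ doubleCell :=
    ⟨hτ, 1 / 2, 1 / 2, by norm_num, by norm_num, by norm_num, by norm_num, by simp⟩
  refine (ha h₁.1).eqOn_of_preconnected_of_eventuallyEq (ha h₂.1)
    (convex_doubleCell_fiber τ).isPreconnected hc' ?_ hx
  filter_upwards [(isOpen_cell.preimage (f := fun z : ℂ => (z, τ)) (by fun_prop)).mem_nhds hc]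
    with v hv
  rw [h₁.2 _ hv, h₂.2 _ hv]

theorem div_mem_doubleCell (h : (z, τ) ∈ cell) : (z / τ, -1 / τ) ∈ doubleCell := by
  obtain ⟨hτ, h0, h1, h2, h3⟩ := mem_cell_iff.1 h
  obtain ⟨hX, hY⟩ := latX_latY_div hτ z
  simp only at h0 h1 h2 h3
  refine mem_doubleCell_iff.2 ⟨im_neg_one_div hτ, ?_, ?_, ?_, ?_⟩ <;> simp only [hX, hY] <;> linarith

theorem contBlock_div (p : ℕ) (n : ℤ) (hτ : 0 < τ.im) (z : ℂ) :
    contBlock p n (z / τ, -1 / τ) = transBlock p n z τ := by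
  have hτ0 : τ ≠ 0 := by rintro rfl; simp at hτ
  rw [contBlock]
  congr 1
  · field_simp
  · field_simp

end Continuation

/-! ### Sums of periodic sequences over one period -/

section PeriodicSums

variable {N : ℕ} {f h Z : ℤ → ℂ}

theorem sum_range_add_one_of_periodic (hf : Function.Periodic f (N : ℤ)) :
    ∑ i ∈ Finset.range N, f (i + 1) = ∑ i ∈ Finset.range N, f i := by
  have h1 := Finset.sum_range_succ (fun i : ℕ => f i) N
  have h2 := Finset.sum_range_succ' (fun i : ℕ => f i) N
  have h3 := hf 0
  rw [zero_add] at h3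
  push_cast at h1 h2
  linear_combination h1 - h2 + h3

theorem sum_range_add_of_periodic (hf : Function.Periodic f (N : ℤ)) (c : ℤ) :
    ∑ i ∈ Finset.range N, f (i + c) = ∑ i ∈ Finset.range N, f i := by
  induction c with
  | zero => simp
  | succ m ih =>
    rw [← ih, ← sum_range_add_one_of_periodic (f := fun i => f (i + m))]
    · exact Finset.sum_congr rfl fun i _ => congrArg f (by ring)
    · exact fun x => (congrArg f (by ring)).trans (hf (x + m))
  | pred m ih =>
    rw [← ih, ← sum_range_add_one_of_periodic (f := fun i => f (i + (-m - 1)))]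
    · exact Finset.sum_congr rfl fun i _ => congrArg f (by ring)
    · exact fun x => (congrArg f (by ring)).trans (hf (x + (-m - 1)))

theorem sum_range_sub_of_periodic (hf : Function.Periodic f (N : ℤ)) (c : ℤ) :
    ∑ i ∈ Finset.range N, f (c - i) = ∑ i ∈ Finset.range N, f i := by
  rw [← Finset.sum_range_reflect, ← sum_range_add_of_periodic hf (c + 1 - N)]
  refine Finset.sum_congr rfl fun i hi => congrArg f ?_
  have := Finset.mem_range.1 hi
  lia

/-- The sum is averaged with its image under i ↦ c - i. -/
theorem sum_mul_of_antisymmetric (hh : Function.Periodic h (N : ℤ))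
    (hZ : Function.Periodic Z (N : ℤ)) {c : ℤ} (hc : ∀ i, Z (c - i) = -Z i) :
    ∑ i ∈ Finset.range N, h i * Z i =
      (∑ i ∈ Finset.range N, (h i - h (c - i)) * Z i) / 2 := by
  have h1 := sum_range_sub_of_periodic (hh.mul hZ) c
  have h2 : ∑ i ∈ Finset.range N, (h i - h (c - i)) * Z i =
      ∑ i ∈ Finset.range N, (h * Z) i + ∑ i ∈ Finset.range N, (h * Z) (c - i) := by
    rw [← Finset.sum_add_distrib]
    refine Finset.sum_congr rfl fun i _ => ?_
    rw [Pi.mul_apply, Pi.mul_apply, hc]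
    ring
  rw [h2, h1]
  simp only [Pi.mul_apply]
  ring

/-- The divisibility says n ≡ c - n modulo 2p, so Z n = -Z n. -/
theorem eq_zero_of_antisymmetric {p : ℤ} (hZ : Function.Periodic Z (2 * p)) {c n : ℤ}
    (hc : ∀ i, Z (c - i) = -Z i) (hn : p * 2 ∣ 2 * n - c) : Z n = 0 := by
  obtain ⟨k, hk⟩ := hn
  have h1 := hZ.zsmul k (c - n)
  rw [smul_eq_mul, show c - n + k * (2 * p) = n by linear_combination -hk, hc] at h1
  have h2 : 2 * Z n = 0 := by linear_combination h1
  exact (mul_eq_zero.1 h2).resolve_left two_ne_zero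

end PeriodicSums

/-! ### Solving the relations for the coefficients -/

section Coefficients

variable {p : ℕ}

theorem qt_ne_zero (p : ℕ) (x : ℂ) : qt p x ≠ 0 := Complex.exp_ne_zero _

theorem qt_neg (p : ℕ) (x : ℂ) : qt p (-x) = (qt p x)⁻¹ :=
  eq_inv_of_mul_eq_one_left (qt_neg_mul p x)

theorem qt_intCast_eq_one_iff (hp : 0 < p) (m : ℤ) : qt p m = 1 ↔ (p : ℤ) ∣ m := by
  have hpc : (p : ℂ) ≠ 0 := by exact_mod_cast hp.ne'
  have hpi : (2 * Real.pi * Complex.I : ℂ) ≠ 0 := Complex.two_pi_I_ne_zero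
  rw [qt, Complex.exp_eq_one_iff]
  constructor
  · rintro ⟨k, hk⟩
    refine ⟨k, ?_⟩
    have : (2 * Real.pi * Complex.I : ℂ) * m = 2 * Real.pi * Complex.I * (p * k) := by
      field_simp at hk
      linear_combination (2 * Real.pi * Complex.I : ℂ) * hk
    exact_mod_cast mul_left_cancel₀ hpi this
  · rintro ⟨k, rfl⟩
    refine ⟨k, ?_⟩
    push_cast
    field_simp

theorem qt_half (hp : 0 < p) (n : ℤ) : qt p (-((n : ℂ) * p) / 2) = (-1) ^ n := by
  have hpc : (p : ℂ) ≠ 0 := by exact_mod_cast hp.ne'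
  rw [qt, show 2 * Real.pi * Complex.I / (p : ℂ) * (-((n : ℂ) * p) / 2) =
    ((-n : ℤ) : ℂ) * (Real.pi * Complex.I) by push_cast; field_simp, Complex.exp_int_mul,
    Complex.exp_pi_mul_I, zpow_neg, ← inv_zpow, inv_neg, inv_one]

theorem qt_half' (hp : 0 < p) (n : ℤ) : qt p (((n : ℂ) * p) / 2) = (-1) ^ n := by
  have := qt_half hp (-n)
  push_cast at this
  rw [neg_mul, neg_neg] at this
  rw [this, zpow_neg, ← inv_zpow, inv_neg, inv_one]

/-- The relations between the integrals of `core` along the three kinds of segments, for index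
functions of period `2 p`. -/
structure BlockRelations (p : ℕ) (F X Y : ℤ → ℂ) : Prop where
  periodicF : Function.Periodic F (2 * p)
  periodicX : Function.Periodic X (2 * p)
  periodicY : Function.Periodic Y (2 * p)
  negX : ∀ n, X (-n) = -X n
  two_subY : ∀ n, Y (2 - n) = -Y n
  relX : ∀ n : ℤ, (1 - qt p (-n)) * X n = F n + qt p (-n) * F (-n)
  relY : ∀ n : ℤ, (1 - qt p (1 - n)) * Y n = -(qt p (-n) * F (-n)) - qt p (-1) * F (n - 2)

variable {F X Y : ℤ → ℂ}

/-- The coefficients of the transformation, over all residues modulo `2 p`. -/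
def modCoeff (p : ℕ) (n m : ℤ) : ℂ :=
  (qt p (-((n : ℂ) * m) / 2) - qt p (((n : ℂ) * m) / 2)) / (1 - qt p (-m)) -
    qt p (-1) * (qt p (-((n : ℂ) * (m + 2)) / 2) - qt p (((n : ℂ) * m) / 2)) / (1 - qt p (-1 - m))

theorem one_sub_qt_ne_zero (hp : 0 < p) {m : ℤ} (hm : ¬ (p : ℤ) ∣ m) : 1 - qt p m ≠ 0 :=
  fun h => hm ((qt_intCast_eq_one_iff hp m).1 (sub_eq_zero.1 h).symm)

/-- No index is exceptional: if p divides n, the quotient is 0 because its denominator is 0, and X n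
vanishes by antisymmetry and periodicity. -/
theorem BlockRelations.eqX (h : BlockRelations p F X Y) (hp : 0 < p) (n : ℤ) :
    X n = (F n + qt p (-n) * F (-n)) / (1 - qt p (-n)) := by
  by_cases hn : (p : ℤ) ∣ -n
  · have h1 := (qt_intCast_eq_one_iff hp (-n)).2 hn
    push_cast at h1
    rw [h1, sub_self, div_zero]
    refine eq_zero_of_antisymmetric (c := 0) h.periodicX (fun i => by rw [zero_sub, h.negX]) ?_
    obtain ⟨k, hk⟩ := hn
    exact ⟨-k, by linear_combination -2 * hk⟩
  · have h1 := one_sub_qt_ne_zero hp hn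
    push_cast at h1
    rw [eq_div_iff h1, ← h.relX]
    ring

/-- The same holds with centre of symmetry 1, the exceptional indices being n ≡ 1 modulo p. -/
theorem BlockRelations.eqY (h : BlockRelations p F X Y) (hp : 0 < p) (n : ℤ) :
    Y n = (-(qt p (-n) * F (-n)) - qt p (-1) * F (n - 2)) / (1 - qt p (1 - n)) := by
  by_cases hn : (p : ℤ) ∣ 1 - n
  · have h1 := (qt_intCast_eq_one_iff hp (1 - n)).2 hn
    push_cast at h1
    rw [h1, sub_self, div_zero]
    refine eq_zero_of_antisymmetric (c := 2) h.periodicY h.two_subY ?_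
    obtain ⟨k, hk⟩ := hn
    exact ⟨-k, by linear_combination -2 * hk⟩
  · have h1 := one_sub_qt_ne_zero hp hn
    push_cast at h1
    rw [eq_div_iff h1, ← h.relY]
    ring

/-- For p ∣ n the indices n and -n agree modulo 2p, and the relation for X degenerates to 0 = 2 F n.
-/
theorem BlockRelations.eq_zero_of_dvd (h : BlockRelations p F X Y) (hp : 0 < p) {n : ℤ} (hn : (p : ℤ) ∣ n) :
    F n = 0 := by
  have h1 := (qt_intCast_eq_one_iff hp (-n)).2 (hn.neg_right)
  have h2 := h.relX n
  push_cast at h1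
  obtain ⟨k, rfl⟩ := hn
  have h3 := h.periodicF.zsmul k (-(p * k))
  rw [smul_eq_mul, show -(p * k) + k * (2 * p) = (p * k : ℤ) by ring] at h3
  rw [h1, ← h3] at h2
  have h4 : 2 * F (p * k) = 0 := by linear_combination -h2
  exact (mul_eq_zero.1 h4).resolve_left two_ne_zero

/-- The relation for Y at index -n has left side 0, and its two block indices n and -n - 2 agree
modulo 2p. -/
theorem BlockRelations.eq_zero_of_dvd_add_one (h : BlockRelations p F X Y) (hp : 0 < p) {n : ℤ} (hn : (p : ℤ) ∣ n + 1) :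
    F n = 0 := by
  have h1 := (qt_intCast_eq_one_iff hp (n + 1)).2 hn
  have h2 := h.relY (-n)
  push_cast at h1 h2
  obtain ⟨k, hk⟩ := hn
  have h3 := h.periodicF.zsmul k (-n - 2)
  rw [smul_eq_mul, show -n - 2 + k * (2 * p) = n by linear_combination -2 * hk] at h3
  have h5 : qt p n = qt p (-1) := by
    rw [qt_add] at h1
    rw [qt_neg]
    exact eq_inv_of_mul_eq_one_left h1
  rw [sub_neg_eq_add, add_comm (1 : ℂ), h1, ← h3, neg_neg, neg_neg, h3, h5] at h2
  have h4 : 2 * qt p (-1) * F n = 0 := by linear_combination h2 + 2 * qt p (-1) * h3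
  exact (mul_eq_zero.1 h4).resolve_left (mul_ne_zero two_ne_zero (qt_ne_zero p _))

/-- True also for r = 1, where both denominators vanish. This keeps the coefficient algebra free of
case distinctions. -/
theorem div_one_sub_inv {r : ℂ} (hr : r ≠ 0) (x : ℂ) : x / (1 - r⁻¹) = -(x * r) / (1 - r) := by
  by_cases h : r = 1
  · simp [h]
  · have h1 : 1 - r ≠ 0 := sub_ne_zero.2 (Ne.symm h)
    have h2 : r - 1 ≠ 0 := sub_ne_zero.2 h
    field_simp
    ring

theorem periodic_qt (hp : 0 < p) (n c : ℤ) :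
    Function.Periodic (fun m : ℤ => qt p ((n : ℂ) * (m + c) / 2)) (2 * p) := fun m => by
  have h := (qt_intCast_eq_one_iff hp (n * p)).2 (Dvd.intro_left n rfl)
  push_cast at h ⊢
  rw [show (n : ℂ) * (m + 2 * p + c) / 2 = n * (m + c) / 2 + n * p by ring, qt_add, h, mul_one]

theorem periodic_qt' (hp : 0 < p) (c : ℤ) :
    Function.Periodic (fun m : ℤ => qt p (c - (m : ℂ))) (2 * p) := fun m => by
  have h := (qt_intCast_eq_one_iff hp (-(2 * p))).2 ⟨-2, by ring⟩
  push_cast at h ⊢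
  rw [show (c : ℂ) - (m + 2 * p) = c - m + -(2 * p) by ring, qt_add, h, mul_one]

/-- After antisymmetrising and inserting the solved relations, the two block terms of X are one
periodic sequence g₁ and its reflection. Those of Y are a reflection and a shift of one sequence g₂.
The factor 1/2 absorbs the two copies. -/
theorem BlockRelations.sum_eq (h : BlockRelations p F X Y) (hp : 0 < p) (n : ℤ) :
    ∑ μ ∈ Finset.range (2 * p), qt p (-((n : ℂ) * μ) / 2) * (X μ + Y μ) =
      ∑ μ ∈ Finset.range (2 * p), modCoeff p n μ * F μ := by
  have hN : ((2 * p : ℕ) : ℤ) = 2 * p := by push_cast; rfl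
  set H : ℤ → ℂ := fun m => qt p (-((n : ℂ) * m) / 2) with hH
  have hHneg : ∀ m : ℤ, qt p ((n : ℂ) * m / 2) = H (-m) := fun m => by
    simp only [hH]
    push_cast
    congr 1
    ring
  have hHper : Function.Periodic H (2 * p) := by
    have := periodic_qt hp (-n) 0
    push_cast at this
    simpa [hH] using this
  have hHper' : Function.Periodic (fun m => H (-m)) (2 * p) := fun m => by
    have := hHper.neg (-m)
    exact (congrArg H (by ring)).trans this
  set g₁ : ℤ → ℂ := fun m => (H m - H (-m)) / (1 - qt p (-m)) * F m with hg₁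
  set g₂ : ℤ → ℂ := fun m => -(qt p (-1) * (H (m + 2) - H (-m)) / (1 - qt p (-1 - m))) * F m with hg₂
  have q1 : Function.Periodic (fun m : ℤ => qt p (-(m : ℂ))) (2 * p) := by
    simpa using periodic_qt' hp 0
  have q2 : Function.Periodic (fun m : ℤ => qt p (-1 - (m : ℂ))) (2 * p) := by
    simpa using periodic_qt' hp (-1)
  have p1 : Function.Periodic g₁ ((2 * p : ℕ) : ℤ) := fun m => by
    have e1 := hHper m
    have e2 := hHper' m
    have e3 := q1 m
    have e4 := h.periodicF m
    simp only at e1 e2 e3 e4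
    simp only [hg₁, hN]
    rw [e1, e2, e3, e4]
  have p2 : Function.Periodic g₂ ((2 * p : ℕ) : ℤ) := fun m => by
    have e1 := hHper (m + 2)
    have e2 := hHper' m
    have e3 := q2 m
    have e4 := h.periodicF m
    simp only at e1 e2 e3 e4
    simp only [hg₂, hN]
    rw [e2, e3, e4, ← e1, show m + 2 * (p : ℤ) + 2 = m + 2 + 2 * p by ring]
  have sX : ∑ μ ∈ Finset.range (2 * p), H μ * X μ = ∑ μ ∈ Finset.range (2 * p), g₁ μ := by
    rw [sum_mul_of_antisymmetric (hN ▸ hHper) (hN ▸ h.periodicX) (c := 0)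
      (fun i => by rw [zero_sub, h.negX])]
    have e : ∑ μ ∈ Finset.range (2 * p), (H μ - H (0 - μ)) * X μ =
        ∑ μ ∈ Finset.range (2 * p), g₁ μ + ∑ μ ∈ Finset.range (2 * p), g₁ (0 - μ) := by
      rw [← Finset.sum_add_distrib]
      refine Finset.sum_congr rfl fun i _ => ?_
      simp only [hg₁, zero_sub, neg_neg]
      rw [h.eqX hp]
      push_cast
      rw [neg_neg, qt_neg, div_one_sub_inv (qt_ne_zero p _), div_one_sub_inv (qt_ne_zero p _)]
      have := qt_ne_zero p (i : ℂ)
      field_simp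
      ring
    rw [e, sum_range_sub_of_periodic p1]
    ring
  have sY : ∑ μ ∈ Finset.range (2 * p), H μ * Y μ = ∑ μ ∈ Finset.range (2 * p), g₂ μ := by
    rw [sum_mul_of_antisymmetric (hN ▸ hHper) (hN ▸ h.periodicY) (c := 2) h.two_subY]
    have e : ∑ μ ∈ Finset.range (2 * p), (H μ - H (2 - μ)) * Y μ =
        ∑ μ ∈ Finset.range (2 * p), g₂ (0 - μ) + ∑ μ ∈ Finset.range (2 * p), g₂ (μ + -2) := by
      rw [← Finset.sum_add_distrib]
      refine Finset.sum_congr rfl fun i _ => ?_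
      simp only [hg₂, zero_sub, neg_neg]
      rw [h.eqY hp, neg_add_cancel_right, show -(i : ℤ) + 2 = 2 - i by ring,
        show -((i : ℤ) + -2) = 2 - i by ring, show (i : ℤ) + -2 = i - 2 by ring]
      push_cast
      rw [show (-1 : ℂ) - -i = -(1 - i) by ring, show (-1 : ℂ) - (i - 2) = 1 - i by ring,
        qt_neg p (1 - i), div_one_sub_inv (qt_ne_zero p _),
        show qt p (-(i : ℂ)) = qt p (-1) * qt p (1 - i) by rw [← qt_add]; ring_nf]
      ring
    rw [e, sum_range_sub_of_periodic p2, sum_range_add_of_periodic p2]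
    ring
  simp only [mul_add, Finset.sum_add_distrib]
  have e3 : ∀ m : ℤ, modCoeff p n m * F m = g₁ m + g₂ m := fun m => by
    simp only [hg₁, hg₂, modCoeff, ← hHneg]
    simp only [hH]
    push_cast
    ring
  have e4 : ∀ m : ℕ, modCoeff p n m * F m = g₁ m + g₂ m := fun m => e3 m
  rw [Finset.sum_congr rfl fun m _ => e4 m, Finset.sum_add_distrib, ← sX, ← sY]
  rfl

/-- The sign is q̃^(±np/2) = (-1)^n; the denominators have period p. -/
theorem modCoeff_add (hp : 0 < p) (n m : ℤ) :
    modCoeff p n (m + p) = (-1) ^ n * modCoeff p n m := by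
  have h := (qt_intCast_eq_one_iff hp (-p)).2 ⟨-1, by ring⟩
  push_cast at h
  have e1 : qt p (-((n : ℂ) * ((m + p : ℤ) : ℂ)) / 2) = (-1) ^ n * qt p (-((n : ℂ) * m) / 2) := by
    rw [← qt_half hp, ← qt_add]
    push_cast
    ring_nf
  have e2 : qt p ((n : ℂ) * ((m + p : ℤ) : ℂ) / 2) = (-1) ^ n * qt p ((n : ℂ) * m / 2) := by
    rw [← qt_half' hp, ← qt_add]
    push_cast
    ring_nf
  have e3 : qt p (-((n : ℂ) * (((m + p : ℤ) : ℂ) + 2)) / 2) =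
      (-1) ^ n * qt p (-((n : ℂ) * (m + 2)) / 2) := by
    rw [← qt_half hp, ← qt_add]
    push_cast
    ring_nf
  have e4 : qt p (-((m + p : ℤ) : ℂ)) = qt p (-m) := by
    rw [← mul_one (qt p (-m)), ← h, ← qt_add]
    push_cast
    ring_nf
  have e5 : qt p (-1 - ((m + p : ℤ) : ℂ)) = qt p (-1 - m) := by
    rw [← mul_one (qt p (-1 - m)), ← h, ← qt_add]
    push_cast
    ring_nf
  rw [modCoeff, modCoeff, e1, e2, e3, e4, e5]
  ring

theorem mul_modCoeff (hp : 0 < p) (n m : ℤ) (hm : ¬ (p : ℤ) ∣ m) (hm' : ¬ (p : ℤ) ∣ m + 1) :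
    Complex.I / ((Real.sqrt (2 * (p : ℝ)) : ℝ) : ℂ) * modCoeff p n m = coeffC p n m := by
  have h1 := one_sub_qt_ne_zero hp hm
  have h2 := one_sub_qt_ne_zero hp hm'
  push_cast at h2
  have e1 : qt p ((n : ℂ) * m / 2) = qt p (-((n : ℂ) * m) / 2) * qt p (n * m) := by
    rw [← qt_add]; ring_nf
  have e2 : qt p (-((n : ℂ) * (m + 2)) / 2) = qt p (-((n : ℂ) * m) / 2) * (qt p n)⁻¹ := by
    rw [← qt_neg, ← qt_add]; ring_nf
  have e3 : qt p (-1 - (m : ℂ)) = (qt p m * qt p 1)⁻¹ := by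
    rw [← qt_add, ← qt_neg]; ring_nf
  have e4 : qt p ((m : ℂ) - n) = qt p m * (qt p n)⁻¹ := by
    rw [← qt_neg, ← qt_add]; ring_nf
  have e5 : qt p (2 * (m : ℂ) - n) = qt p m * qt p m * (qt p n)⁻¹ := by
    rw [← qt_neg, ← qt_add, ← qt_add]; ring_nf
  have e6 : qt p ((n : ℂ) * m + 2 * m) = qt p (n * m) * qt p m * qt p m := by
    rw [← qt_add, ← qt_add]; ring_nf
  have e7 : qt p ((n : ℂ) * m + 2 * m + 1) = qt p (n * m) * qt p m * qt p m * qt p 1 := by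
    rw [← qt_add, ← qt_add, ← qt_add]; ring_nf
  have e8 : qt p (2 * (m : ℂ) + 1) = qt p m * qt p m * qt p 1 := by
    rw [← qt_add, ← qt_add]; ring_nf
  have e9 : qt p ((m : ℂ) + 1) = qt p m * qt p 1 := qt_add _ _ _
  rw [e9] at h2
  have n1 := qt_ne_zero p m
  have n2 := qt_ne_zero p 1
  have n3 := qt_ne_zero p n
  rw [modCoeff, coeffC, e1, e2, e3, e4, e5, e6, e7, e8, e9, qt_neg p m, qt_neg p 1, mul_assoc]
  congr 1
  rw [div_one_sub_inv n1, div_one_sub_inv (mul_ne_zero n1 n2)]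
  field_simp
  ring

theorem sum_Icc_one_eq (k : ℕ) (f : ℤ → ℂ) :
    ∑ μ ∈ Finset.Icc (1 : ℤ) k, f μ = ∑ i ∈ Finset.range k, f (i + 1) := by
  induction k with
  | zero => simp
  | succ k ih =>
    rw [Finset.sum_range_succ, ← ih]
    have : Finset.Icc (1 : ℤ) ((k + 1 : ℕ) : ℤ) = insert ((k : ℤ) + 1) (Finset.Icc (1 : ℤ) k) := by
      ext x
      simp only [Finset.mem_Icc, Finset.mem_insert]
      push_cast
      lia
    rw [this, Finset.sum_insert (by simp), add_comm]

/-- The 2p residues are folded into pairs μ, μ + p, and F_(p+μ) = F_(-(p-μ)) is the minus block of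
index p - μ. The classes μ = 0 and μ = p - 1 drop out, exactly those where the denominators of
`coeffC` vanish. -/
theorem BlockRelations.sum_eq_coeffC (k : ℕ) (hp : p = k + 2) (h : BlockRelations p F X Y) (n : ℤ) :
    Complex.I / ((Real.sqrt (2 * (p : ℝ)) : ℝ) : ℂ) *
      ∑ μ ∈ Finset.range (2 * p), qt p (-((n : ℂ) * μ) / 2) * (X μ + Y μ) =
      ∑ μ ∈ Finset.Icc (1 : ℤ) ((p : ℤ) - 2),
        coeffC p n μ * (F μ + (-1) ^ n * F (-(p - μ))) := by
  have hp0 : 0 < p := by lia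
  have e1 : ∀ m : ℤ, F (p + m) = F (-(p - m)) := fun m => by
    have := h.periodicF (-(p - m))
    rw [← this]
    congr 1
    ring
  have e2 : ∑ μ ∈ Finset.range (2 * p), modCoeff p n μ * F μ =
      ∑ i ∈ Finset.range p, modCoeff p n i * (F i + (-1) ^ n * F (p + i)) := by
    rw [two_mul, Finset.sum_range_add, ← Finset.sum_add_distrib]
    refine Finset.sum_congr rfl fun i _ => ?_
    have := modCoeff_add hp0 n i
    push_cast
    rw [add_comm (p : ℤ) i, this]
    ring
  have z1 : F 0 = 0 := h.eq_zero_of_dvd hp0 (dvd_zero _)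
  have z2 : F (p + 0) = 0 := h.eq_zero_of_dvd hp0 (by rw [add_zero])
  have z3 : F ((k + 1 : ℕ) : ℤ) = 0 := h.eq_zero_of_dvd_add_one hp0 ⟨1, by rw [hp]; push_cast; ring⟩
  have z4 : F (p + ((k + 1 : ℕ) : ℤ)) = 0 := h.eq_zero_of_dvd_add_one hp0 ⟨2, by rw [hp]; push_cast; ring⟩
  have hk : (p : ℤ) - 2 = k := by rw [hp]; push_cast; ring
  rw [h.sum_eq hp0, e2, hk, sum_Icc_one_eq]
  have hsub : ∀ g : ℕ → ℂ, g 0 = 0 → g (k + 1) = 0 →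
      ∑ i ∈ Finset.range p, g i = ∑ i ∈ Finset.range k, g (i + 1) := fun g g0 g1 => by
    rw [hp, Finset.sum_range_succ, g1, add_zero, Finset.sum_range_succ', g0, add_zero]
  rw [hsub, Finset.mul_sum]
  · refine Finset.sum_congr rfl fun i hi => ?_
    have hi' := Finset.mem_range.1 hi
    have hd : ∀ m : ℤ, 0 < m → m < p → ¬ (p : ℤ) ∣ m := fun m h0 h1 hd =>
      absurd (Int.le_of_dvd h0 hd) (by lia)
    rw [← mul_modCoeff hp0 n _ (hd _ (by lia) (by lia)) (hd _ (by lia) (by lia)), ← e1]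
    push_cast
    ring
  · push_cast
    rw [z1, z2]
    ring
  · rw [z3, z4]
    ring

end Coefficients

/-! ### The transformation law of the blocks -/

section Transformation

variable {p : ℕ} {z τ : ℂ}

theorem prim_add_period (hp : 0 < p) (n : ℤ) (z τ t : ℂ) :
    prim p (n + 2 * p) z τ t = prim p n z τ t := by
  simp only [prim, core_add_period hp]

theorem prim_neg_add_period (hp : 0 < p) (n : ℤ) (z τ t : ℂ) :
    prim p (-(n + 2 * p)) z τ t = prim p (-n) z τ t := by
  rw [← prim_add_period hp (-(n + 2 * p))]
  congr 1
  ring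

theorem blockRelations (hp : 1 < p) (hτ : 0 < τ.im) (h0 : -1 < latY z τ) (h1 : latY z τ < 0) :
    BlockRelations p (fun n => blockPlus p n z τ) (fun n => prefactor p z τ * coreX p n z τ)
      (fun n => prefactor p z τ * coreY p n z τ) := by
  have hp0 : 0 < p := zero_lt_one.trans hp
  have hF : (fun n => blockPlus p n z τ) = fun n => prefactor p z τ * coreBlock p n z τ :=
    funext fun n => blockPlus_eq hp n hτ h0 h1
  rw [hF]
  refine ⟨fun n => ?_, fun n => ?_, fun n => ?_, fun n => ?_, fun n => ?_, fun n => ?_, fun n => ?_⟩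
  · have := periodic_qt' hp0 0 n
    simp only [Int.cast_zero, zero_sub] at this
    simp only [coreBlock]
    rw [prim_add_period hp0, prim_neg_add_period hp0, this]
  · simp only [coreX]
    rw [prim_add_period hp0, prim_neg_add_period hp0]
  · simp only [coreY]
    rw [prim_add_period hp0, ← prim_add_period hp0 (2 - (n + 2 * p)),
      show 2 - (n + 2 * (p : ℤ)) + 2 * p = 2 - n by ring]
  · simp only [coreX_neg, mul_neg]
  · simp only [coreY_two_sub, mul_neg]
  · linear_combination prefactor p z τ * coreX_relation hp n hτ h0 h1
  · linear_combination prefactor p z τ * coreY_relation hp n hτ h0 h1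

/-- The splitting into X + Y needs only the second coordinate of z, so it applies on the side
reached by continuation. -/
theorem transBlock_eq (k : ℕ) (hk : 1 ≤ k) (hp : p = k + 2) (n : ℤ) (hτ : 0 < τ.im)
    (h0 : -1 < latY z τ) (h1 : latY z τ < 0) :
    transBlock p n z τ = τ ^ (3 / (2 * (p : ℂ))) * ∑ μ ∈ Finset.Icc (1 : ℤ) ((p : ℤ) - 2),
      coeffC p n μ * (blockPlus p μ z τ + (-1) ^ n * blockMinus p ((p : ℤ) - μ) z τ) := by
  have hp1 : 1 < p := by lia
  have h := (blockRelations hp1 hτ h0 h1).sum_eq_coeffC k hp n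
  simp only [blockMinus]
  rw [← h, transBlock, sConst]
  simp only [← mul_add, coreX_add_coreY hp1 _ hτ h0 h1]
  ring

end Transformation

/-! ### Matrix form -/

section Matrices

variable {k : ℕ}

theorem matK_mulVec_separatedOrder (k : ℕ) (f : ℤ → ℂ) :
    (matK k).mulVec (separatedOrder k f) = alternatingOrder k f := by
  funext i
  have hi := i.2
  by_cases hi2 : (i : ℕ) % 2 = 0
  · have hj : k + (i : ℕ) / 2 < k + k := by lia
    rw [Matrix.mulVec, dotProduct, Finset.sum_eq_single ⟨k + (i : ℕ) / 2, hj⟩]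
    · simp only [matK, Matrix.of_apply, hi2, true_and, true_or, if_true, one_mul, separatedOrder,
        alternatingOrder]
      rw [if_neg (by lia)]
      congr 1
      push_cast
      ring
    · intro j _ hne
      have : ¬ (j : ℕ) = k + (i : ℕ) / 2 := fun h => hne (Fin.ext h)
      simp [matK, hi2, this]
    · simp
  · have hj : k - 1 - (i : ℕ) / 2 < k + k := by lia
    have hi3 : (i : ℕ) % 2 = 1 := by lia
    rw [Matrix.mulVec, dotProduct, Finset.sum_eq_single ⟨k - 1 - (i : ℕ) / 2, hj⟩]
    · have : k - 1 - (i : ℕ) / 2 + (i : ℕ) / 2 + 1 = k := by lia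
      simp only [matK, Matrix.of_apply, hi3, this, and_self, or_true, if_true, one_mul,
        separatedOrder, alternatingOrder]
      rw [if_pos (by lia), if_neg (by lia)]
      congr 1
      lia
    · intro j _ hne
      have : ¬ (j : ℕ) + (i : ℕ) / 2 + 1 = k := fun h => hne (Fin.ext (by simp only; lia))
      simp [matK, hi3, this]
    · simp

/-- The inverse permutation: the row of the single one is given as a function of the column, which
makes the orthogonality of K immediate. -/
theorem matK_apply (i j : Fin (k + k)) : matK k i j =
    if (i : ℕ) = (if (j : ℕ) < k then 2 * (k - 1 - j) + 1 else 2 * (j - k)) then 1 else 0 := by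
  have hi := i.2
  have hj := j.2
  rw [matK, Matrix.of_apply]
  congr 1
  apply propext
  split_ifs <;> lia

theorem matK_transpose_mul_matK (k : ℕ) : (matK k).transpose * matK k = 1 := by
  ext a b
  have ha := a.2
  have hb := b.2
  rw [Matrix.mul_apply, Finset.sum_eq_single
    ⟨if (a : ℕ) < k then 2 * (k - 1 - a) + 1 else 2 * (a - k), by split_ifs <;> lia⟩]
  · rw [Matrix.transpose_apply, matK_apply, matK_apply, if_pos rfl, one_mul, Matrix.one_apply]
    congr 1
    apply propext
    rw [Fin.ext_iff]
    simp only
    split_ifs <;> lia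
  · intro i _ hi
    rw [Matrix.transpose_apply, matK_apply, if_neg fun h => hi (Fin.ext h), zero_mul]
  · simp

theorem neg_one_zpow_sub (n p : ℤ) : ((-1 : ℂ)) ^ (n - p) = (-1) ^ (n + p) := by
  rw [sub_eq_add_neg, zpow_add₀ (by norm_num), zpow_add₀ (by norm_num), zpow_neg, ← inv_zpow,
    inv_neg, inv_one]

/-- This gives the lower rows of S', because the minus block of index p - n is the plus block of
index n - p. -/
theorem coeffC_sub {p : ℕ} (hp : 0 < p) (n μ : ℤ) :
    coeffC p (n - p) μ = (-1) ^ μ * coeffC p n μ := by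
  have hq := fun m : ℤ => (qt_intCast_eq_one_iff hp (p * m)).2 (Dvd.intro m rfl)
  have h1 := hq 1
  have h2 := hq (-μ)
  push_cast at h1 h2
  rw [mul_one] at h1
  have e1 : qt p (-(((n - p : ℤ) : ℂ) * μ) / 2) = (-1) ^ μ * qt p (-((n : ℂ) * μ) / 2) := by
    rw [← qt_half' hp, ← qt_add]
    push_cast
    ring_nf
  have e2 : ∀ x : ℂ, qt p (x - ((n - p : ℤ) : ℂ)) = qt p (x - n) := fun x => by
    rw [← mul_one (qt p (x - n)), ← h1, ← qt_add]
    push_cast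
    ring_nf
  have e3 : ∀ x : ℂ, qt p (((n - p : ℤ) : ℂ) * μ + x) = qt p (n * μ + x) := fun x => by
    rw [← mul_one (qt p (n * μ + x)), ← h2, ← qt_add]
    push_cast
    ring_nf
  rw [coeffC, coeffC, e1, e2, e2, e3, add_assoc, e3, add_assoc]
  ring

theorem matS'_mulVec (k : ℕ) (f g : ℤ → ℂ)
    (h : ∀ n : ℤ, g n = ∑ μ ∈ Finset.Icc (1 : ℤ) (((k + 2 : ℕ) : ℤ) - 2),
      coeffC (k + 2) n μ * (f μ + (-1) ^ n * f (-(((k + 2 : ℕ) : ℤ) - μ)))) :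
    separatedOrder k g = (matS' k).mulVec (separatedOrder k f) := by
  have hg : ∀ n : ℤ, g n = ∑ μ : Fin k, coeffC (k + 2) n (μ + 1) *
      (f (μ + 1) + (-1) ^ n * f (-((k : ℤ) + 1 - μ))) := fun n => by
    rw [h, show ((k + 2 : ℕ) : ℤ) - 2 = k by push_cast; ring, sum_Icc_one_eq,
      ← Fin.sum_univ_eq_sum_range (fun i : ℕ => coeffC (k + 2) n (i + 1) *
        (f (i + 1) + (-1) ^ n * f (-(((k + 2 : ℕ) : ℤ) - (i + 1)))))]
    refine Finset.sum_congr rfl fun μ _ => ?_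
    rw [show ((k + 2 : ℕ) : ℤ) - ((μ : ℕ) + 1) = (k : ℤ) + 1 - (μ : ℕ) by push_cast; ring]
  have hl : ∀ (v : ℤ → ℂ) (i : Fin k), separatedOrder k v (finSumFinEquiv (Sum.inl i)) =
      v (i + 1) := fun v i => by
    simp [separatedOrder]
  have hr : ∀ (v : ℤ → ℂ) (i : Fin k), separatedOrder k v (finSumFinEquiv (Sum.inr i)) =
      v (-((k : ℤ) + 1 - i)) := fun v i => by
    have hval : ((finSumFinEquiv (Sum.inr i) : Fin (k + k)) : ℕ) = k + i := by simp [add_comm]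
    rw [separatedOrder, if_neg (by rw [hval]; lia), hval]
    congr 1
    push_cast
    ring
  have hv : separatedOrder k f ∘ finSumFinEquiv =
      Sum.elim (fun i : Fin k => f (i + 1)) (fun i : Fin k => f (-((k : ℤ) + 1 - i))) := by
    funext i
    rcases i with i | i
    · exact hl f i
    · exact hr f i
  rw [matS', Matrix.reindex_apply, Matrix.submatrix_mulVec_equiv, Equiv.symm_symm, hv,
    Matrix.fromBlocks_mulVec]
  funext i
  obtain ⟨i, rfl⟩ := finSumFinEquiv.surjective i
  rw [Function.comp_apply, Equiv.symm_apply_apply]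
  rcases i with n | n
  · rw [hl, hg]
    simp only [Sum.elim_inl, Pi.add_apply, Matrix.mulVec, dotProduct, Matrix.of_apply,
      Function.comp_apply, Sum.elim_inr, ← Finset.sum_add_distrib]
    refine Finset.sum_congr rfl fun μ _ => ?_
    rw [show ((n : ℕ) : ℤ) + 1 = ((n + 1 : ℕ) : ℤ) by push_cast; rfl, zpow_natCast]
    ring
  · rw [hr, hg]
    simp only [Sum.elim_inl, Pi.add_apply, Matrix.mulVec, dotProduct, Matrix.of_apply,
      Function.comp_apply, Sum.elim_inr, ← Finset.sum_add_distrib]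
    refine Finset.sum_congr rfl fun μ _ => ?_
    -- With indices counted from 0, the lower row n stands for the block of index (n + 1) - p.
    have e : -((k : ℤ) + 1 - n) = ((n : ℕ) : ℤ) + 1 - ((k + 2 : ℕ) : ℤ) := by push_cast; ring
    have e1 : ((-1 : ℂ)) ^ ((μ : ℕ) + 1 : ℤ) = (-1) ^ ((μ : ℕ) + 1) := by
      rw [← zpow_natCast]; push_cast; rfl
    have e2 : ((-1 : ℂ)) ^ ((n : ℕ) + 1 + ((k + 2 : ℕ) : ℤ)) = (-1) ^ ((n : ℕ) + 1 + (k + 2)) := by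
      rw [← zpow_natCast]; push_cast; rfl
    rw [e, coeffC_sub (by lia), neg_one_zpow_sub, e1, e2]
    ring

theorem matS_mulVec (k : ℕ) (f g : ℤ → ℂ)
    (h : separatedOrder k g = (matS' k).mulVec (separatedOrder k f)) :
    alternatingOrder k g = (matS k).mulVec (alternatingOrder k f) := by
  rw [← matK_mulVec_separatedOrder, ← matK_mulVec_separatedOrder, h, matS, Matrix.mulVec_mulVec,
    Matrix.mulVec_mulVec, Matrix.mul_assoc, matK_transpose_mul_matK, Matrix.mul_one]

theorem smul_separatedOrder (k : ℕ) (c : ℂ) (f : ℤ → ℂ) :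
    c • separatedOrder k f = separatedOrder k fun n => c * f n := by
  funext i
  simp only [separatedOrder, Pi.smul_apply, smul_eq_mul]
  split_ifs <;> rfl

theorem smul_alternatingOrder (k : ℕ) (c : ℂ) (f : ℤ → ℂ) :
    c • alternatingOrder k f = alternatingOrder k fun n => c * f n := by
  funext i
  simp only [alternatingOrder, Pi.smul_apply, smul_eq_mul]
  split_ifs <;> rfl

end Matrices

end TorusBlocks

/-! ### The theorem -/

theorem mainTheorem3 (k : ℕ) (hk : 1 ≤ k) (p : ℕ) (hp : p = k + 2) :
    -- the blocks are well defined: the regularized integrals exist and are unique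
    (∀ n : ℤ, ∀ z τ : ℂ, (z, τ) ∈ TorusBlocks.cell →
      ∃! I : ℂ, TorusBlocks.HasFinitePart p
        (fun t : ℝ => TorusBlocks.blockForm p n z τ (t : ℂ)) I) ∧
    -- every block can be continued
    (∀ n : ℤ, ∃ G : ℂ × ℂ → ℂ,
      TorusBlocks.IsClockwiseContinuation (TorusBlocks.blockPlus p n) G) ∧
    -- and the continued blocks transform as follows
    (∀ G : ℤ → ℂ × ℂ → ℂ,
      (∀ n : ℤ, TorusBlocks.IsClockwiseContinuation (TorusBlocks.blockPlus p n) (G n)) →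
      ∀ z τ : ℂ, (z, τ) ∈ TorusBlocks.cell →
        (z / τ, -1 / τ) ∈ TorusBlocks.doubleCell ∧
        (∀ n : ℤ, G n (z / τ, -1 / τ) =
          τ ^ (3 / (2 * (p : ℂ))) * ∑ μ ∈ Finset.Icc (1 : ℤ) ((p : ℤ) - 2),
            TorusBlocks.coeffC p n μ *
              (TorusBlocks.blockPlus p μ z τ
                + (-1) ^ n * TorusBlocks.blockMinus p ((p : ℤ) - μ) z τ)) ∧
        τ ^ (-(3 / (2 * (p : ℂ)))) •
            TorusBlocks.separatedOrder k (fun n => G n (z / τ, -1 / τ)) =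
          (TorusBlocks.matS' k).mulVec
            (TorusBlocks.separatedOrder k (fun n => TorusBlocks.blockPlus p n z τ)) ∧
        TorusBlocks.alternatingOrder k (fun n => TorusBlocks.blockPlus p n z τ) =
          (TorusBlocks.matK k).mulVec
            (TorusBlocks.separatedOrder k (fun n => TorusBlocks.blockPlus p n z τ)) ∧
        τ ^ (-(3 / (2 * (p : ℂ)))) •
            TorusBlocks.alternatingOrder k (fun n => G n (z / τ, -1 / τ)) =
          (TorusBlocks.matS k).mulVec
            (TorusBlocks.alternatingOrder k (fun n => TorusBlocks.blockPlus p n z τ))) := by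
  have hp1 : 1 < p := by lia
  refine ⟨fun n z τ hx => ?_, fun n => ?_, fun G hG z τ hx => ?_⟩
  · obtain ⟨hτ, -, -, h2, h3⟩ := TorusBlocks.mem_cell_iff.1 hx
    have h := TorusBlocks.hasFinitePart_blockForm hp1 n hτ h2 h3
    exact ⟨_, h, fun J hJ => hJ.unique (by lia) h⟩
  · exact ⟨_, TorusBlocks.isClockwiseContinuation_contBlock hp1 n⟩
  · obtain ⟨hτ, -, -, h2, h3⟩ := TorusBlocks.mem_cell_iff.1 hx
    have hτ0 : τ ≠ 0 := by
      rintro rfl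
      simp at hτ
    have hD := TorusBlocks.div_mem_doubleCell hx
    have key : ∀ n : ℤ, G n (z / τ, -1 / τ) =
        τ ^ (3 / (2 * (p : ℂ))) * ∑ μ ∈ Finset.Icc (1 : ℤ) ((p : ℤ) - 2),
          TorusBlocks.coeffC p n μ *
            (TorusBlocks.blockPlus p μ z τ
              + (-1) ^ n * TorusBlocks.blockMinus p ((p : ℤ) - μ) z τ) := fun n => by
      -- By uniqueness an arbitrary continuation equals `contBlock`, whose value at (z/τ, -1/τ) is
      -- `transBlock` at (z, τ).
      rw [(hG n).eqOn (TorusBlocks.isClockwiseContinuation_contBlock hp1 n) hD,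
        TorusBlocks.contBlock_div p n hτ, TorusBlocks.transBlock_eq k hk hp n hτ h2 h3]
    have hS : TorusBlocks.separatedOrder k
          (fun n => τ ^ (-(3 / (2 * (p : ℂ)))) * G n (z / τ, -1 / τ)) =
        (TorusBlocks.matS' k).mulVec
          (TorusBlocks.separatedOrder k (fun n => TorusBlocks.blockPlus p n z τ)) := by
      refine TorusBlocks.matS'_mulVec k _ _ fun n => ?_
      rw [key n, ← mul_assoc, ← Complex.cpow_add _ _ hτ0, neg_add_cancel, Complex.cpow_zero, one_mul]
      subst hp
      rfl
    refine ⟨hD, key, ?_, (TorusBlocks.matK_mulVec_separatedOrder k _).symm, ?_⟩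
    · rw [TorusBlocks.smul_separatedOrder]
      exact hS
    · rw [TorusBlocks.smul_alternatingOrder]
      exact TorusBlocks.matS_mulVec k _ _ hS

end
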